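/- Let $c$ denote Euler's constant and $\zeta$ the Riemann zeta-function. Call a number of the form $q=\frac{x^n+y^n}{z^n}$ with positive integers $x,y,z,n$, $n\ge 3$, a Fermat rational. Let $N$ be a fixed positive integer. Then for every Fermat rational $q$ the limit $$\lim_{\tau\to\infty}\frac1\tau\int_{q\tau/(\ln 2\pi-2c)}^{(N+1)q\tau/(\ln 2\pi-2c)}\left\{\ln t-\left|\zeta\left(\tfrac12+it\right)\right|^2\right\}\,dt$$ exists and equals $Nq$. Moreover, the condition $$\lim_{\tau\to\infty}\frac1\tau\int_{q\tau/(\ln 2\pi-2c)}^{(N+1)q\tau/(\ln 2\pi-2c)}\left\{\ln t-\left|\zeta\left(\tfrac12+it\right)\right|^2\right\}\,dt\neq N\quad\text{for all Fermat rationals } q$$ (separately for each such fixed $N$) is equivalent to the Fermat–Wiles theorem, i.e. to the assertion that $x^n+y^n=z^n$ has no solution in positive integers $x,y,z,n$ with $n\ge 3$. -/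

import Mathlib

open Filter Topology

/-- The integrand `ln t - |ζ(1/2 + it)|²`. -/
noncomputable def logModZeta (t : ℝ) : ℝ :=
  Real.log t - ‖riemannZeta (1 / 2 + Complex.I * (t : ℂ))‖ ^ 2

/-- The constant `ln 2π - 2c`, where `c` is Euler's constant. -/
noncomputable def logModConst : ℝ :=
  Real.log (2 * Real.pi) - 2 * Real.eulerMascheroniConstant

/-- The Fermat rational `(xⁿ + yⁿ) / zⁿ`, as a real number. -/
noncomputable def fermatRational (x y z n : ℕ) : ℝ :=
  ((x : ℝ) ^ n + (y : ℝ) ^ n) / (z : ℝ) ^ n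

/-- The mean
`(1/τ) ∫ (ln t - |ζ(1/2 + it)|²) dt` over `t` from `q τ / (ln 2π - 2c)` to
`(N + 1) q τ / (ln 2π - 2c)`. -/
noncomputable def logModMean (N : ℕ) (q τ : ℝ) : ℝ :=
  (1 / τ) * ∫ t in (q * (τ / logModConst))..(((N : ℝ) + 1) * q * (τ / logModConst)),
    logModZeta t

/-! The analytic content is the Hardy–Littlewood mean square with its secondary term: the integral
of `|ζ(1/2+it)|²` over `[0, T]` is `T log T + (2γ - 1 - log 2π) T + o(T)`. Subtracting from `∫ log t
= T log T - T` gives `∫₀ᵀ logModZeta ~ (log 2π - 2γ) T`, and differencing at the two endpoints,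
linear in `τ`, gives the limit `N q`. Since `N ≠ 0`, the limit is `N` exactly when `q = 1`, that is,
when `xⁿ + yⁿ = zⁿ`.

The mean square is first computed against a finite measure `ν` whose characteristic function `k` is
real and supported in a short interval `[-Θ, Θ]`. On the critical line `ζ` is replaced by the
Dirichlet polynomial of length `N` minus its pole term (`norm_riemannZeta_sub_zetaTrunc_le`).
Squaring and integrating leaves the sum of `(mn)^(-1/2) k(log m - log n)`, together with a cross
term and a pole term whose sum is about `-N κ`, where `κ = ∫ exp(-|y|/2) k(y) dy`. Only pairs with
`m/n` near 1 contribute. Partial summation reduces the off-diagonal part to counting such pairs with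
weight `1/m`; by Stirling the count is `N z - log(2π N z)/2 + ...` with `z = 1 - exp(-θ)`
(`abs_closePairSum_sub_le`). Its linear term cancels `-N κ`, the `log N` cancels against the
diagonal harmonic sum, and what survives is `k(0)(γ - log 2π) + ∫₀^Θ k' log`
(`abs_integral_zetaTrunc_sub_le`).

The last integral equals `∫ (γ + log|t|) dν`, by the Laplace transform of the logarithm
(`integral_deriv_mul_log`). Hence `∫ |ζ|² dν` is `∫ log|t| dν + ν(ℝ)(2γ - log 2π)` up to small
errors.

Finally `ν` is taken to be Lebesgue measure on `(-T, T]` smeared at scale `D` by a probability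
measure with compactly supported characteristic function and all moments. With `T` near `x⁴`, `D =
x²` and `N` about `x³²` every error is `o(T)`, and moving `T` by `x³` sandwiches the sharp cutoff
between two smeared ones. -/

/-! ### Continuation of `(s - 1) ζ(s)` to `Re s > 0` -/

/-- The integral of `(s - 1) (n ^ (-s) - u ^ (-s))` over `u` from `n` to `n + 1`. -/
noncomputable def zetaTerm (n : ℕ) (s : ℂ) : ℂ :=
  (s - 1) * (n : ℂ) ^ (-s) + ((n : ℂ) + 1) ^ (1 - s) - (n : ℂ) ^ (1 - s)

lemma hasDerivAt_ofReal_cpow_neg {x : ℝ} (hx : 0 < x) (s : ℂ) :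
    HasDerivAt (fun x : ℝ => (x : ℂ) ^ (-s)) (-s * (x : ℂ) ^ (-s - 1)) x := by
  by_cases hs0 : s = 0
  · subst hs0
    simpa using hasDerivAt_const x (1 : ℂ)
  · exact hasDerivAt_ofReal_cpow_const hx.ne' (neg_ne_zero.mpr hs0)

lemma norm_cpow_neg_sub_le {a : ℝ} (ha : 0 < a) {s : ℂ} (hs : 0 ≤ s.re) {u : ℝ} (hu : a ≤ u) :
    ‖(u : ℂ) ^ (-s) - (a : ℂ) ^ (-s)‖ ≤ ‖s‖ * a ^ (-s.re - 1) * (u - a) := by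
  have h := (convex_Icc a u).norm_image_sub_le_of_norm_hasDerivWithin_le
    (f := fun x : ℝ => (x : ℂ) ^ (-s)) (f' := fun x : ℝ => -s * (x : ℂ) ^ (-s - 1))
    (C := ‖s‖ * a ^ (-s.re - 1)) (x := a) (y := u)
    (fun x hx => (hasDerivAt_ofReal_cpow_neg (ha.trans_le hx.1) s).hasDerivWithinAt) ?_
    ⟨le_rfl, hu⟩ ⟨hu, le_rfl⟩
  · rwa [Real.norm_of_nonneg (by linarith : 0 ≤ u - a)] at h
  · intro x hx
    have hx0 : 0 < x := ha.trans_le hx.1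
    rw [norm_mul, norm_neg, Complex.norm_cpow_eq_rpow_re_of_pos hx0]
    simp only [Complex.sub_re, Complex.neg_re, Complex.one_re]
    gcongr ?_ * ?_
    exact Real.rpow_le_rpow_of_nonpos ha hx.1 (by linarith)

/-- The term is the increment over `[n, n + 1]` of `x ↦ x^(1-s) + (s-1) n^(-s) x`, whose derivative
`(s-1)(n^(-s) - x^(-s))` is small by `norm_cpow_neg_sub_le`. The gain of one power of `n` makes the
series converge for `Re s > 0`. -/
lemma norm_zetaTerm_le {n : ℕ} (hn : 1 ≤ n) {s : ℂ} (hs : 0 ≤ s.re) :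
    ‖zetaTerm n s‖ ≤ ‖s - 1‖ * ‖s‖ * (n : ℝ) ^ (-s.re - 1) := by
  have hn0 : (0 : ℝ) < n := by exact_mod_cast hn
  have h := (convex_Icc (n : ℝ) (n + 1)).norm_image_sub_le_of_norm_hasDerivWithin_le
    (f := fun x : ℝ => (x : ℂ) ^ (-(s - 1)) + (s - 1) * (n : ℂ) ^ (-s) * x)
    (f' := fun x : ℝ => -(s - 1) * (x : ℂ) ^ (-(s - 1) - 1) + (s - 1) * (n : ℂ) ^ (-s))
    (C := ‖s - 1‖ * (‖s‖ * (n : ℝ) ^ (-s.re - 1))) (x := n) (y := n + 1) ?_ ?_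
    ⟨le_rfl, by linarith⟩ ⟨by linarith, le_rfl⟩
  · rw [add_sub_cancel_left, norm_one, mul_one, ← mul_assoc] at h
    refine le_of_eq_of_le (congrArg norm ?_) h
    simp only [zetaTerm]
    push_cast
    rw [neg_sub]
    ring
  · intro x hx
    refine ((hasDerivAt_ofReal_cpow_neg (hn0.trans_le hx.1) (s - 1)).add ?_).hasDerivWithinAt
    simpa using (Complex.ofRealCLM.hasDerivAt (x := x)).const_mul ((s - 1) * (n : ℂ) ^ (-s))
  · intro x hx
    have : -(s - 1) * (x : ℂ) ^ (-(s - 1) - 1) + (s - 1) * (n : ℂ) ^ (-s)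
        = -((s - 1) * ((x : ℂ) ^ (-s) - ((n : ℝ) : ℂ) ^ (-s))) := by
      rw [show -(s - 1) - 1 = -s by ring, Complex.ofReal_natCast]; ring
    rw [this, norm_neg, norm_mul]
    gcongr
    refine (norm_cpow_neg_sub_le hn0 hs hx.1).trans ?_
    refine mul_le_of_le_one_right (by positivity) (by linarith [hx.2])

lemma sum_zetaTerm (N : ℕ) (s : ℂ) :
    ∑ n ∈ Finset.range N, zetaTerm (n + 1) s
      = (s - 1) * ∑ n ∈ Finset.range N, ((n : ℂ) + 1) ^ (-s) + ((N : ℂ) + 1) ^ (1 - s) - 1 := by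
  induction N with
  | zero => simp
  | succ N ih =>
    rw [Finset.sum_range_succ, Finset.sum_range_succ, ih, zetaTerm]
    push_cast
    ring

lemma differentiable_zetaTerm {n : ℕ} (hn : 1 ≤ n) : Differentiable ℂ (zetaTerm n) := by
  have h0 : (n : ℂ) ≠ 0 := by exact_mod_cast (by omega : n ≠ 0)
  have h1 : (n : ℂ) + 1 ≠ 0 := by exact_mod_cast (by omega : n + 1 ≠ 0)
  unfold zetaTerm
  intro s
  refine DifferentiableAt.sub (DifferentiableAt.add (DifferentiableAt.mul (by fun_prop) ?_) ?_) ?_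
  · exact DifferentiableAt.const_cpow (by fun_prop) (Or.inl h0)
  · exact DifferentiableAt.const_cpow (by fun_prop) (Or.inl h1)
  · exact DifferentiableAt.const_cpow (by fun_prop) (Or.inl h0)

lemma summable_zetaTerm {s : ℂ} (hs : 0 < s.re) : Summable fun n : ℕ => zetaTerm (n + 1) s := by
  refine Summable.of_norm_bounded (g := fun n : ℕ => ‖s - 1‖ * ‖s‖ * ((n + 1 : ℕ) : ℝ) ^ (-s.re - 1))
    (Summable.mul_left _ ?_) fun n => norm_zetaTerm_le (by omega) hs.le
  exact (summable_nat_add_iff 1).mpr (Real.summable_nat_rpow.mpr (by linarith))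

lemma riemannZeta₁_eq_tsum_of_one_lt {s : ℂ} (hs : 1 < s.re) :
    riemannZeta₁ s = 1 + ∑' n : ℕ, zetaTerm (n + 1) s := by
  have hs1 : s ≠ 1 := by rintro rfl; simp at hs
  have h1 : riemannZeta₁ s = (s - 1) * riemannZeta s := by
    rw [riemannZeta_eq_inv_sub_mul hs1, mul_inv_cancel_left₀ (sub_ne_zero.mpr hs1)]
  have hsum : Summable fun n : ℕ => ((n : ℂ) + 1) ^ (-s) := by
    have := (summable_nat_add_iff 1).mpr (Complex.summable_one_div_nat_cpow.mpr hs)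
    refine this.congr fun n => ?_
    rw [Complex.cpow_neg, one_div]; push_cast; rfl
  have hz : riemannZeta s = ∑' n : ℕ, ((n : ℂ) + 1) ^ (-s) := by
    rw [zeta_eq_tsum_one_div_nat_add_one_cpow hs]
    simp_rw [Complex.cpow_neg, one_div]
  have ht : Tendsto (fun N : ℕ => ∑ n ∈ Finset.range N, zetaTerm (n + 1) s) atTop
      (𝓝 ((s - 1) * riemannZeta s + 0 - 1)) := by
    simp_rw [sum_zetaTerm]
    refine ((hz ▸ hsum.hasSum.tendsto_sum_nat).const_mul _ |>.add ?_).sub_const _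
    rw [tendsto_zero_iff_norm_tendsto_zero]
    have h2 : Tendsto (fun N : ℕ => ((N : ℝ) + 1) ^ (-(s.re - 1))) atTop (𝓝 0) :=
      (tendsto_rpow_neg_atTop (by linarith)).comp
        (tendsto_atTop_add_const_right _ _ tendsto_natCast_atTop_atTop)
    refine h2.congr fun N => ?_
    have : ((N : ℂ) + 1) = (((N : ℝ) + 1 : ℝ) : ℂ) := by push_cast; rfl
    rw [this, Complex.norm_cpow_eq_rpow_re_of_pos (by positivity)]
    simp
  have := tendsto_nhds_unique ht (summable_zetaTerm (by linarith)).hasSum.tendsto_sum_nat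
  rw [← this, h1]; ring

/-- Both sides are analytic on a convex region reaching into `Re s > 1`, where they agree by
telescoping, so the identity theorem applies. -/
theorem riemannZeta₁_eq_tsum {s : ℂ} (hs : 0 < s.re) :
    riemannZeta₁ s = 1 + ∑' n : ℕ, zetaTerm (n + 1) s := by
  -- The region is a ball cut by a half-plane. Boundedness makes `‖z - 1‖ ‖z‖` uniformly bounded for
  -- the M-test, and the radius leaves room for the base point `‖s‖ + 2`, whose real part exceeds 1.
  set R : ℝ := ‖s‖ + 3
  set δ : ℝ := s.re / 2
  have hδ : 0 < δ := by positivity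
  set U : Set ℂ := Metric.ball 0 R ∩ {z | δ < z.re}
  have hUo : IsOpen U := Metric.isOpen_ball.inter (isOpen_lt continuous_const Complex.continuous_re)
  have hUc : Convex ℝ U := (convex_ball 0 R).inter (convex_halfSpace_re_gt δ)
  have hd : DifferentiableOn ℂ (fun z => 1 + ∑' n : ℕ, zetaTerm (n + 1) z) U := by
    refine (differentiableOn_const 1).add (Complex.differentiableOn_tsum_of_summable_norm
      (u := fun n : ℕ => (R + 1) * R * ((n + 1 : ℕ) : ℝ) ^ (-δ - 1)) (Summable.mul_left _ ?_)
      (fun n => (differentiable_zetaTerm (by omega)).differentiableOn) hUo ?_)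
    · exact (summable_nat_add_iff 1).mpr (Real.summable_nat_rpow.mpr (by linarith))
    · rintro n z ⟨hz, hz'⟩
      have hz1 : ‖z‖ ≤ R := by simpa using (mem_ball_zero_iff.mp hz).le
      have hz2 : δ < z.re := hz'
      refine (norm_zetaTerm_le (by omega) (by linarith)).trans ?_
      have : ‖z - 1‖ ≤ R + 1 := (norm_sub_le _ _).trans (by simpa using hz1)
      gcongr
      · simp
  have hev : riemannZeta₁ =ᶠ[𝓝 ((‖s‖ + 2 : ℝ) : ℂ)] fun z => 1 + ∑' n : ℕ, zetaTerm (n + 1) z := by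
    have : IsOpen {z : ℂ | 1 < z.re} := isOpen_lt continuous_const Complex.continuous_re
    filter_upwards [this.mem_nhds (show 1 < ((‖s‖ + 2 : ℝ) : ℂ).re by
      rw [Complex.ofReal_re]; linarith [norm_nonneg s])] with z hz
    exact riemannZeta₁_eq_tsum_of_one_lt hz
  have hsn : s.re ≤ ‖s‖ := Complex.re_le_norm s
  refine AnalyticOnNhd.eqOn_of_preconnected_of_eventuallyEq
    (differentiable_riemannZeta₁.differentiableOn.analyticOnNhd hUo) (hd.analyticOnNhd hUo)
    hUc.isPreconnected (z₀ := ((‖s‖ + 2 : ℝ) : ℂ)) ⟨?_, ?_⟩ hev ⟨?_, ?_⟩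
  · rw [mem_ball_zero_iff, Complex.norm_real, Real.norm_of_nonneg (by positivity)]
    simp only [R]; linarith
  · simp only [Set.mem_ofPred_eq, Complex.ofReal_re, δ]; linarith
  · rw [mem_ball_zero_iff]; simp only [R]; linarith
  · simp only [Set.mem_ofPred_eq, δ]; linarith

/-! ### Approximation of `ζ(1/2 + it)` by a truncated Dirichlet series -/

/-- A telescoping majorant, so that the tail of the series of `zetaTerm` on the critical line is
bounded explicitly. -/
lemma rpow_neg_three_halves_le {x : ℝ} (hx : 1 ≤ x) :
    x ^ (-(3 / 2) : ℝ) ≤ 4 * (x ^ (-(1 / 2) : ℝ) - (x + 1) ^ (-(1 / 2) : ℝ)) := by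
  have hx0 : 0 < x := by linarith
  rw [Real.rpow_neg hx0.le, Real.rpow_neg hx0.le, Real.rpow_neg (by linarith), ← Real.sqrt_eq_rpow,
    ← Real.sqrt_eq_rpow, show (3 / 2 : ℝ) = 1 + 1 / 2 by norm_num, Real.rpow_add hx0,
    Real.rpow_one, ← Real.sqrt_eq_rpow]
  have ha : 0 < √x := Real.sqrt_pos.mpr hx0
  have hb : 0 < √(x + 1) := Real.sqrt_pos.mpr (by linarith)
  have ha2 : √x ^ 2 = x := Real.sq_sqrt hx0.le
  have hb2 : √(x + 1) ^ 2 = x + 1 := Real.sq_sqrt (by linarith)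
  set a := √x
  set b := √(x + 1)
  -- From `x + 1 ≤ 2x` and `√2 ≤ 3/2`; then `b (b + a) ≤ 15/4 · a²`, which is where the constant 4
  -- comes from.
  have hab : b ≤ 3 / 2 * a := by nlinarith
  have hba : (b - a) * (b + a) = 1 := by nlinarith
  have hsub : 0 < b - a := by nlinarith
  rw [← ha2, inv_sub_inv ha.ne' hb.ne', inv_eq_one_div, ← mul_div_assoc,
    div_le_div_iff₀ (by positivity) (by positivity)]
  have h3 : b * (b + a) ≤ 4 * a ^ 2 := by nlinarith
  calc 1 * (a * b) = a * ((b - a) * (b * (b + a))) := by linear_combination (-a * b) * hba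
    _ ≤ a * ((b - a) * (4 * a ^ 2)) := by gcongr
    _ = 4 * (b - a) * (a ^ 2 * a) := by ring

lemma norm_sum_zetaTerm_le {s : ℂ} (hs : s.re = 1 / 2) {N M : ℕ} (h : N ≤ M) :
    ‖∑ n ∈ Finset.Ico N M, zetaTerm (n + 1) s‖
      ≤ ‖s - 1‖ * ‖s‖ * (4 * (((N : ℝ) + 1) ^ (-(1 / 2) : ℝ) - ((M : ℝ) + 1) ^ (-(1 / 2) : ℝ))) := by
  induction M, h using Nat.le_induction with
  | base => simp
  | succ M hM ih =>
    rw [Finset.sum_Ico_succ_top hM]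
    refine (norm_add_le _ _).trans ?_
    have h1 := norm_zetaTerm_le (n := M + 1) (by omega) (s := s) (by rw [hs]; norm_num)
    have h2 := rpow_neg_three_halves_le (x := (M : ℝ) + 1) (by simp)
    rw [hs] at h1
    push_cast at h1 ⊢
    norm_num at h1 h2 ih ⊢
    have h3 : ‖s - 1‖ * ‖s‖ * ((M : ℝ) + 1) ^ (-(3 / 2) : ℝ) ≤ ‖s - 1‖ * ‖s‖ *
      (4 * (((M : ℝ) + 1) ^ (-(1 / 2) : ℝ) - ((M : ℝ) + 1 + 1) ^ (-(1 / 2) : ℝ))) := by gcongr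
    linarith

/-- The `N`-th truncation of the Dirichlet series of `ζ(1/2 + it)`, corrected at the pole. -/
noncomputable def zetaTrunc (N : ℕ) (t : ℝ) : ℂ :=
  ∑ n ∈ Finset.range N, ((n : ℂ) + 1) ^ (-(1 / 2 + Complex.I * t))
    - (N : ℂ) ^ (1 / 2 - Complex.I * t) / (1 / 2 - Complex.I * t)

/-- The truncation is the partial sum of the convergent series divided by `s - 1`. The tail
contributes `4 ‖s‖ N^(-1/2)` and the last Dirichlet term another `N^(-1/2)`. The factor `1 + |t|` is
harmless because `N` will be a large power of the height. -/
theorem norm_riemannZeta_sub_zetaTrunc_le {N : ℕ} (hN : 1 ≤ N) (t : ℝ) :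
    ‖riemannZeta (1 / 2 + Complex.I * t) - zetaTrunc N t‖
      ≤ 5 * (1 + |t|) * (N : ℝ) ^ (-(1 / 2) : ℝ) := by
  obtain ⟨M, rfl⟩ : ∃ M, N = M + 1 := ⟨N - 1, by omega⟩
  set s : ℂ := 1 / 2 + Complex.I * t with hs
  have hsre : s.re = 1 / 2 := by simp [hs]
  have hs1 : s - 1 ≠ 0 := fun h => by
    have := congrArg Complex.re h
    simp [hsre] at this
    norm_num at this
  have hsn : ‖s‖ ≤ 1 / 2 + |t| := (norm_add_le _ _).trans (by simp)
  have hlim : Tendsto (fun K => ∑ n ∈ Finset.Ico M K, zetaTerm (n + 1) s) atTop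
      (𝓝 (riemannZeta₁ s - 1 - ∑ n ∈ Finset.range M, zetaTerm (n + 1) s)) := by
    have h1 := (summable_zetaTerm (s := s) (by rw [hsre]; norm_num)).hasSum.tendsto_sum_nat
    rw [riemannZeta₁_eq_tsum (s := s) (by rw [hsre]; norm_num), add_sub_cancel_left]
    refine (h1.sub_const _).congr' ?_
    filter_upwards [eventually_ge_atTop M] with K hK
    rw [Finset.sum_Ico_eq_sub _ hK]
  have htail : ‖riemannZeta₁ s - 1 - ∑ n ∈ Finset.range M, zetaTerm (n + 1) s‖
      ≤ ‖s - 1‖ * ‖s‖ * (4 * ((M : ℝ) + 1) ^ (-(1 / 2) : ℝ)) := by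
    refine le_of_tendsto hlim.norm ?_
    filter_upwards [eventually_ge_atTop M] with K hK
    refine (norm_sum_zetaTerm_le hsre hK).trans ?_
    gcongr
    have : 0 ≤ ((K : ℝ) + 1) ^ (-(1 / 2) : ℝ) := by positivity
    linarith
  -- The telescoped sum of `M` terms carries the boundary power `(M + 1)^(1-s)`, which is the pole
  -- term for `N = M + 1`; the truncation has one Dirichlet term more.
  have hkey : riemannZeta s - zetaTrunc (M + 1) t
      = (s - 1)⁻¹ * (riemannZeta₁ s - 1 - ∑ n ∈ Finset.range M, zetaTerm (n + 1) s)
        - ((M : ℂ) + 1) ^ (-s) := by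
    rw [riemannZeta_eq_inv_sub_mul (sub_ne_zero.mp hs1), zetaTrunc, sum_zetaTerm,
      Finset.sum_range_succ, ← hs, show (1 / 2 - Complex.I * t : ℂ) = -(s - 1) by rw [hs]; ring,
      show (1 - s) = -(s - 1) by ring]
    push_cast
    field_simp
    ring
  have hpow : ‖((M : ℂ) + 1) ^ (-s)‖ = ((M : ℝ) + 1) ^ (-(1 / 2) : ℝ) := by
    rw [show ((M : ℂ) + 1) = (((M : ℝ) + 1 : ℝ) : ℂ) by push_cast; rfl,
      Complex.norm_cpow_eq_rpow_re_of_pos (by positivity), Complex.neg_re, hsre]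
  rw [hkey]
  refine (norm_sub_le _ _).trans ?_
  rw [hpow, norm_mul, norm_inv]
  have h0 : 0 < ‖s - 1‖ := norm_pos_iff.mpr hs1
  have hP : 0 ≤ ((M : ℝ) + 1) ^ (-(1 / 2) : ℝ) := by positivity
  have h2 : ‖s - 1‖⁻¹ * ‖riemannZeta₁ s - 1 - ∑ n ∈ Finset.range M, zetaTerm (n + 1) s‖
      ≤ ‖s‖ * (4 * ((M : ℝ) + 1) ^ (-(1 / 2) : ℝ)) := by
    rw [inv_mul_le_iff₀ h0]
    linarith
  push_cast
  nlinarith [abs_nonneg t]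

theorem norm_riemannZeta_le (t : ℝ) : ‖riemannZeta (1 / 2 + Complex.I * t)‖ ≤ 10 * (1 + |t|) := by
  have h := norm_riemannZeta_sub_zetaTrunc_le le_rfl t
  have h1 : ‖zetaTrunc 1 t‖ ≤ 3 := by
    rw [zetaTrunc]
    simp only [Finset.range_one, Finset.sum_singleton, Nat.cast_zero, zero_add, Complex.one_cpow,
      Nat.cast_one]
    refine (norm_sub_le _ _).trans ?_
    have : (1 / 2 : ℝ) ≤ ‖(1 / 2 - Complex.I * t : ℂ)‖ := by
      refine le_trans ?_ (Complex.re_le_norm _)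
      simp
    rw [norm_one, norm_div, norm_one]
    have := one_div_le_one_div_of_le (by norm_num) this
    linarith
  have h2 := norm_le_norm_add_norm_sub' (riemannZeta (1 / 2 + Complex.I * t)) (zetaTrunc 1 t)
  simp only [Nat.cast_one, Real.one_rpow, mul_one] at h
  nlinarith [abs_nonneg t]

/-! ### The pole term as a Fourier transform -/

open MeasureTheory

/-- Parseval by Fubini: the `ν`-integral of a Fourier transform moves onto the characteristic
function, which later vanishes outside a short interval. -/
lemma integral_fourier_mul_exp (ν : Measure ℝ) [IsFiniteMeasure ν] {h : ℝ → ℂ} (hh : Integrable h)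
    (s : ℝ) :
    ∫ t, (∫ x, h x * Complex.exp (x * t * Complex.I)) * Complex.exp (s * t * Complex.I) ∂ν
      = ∫ x, h x * charFun ν (x + s) := by
  have h1 : ∀ t : ℝ, (∫ x, h x * Complex.exp (x * t * Complex.I)) * Complex.exp (s * t * Complex.I)
      = ∫ x, h x * Complex.exp ((x + s : ℝ) * t * Complex.I) := fun t => by
    rw [← integral_mul_const]
    congr 1; ext x
    rw [mul_assoc, ← Complex.exp_add]
    push_cast
    ring_nf
  simp_rw [h1]
  rw [integral_integral_swap]
  · congr 1; ext x
    rw [integral_const_mul, charFun_apply_real]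
  · refine (Integrable.comp_snd hh ν).mono ?_ (ae_of_all _ fun p => ?_)
    · refine (Integrable.comp_snd hh ν).aestronglyMeasurable.mul ?_
      exact Continuous.aestronglyMeasurable (by fun_prop)
    · have : ((p.2 + s : ℝ) : ℂ) * p.1 * Complex.I = ((p.2 + s) * p.1 : ℝ) * Complex.I := by
        push_cast; rfl
      simp only [Function.uncurry]
      rw [norm_mul, this, Complex.norm_exp_ofReal_mul_I, mul_one]

lemma cpow_eq_exp_log (n : ℕ) (t : ℝ) :
    ((n : ℂ) + 1) ^ (-(1 / 2 + Complex.I * t))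
      = (((n : ℝ) + 1) ^ (-(1 / 2) : ℝ) : ℝ)
        * Complex.exp ((-Real.log (n + 1) : ℝ) * t * Complex.I) := by
  have h : ((n : ℂ) + 1) = (((n : ℝ) + 1 : ℝ) : ℂ) := by push_cast; rfl
  have h0 : (0 : ℝ) < (n : ℝ) + 1 := by positivity
  rw [h, Complex.ofReal_cpow h0.le, neg_add, Complex.cpow_add _ _ (by exact_mod_cast h0.ne')]
  congr 1
  · push_cast; rfl
  · rw [Complex.cpow_def_of_ne_zero (by exact_mod_cast h0.ne'), ← Complex.ofReal_log h0.le]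
    push_cast; ring_nf

/-- The correction term of `zetaTrunc`. -/
noncomputable def zetaPole (N : ℕ) (t : ℝ) : ℂ :=
  (N : ℂ) ^ (1 / 2 - Complex.I * t) / (1 / 2 - Complex.I * t)

lemma integrable_indicator_exp_half (L : ℝ) :
    Integrable ((Set.Iic L).indicator fun x : ℝ => (Real.exp (x / 2) : ℂ)) := by
  rw [integrable_indicator_iff measurableSet_Iic]
  refine Integrable.ofReal (f := fun x : ℝ => Real.exp (x / 2)) ?_
  have := integrableOn_exp_mul_Iic (a := 1 / 2) (by norm_num) L
  refine this.congr_fun (fun x _ => ?_) measurableSet_Iic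
  simp only; ring_nf

lemma conj_zetaPole {N : ℕ} (hN : 1 ≤ N) (t : ℝ) :
    (starRingEnd ℂ) (zetaPole N t)
      = ∫ x, (Set.Iic (Real.log N)).indicator (fun x : ℝ => (Real.exp (x / 2) : ℂ)) x
        * Complex.exp (x * t * Complex.I) := by
  have hN0 : (0 : ℝ) < N := by exact_mod_cast hN
  have h1 : ∀ x : ℝ, (Set.Iic (Real.log N)).indicator (fun x : ℝ => (Real.exp (x / 2) : ℂ)) x
      * Complex.exp (x * t * Complex.I) = (Set.Iic (Real.log N)).indicator
        (fun x : ℝ => Complex.exp ((1 / 2 + Complex.I * t) * x)) x := fun x => by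
    by_cases hx : x ∈ Set.Iic (Real.log N)
    · rw [Set.indicator_of_mem hx, Set.indicator_of_mem hx, Complex.ofReal_exp, ← Complex.exp_add]
      push_cast; ring_nf
    · rw [Set.indicator_of_notMem hx, Set.indicator_of_notMem hx, zero_mul]
  simp_rw [h1]
  rw [integral_indicator measurableSet_Iic, integral_exp_mul_complex_Iic (by simp), zetaPole,
    map_div₀]
  have h2 : (starRingEnd ℂ) (1 / 2 - Complex.I * t) = 1 / 2 + Complex.I * t := by
    simp only [map_sub, map_div₀, map_one, map_ofNat, map_mul, Complex.conj_I, Complex.conj_ofReal]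
    ring
  rw [h2]
  congr 1
  rw [Complex.cpow_def_of_ne_zero (by exact_mod_cast hN0.ne'), ← Complex.exp_conj, map_mul, h2,
    ← Complex.natCast_log, Complex.conj_ofReal]
  ring_nf

lemma exp_neg_abs_half_eq_of_nonpos {x : ℝ} (hx : x ≤ 0) (t : ℝ) :
    (Real.exp (-|x| / 2) : ℂ) * Complex.exp (x * t * Complex.I)
      = Complex.exp ((1 / 2 + Complex.I * t) * x) := by
  rw [abs_of_nonpos hx, Complex.ofReal_exp, ← Complex.exp_add]
  push_cast; ring_nf

lemma exp_neg_abs_half_eq_of_nonneg {x : ℝ} (hx : 0 ≤ x) (t : ℝ) :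
    (Real.exp (-|x| / 2) : ℂ) * Complex.exp (x * t * Complex.I)
      = Complex.exp ((-(1 / 2) + Complex.I * t) * x) := by
  rw [abs_of_nonneg hx, Complex.ofReal_exp, ← Complex.exp_add]
  push_cast; ring_nf

lemma integrable_exp_neg_abs_half_mul (t : ℝ) :
    Integrable fun x : ℝ => (Real.exp (-|x| / 2) : ℂ) * Complex.exp (x * t * Complex.I) := by
  rw [← integrableOn_univ, ← Set.Iic_union_Ioi (a := (0 : ℝ))]
  refine IntegrableOn.union ?_ ?_
  · exact (integrableOn_exp_mul_complex_Iic (a := 1 / 2 + Complex.I * t) (by simp) 0).congr_fun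
      (fun x hx => (exp_neg_abs_half_eq_of_nonpos hx t).symm) measurableSet_Iic
  · exact (integrableOn_exp_mul_complex_Ioi (a := -(1 / 2) + Complex.I * t) (by simp) 0).congr_fun
      (fun x hx => (exp_neg_abs_half_eq_of_nonneg (le_of_lt hx) t).symm) measurableSet_Ioi

lemma integrable_exp_neg_abs_half : Integrable fun x : ℝ => (Real.exp (-|x| / 2) : ℂ) := by
  simpa using integrable_exp_neg_abs_half_mul 0

/-- The left side is `N / (1/4 + t²)`, and `1 / (1/4 + t²)` is the Fourier transform of
`exp(-|x|/2)`. -/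
lemma normSq_zetaPole {N : ℕ} (hN : 1 ≤ N) (t : ℝ) :
    (Complex.normSq (zetaPole N t) : ℂ)
      = N * ∫ x : ℝ, (Real.exp (-|x| / 2) : ℂ) * Complex.exp (x * t * Complex.I) := by
  have hN0 : (0 : ℝ) < N := by exact_mod_cast hN
  have ha : (1 / 2 + Complex.I * t : ℂ) ≠ 0 := fun h => by
    have := congrArg Complex.re h
    simp at this
  have hb : (1 / 2 - Complex.I * t : ℂ) ≠ 0 := fun h => by
    have := congrArg Complex.re h
    simp at this
  have hint : ∫ x : ℝ, (Real.exp (-|x| / 2) : ℂ) * Complex.exp (x * t * Complex.I)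
      = 1 / (1 / 2 + Complex.I * t) + 1 / (1 / 2 - Complex.I * t) := by
    rw [← integral_add_compl measurableSet_Iic (integrable_exp_neg_abs_half_mul t) (s := Set.Iic 0),
      Set.compl_Iic,
      setIntegral_congr_fun measurableSet_Iic fun x hx => exp_neg_abs_half_eq_of_nonpos hx t,
      setIntegral_congr_fun measurableSet_Ioi
        fun x hx => exp_neg_abs_half_eq_of_nonneg (le_of_lt hx) t,
      integral_exp_mul_complex_Iic (by simp), integral_exp_mul_complex_Ioi (by simp),
      show (-(1 / 2) + Complex.I * t : ℂ) = -(1 / 2 - Complex.I * t) by ring]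
    simp only [Complex.ofReal_zero, mul_zero, Complex.exp_zero]
    rw [neg_div_neg_eq]
  have hnum : Complex.normSq ((N : ℂ) ^ (1 / 2 - Complex.I * t)) = N := by
    rw [Complex.normSq_eq_norm_sq, ← Complex.ofReal_natCast,
      Complex.norm_cpow_eq_rpow_re_of_pos hN0, ← Real.rpow_natCast, ← Real.rpow_mul hN0.le]
    simp
  have hden : (Complex.normSq (1 / 2 - Complex.I * t) : ℂ)
      = (1 / 2 - Complex.I * t) * (1 / 2 + Complex.I * t) := by
    rw [Complex.normSq_eq_conj_mul_self]
    simp only [map_sub, map_div₀, map_one, map_ofNat, map_mul, Complex.conj_I, Complex.conj_ofReal]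
    ring
  rw [hint, zetaPole, map_div₀, hnum, Complex.ofReal_div, hden]
  have huv : (1 / 2 + Complex.I * t : ℂ) + (1 / 2 - Complex.I * t) = 1 := by ring
  revert ha hb huv
  generalize (1 / 2 + Complex.I * t : ℂ) = u
  generalize (1 / 2 - Complex.I * t : ℂ) = v
  intro ha hb huv
  push_cast
  field_simp
  linear_combination (-(N : ℂ)) * huv

/-! ### Mean square of the truncation against a band-limited measure -/

/-- Two scales of bounds are kept apart. `K` controls `k` and `θ k'`, and will have order `T`; `K₁`
controls `k'` itself, will have order `T²`, and enters the final error only with the factor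
`N^(-1/2)`. The condition `Θ ≤ 1/2` serves elementary bounds such as `exp(θ/2) ≤ 2` and `1 - exp(-θ)
≥ θ/2`. -/
structure IsBandLimited (ν : Measure ℝ) (k k' : ℝ → ℝ) (Θ K K₁ : ℝ) : Prop where
  charFun_eq : ∀ θ, charFun ν θ = k θ
  hasDerivAt : ∀ θ, HasDerivAt k (k' θ) θ
  continuous_deriv : Continuous k'
  abs_le : ∀ θ, |k θ| ≤ K
  abs_mul_deriv_le : ∀ θ, |θ * k' θ| ≤ K
  abs_deriv_le : ∀ θ, |k' θ| ≤ K₁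
  eq_zero : ∀ θ, Θ ≤ |θ| → k θ = 0
  pos : 0 < Θ
  le_half : Θ ≤ 1 / 2

namespace IsBandLimited

variable {ν : Measure ℝ} {k k' : ℝ → ℝ} {Θ K K₁ : ℝ}

lemma continuous (h : IsBandLimited ν k k' Θ K K₁) : Continuous k :=
  continuous_iff_continuousAt.mpr fun θ => (h.hasDerivAt θ).continuousAt

lemma even (h : IsBandLimited ν k k' Θ K K₁) (θ : ℝ) : k (-θ) = k θ := by
  have := charFun_neg (μ := ν) θ
  rw [h.charFun_eq, h.charFun_eq, Complex.conj_ofReal] at this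
  exact_mod_cast this

lemma hasCompactSupport (h : IsBandLimited ν k k' Θ K K₁) : HasCompactSupport k := by
  refine HasCompactSupport.intro (isCompact_Icc (a := -Θ) (b := Θ)) fun θ hθ => h.eq_zero θ ?_
  by_contra hc
  exact hθ (_root_.abs_le.mp (not_le.mp hc).le)

lemma integrable_mul (h : IsBandLimited ν k k' Θ K K₁) {f : ℝ → ℝ} (hf : Continuous f) :
    Integrable fun y => f y * k y :=
  (hf.mul h.continuous).integrable_of_hasCompactSupport h.hasCompactSupport.mul_left

lemma integral_normSq_sum [IsFiniteMeasure ν] (h : IsBandLimited ν k k' Θ K K₁) (N : ℕ) :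
    ∫ t, Complex.normSq (∑ n ∈ Finset.range N, ((n : ℂ) + 1) ^ (-(1 / 2 + Complex.I * t))) ∂ν
      = ∑ m ∈ Finset.range N, ∑ n ∈ Finset.range N, ((m : ℝ) + 1) ^ (-(1 / 2) : ℝ)
          * ((n : ℝ) + 1) ^ (-(1 / 2) : ℝ) * k (Real.log (m + 1) - Real.log (n + 1)) := by
  have hpt : ∀ t : ℝ, (Complex.normSq
      (∑ n ∈ Finset.range N, ((n : ℂ) + 1) ^ (-(1 / 2 + Complex.I * t))) : ℂ)
      = ∑ m ∈ Finset.range N, ∑ n ∈ Finset.range N, ((((m : ℝ) + 1) ^ (-(1 / 2) : ℝ)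
          * ((n : ℝ) + 1) ^ (-(1 / 2) : ℝ) : ℝ) : ℂ) *
          Complex.exp (((Real.log (m + 1) - Real.log (n + 1) : ℝ) : ℂ) * t * Complex.I) := by
    intro t
    rw [Complex.normSq_eq_conj_mul_self, map_sum, Finset.sum_mul_sum]
    refine Finset.sum_congr rfl fun m _ => Finset.sum_congr rfl fun n _ => ?_
    rw [cpow_eq_exp_log, cpow_eq_exp_log, map_mul, Complex.conj_ofReal, ← Complex.exp_conj,
      map_mul, map_mul, Complex.conj_I, Complex.conj_ofReal, Complex.conj_ofReal,
      mul_mul_mul_comm, ← Complex.exp_add]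
    push_cast
    ring_nf
  have hI : ∀ a : ℝ, Integrable (fun t : ℝ => Complex.exp (a * t * Complex.I)) ν := fun a => by
    refine Integrable.of_bound (C := 1) (Continuous.aestronglyMeasurable (by fun_prop))
      (ae_of_all _ fun t => ?_)
    rw [← Complex.ofReal_mul, Complex.norm_exp_ofReal_mul_I]
  have : ((∫ t, Complex.normSq (∑ n ∈ Finset.range N,
      ((n : ℂ) + 1) ^ (-(1 / 2 + Complex.I * t))) ∂ν : ℝ) : ℂ)
      = ((∑ m ∈ Finset.range N, ∑ n ∈ Finset.range N, ((m : ℝ) + 1) ^ (-(1 / 2) : ℝ)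
          * ((n : ℝ) + 1) ^ (-(1 / 2) : ℝ) * k (Real.log (m + 1) - Real.log (n + 1)) : ℝ) : ℂ) := by
    rw [← integral_complex_ofReal]
    simp_rw [hpt]
    rw [integral_finsetSum _ fun m _ => integrable_finsetSum _ fun n _ => (hI _).const_mul _,
      Complex.ofReal_sum]
    refine Finset.sum_congr rfl fun m _ => ?_
    rw [integral_finsetSum _ fun n _ => (hI _).const_mul _, Complex.ofReal_sum]
    refine Finset.sum_congr rfl fun n _ => ?_
    rw [integral_const_mul, Complex.ofReal_mul _ (k _), ← h.charFun_eq, charFun_apply_real]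
  exact_mod_cast this

lemma integral_normSq_zetaPole [IsFiniteMeasure ν] (h : IsBandLimited ν k k' Θ K K₁) {N : ℕ}
    (hN : 1 ≤ N) :
    ∫ t, Complex.normSq (zetaPole N t) ∂ν = N * ∫ y, Real.exp (-|y| / 2) * k y := by
  have : ((∫ t, Complex.normSq (zetaPole N t) ∂ν : ℝ) : ℂ)
      = ((N * ∫ y, Real.exp (-|y| / 2) * k y : ℝ) : ℂ) := by
    rw [← integral_complex_ofReal]
    simp_rw [normSq_zetaPole hN]
    rw [integral_const_mul, Complex.ofReal_mul, ← integral_complex_ofReal]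
    have := integral_fourier_mul_exp ν integrable_exp_neg_abs_half 0
    simp only [Complex.ofReal_zero, zero_mul, Complex.exp_zero, mul_one, add_zero,
      h.charFun_eq] at this
    rw [this]
    push_cast; rfl
  exact_mod_cast this

lemma integral_sum_mul_conj_zetaPole [IsFiniteMeasure ν] (h : IsBandLimited ν k k' Θ K K₁) {N : ℕ}
    (hN : 1 ≤ N) (m : ℕ) :
    ∫ t, ((m : ℂ) + 1) ^ (-(1 / 2 + Complex.I * t)) * (starRingEnd ℂ) (zetaPole N t) ∂ν
      = ((∫ y in Set.Iic (Real.log N - Real.log (m + 1)), Real.exp (y / 2) * k y : ℝ) : ℂ) := by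
  have hm : (0 : ℝ) < (m : ℝ) + 1 := by positivity
  simp_rw [cpow_eq_exp_log, conj_zetaPole hN, mul_assoc, mul_comm (Complex.exp _) (∫ x, _ ∂_)]
  rw [integral_const_mul]
  simp_rw [← mul_assoc]
  rw [integral_fourier_mul_exp ν (integrable_indicator_exp_half _),
    ← integral_indicator measurableSet_Iic, ← integral_complex_ofReal,
    ← integral_add_right_eq_self (fun x : ℝ => (((Set.Iic (Real.log N - Real.log (m + 1))).indicator
      (fun y => Real.exp (y / 2) * k y) x : ℝ) : ℂ)) (-Real.log (m + 1)), ← integral_const_mul]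
  congr 1; ext x
  rw [h.charFun_eq]
  by_cases hx : x ∈ Set.Iic (Real.log N)
  · have hx' : x + -Real.log (m + 1) ∈ Set.Iic (Real.log N - Real.log (m + 1)) := by
      simp only [Set.mem_Iic] at hx ⊢; linarith
    rw [Set.indicator_of_mem hx, Set.indicator_of_mem hx', Real.rpow_def_of_pos hm, ← mul_assoc,
      ← Complex.ofReal_mul, ← Complex.ofReal_mul, ← Real.exp_add]
    ring_nf
  · have hx' : x + -Real.log (m + 1) ∉ Set.Iic (Real.log N - Real.log (m + 1)) := by
      simp only [Set.mem_Iic] at hx ⊢; intro h; apply hx; linarith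
    rw [Set.indicator_of_notMem hx, Set.indicator_of_notMem hx']
    simp

lemma continuous_zetaPole {N : ℕ} (hN : 1 ≤ N) : Continuous (zetaPole N) := by
  have hN0 : (N : ℂ) ≠ 0 := by exact_mod_cast (by omega : N ≠ 0)
  unfold zetaPole
  refine Continuous.div (Continuous.const_cpow (by fun_prop) (Or.inl hN0)) (by fun_prop) ?_
  intro t ht
  have := congrArg Complex.re ht
  simp at this

lemma norm_zetaPole_le {N : ℕ} (hN : 1 ≤ N) (t : ℝ) : ‖zetaPole N t‖ ≤ 2 * N := by
  have hN0 : (0 : ℝ) < N := by exact_mod_cast hN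
  rw [zetaPole, norm_div, ← Complex.ofReal_natCast, Complex.norm_cpow_eq_rpow_re_of_pos hN0]
  have h1 : (1 / 2 : ℝ) ≤ ‖(1 / 2 - Complex.I * t : ℂ)‖ :=
    le_trans (by simp) (Complex.re_le_norm _)
  rw [div_le_iff₀ (by linarith)]
  have h2 : (N : ℝ) ^ (1 / 2 - Complex.I * t : ℂ).re ≤ N := by
    refine (Real.rpow_le_rpow_of_exponent_le (z := 1) (by exact_mod_cast hN) ?_).trans_eq
      (Real.rpow_one _)
    simp; norm_num
  nlinarith

lemma continuous_cpow_nat (n : ℕ) :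
    Continuous fun t : ℝ => ((n : ℂ) + 1) ^ (-(1 / 2 + Complex.I * t)) := by
  refine Continuous.const_cpow (by fun_prop) (Or.inl ?_)
  exact_mod_cast (by omega : n + 1 ≠ 0)

lemma norm_cpow_nat_le (n : ℕ) (t : ℝ) : ‖((n : ℂ) + 1) ^ (-(1 / 2 + Complex.I * t))‖ ≤ 1 := by
  rw [cpow_eq_exp_log, norm_mul, ← Complex.ofReal_mul, Complex.norm_exp_ofReal_mul_I, mul_one,
    Complex.norm_real, Real.norm_of_nonneg (by positivity)]
  exact Real.rpow_le_one_of_one_le_of_nonpos (by simp) (by norm_num)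

/-- Expansion of `|S - X|²` into `|S|²`, `|X|²` and `-2 Re (S · conj X)`, each evaluated by turning
exponentials in `t` into values of `k`. -/
theorem integral_norm_zetaTrunc_sq [IsFiniteMeasure ν] (h : IsBandLimited ν k k' Θ K K₁) {N : ℕ}
    (hN : 1 ≤ N) :
    ∫ t, ‖zetaTrunc N t‖ ^ 2 ∂ν
      = ∑ m ∈ Finset.range N, ∑ n ∈ Finset.range N, ((m : ℝ) + 1) ^ (-(1 / 2) : ℝ)
          * ((n : ℝ) + 1) ^ (-(1 / 2) : ℝ) * k (Real.log (m + 1) - Real.log (n + 1))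
        - 2 * (∑ m ∈ Finset.range N,
          ∫ y in Set.Iic (Real.log N - Real.log (m + 1)), Real.exp (y / 2) * k y)
        + N * ∫ y, Real.exp (-|y| / 2) * k y := by
  have hS : Continuous fun t : ℝ =>
      ∑ n ∈ Finset.range N, ((n : ℂ) + 1) ^ (-(1 / 2 + Complex.I * t)) :=
    continuous_finsetSum _ fun n _ => continuous_cpow_nat n
  have hSn : ∀ t : ℝ,
      ‖∑ n ∈ Finset.range N, ((n : ℂ) + 1) ^ (-(1 / 2 + Complex.I * t))‖ ≤ N := fun t => by
    refine (norm_sum_le_of_le _ fun n _ => norm_cpow_nat_le n t).trans ?_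
    simp
  have hX := continuous_zetaPole hN
  have hpt : ∀ t : ℝ, ‖zetaTrunc N t‖ ^ 2
      = Complex.normSq (∑ n ∈ Finset.range N, ((n : ℂ) + 1) ^ (-(1 / 2 + Complex.I * t)))
        + Complex.normSq (zetaPole N t)
        - 2 * (∑ n ∈ Finset.range N, ((n : ℂ) + 1) ^ (-(1 / 2 + Complex.I * t))
          * (starRingEnd ℂ) (zetaPole N t)).re := fun t => by
    rw [← Complex.normSq_eq_norm_sq, ← Finset.sum_mul, ← Complex.normSq_sub]
    rfl
  have hXc : Continuous fun t => (starRingEnd ℂ) (zetaPole N t) := Complex.continuous_conj.comp hX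
  have hI3 : ∀ n : ℕ, Integrable (fun t : ℝ => ((n : ℂ) + 1) ^ (-(1 / 2 + Complex.I * t))
      * (starRingEnd ℂ) (zetaPole N t)) ν := fun n => by
    refine Integrable.of_bound (C := 1 * (2 * N))
      ((continuous_cpow_nat n).mul hXc).aestronglyMeasurable (ae_of_all _ fun t => ?_)
    rw [norm_mul, RCLike.norm_conj]
    exact mul_le_mul (norm_cpow_nat_le n t) (norm_zetaPole_le hN t) (norm_nonneg _) zero_le_one
  have hI1 : Integrable (fun t : ℝ => Complex.normSq
      (∑ n ∈ Finset.range N, ((n : ℂ) + 1) ^ (-(1 / 2 + Complex.I * t)))) ν := by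
    refine Integrable.of_bound (C := (N : ℝ) ^ 2)
      (Complex.continuous_normSq.comp hS).aestronglyMeasurable (ae_of_all _ fun t => ?_)
    rw [Complex.normSq_eq_norm_sq, Real.norm_of_nonneg (by positivity)]
    gcongr
    exact hSn t
  have hI2 : Integrable (fun t : ℝ => Complex.normSq (zetaPole N t)) ν := by
    refine Integrable.of_bound (C := (2 * (N : ℝ)) ^ 2)
      (Complex.continuous_normSq.comp hX).aestronglyMeasurable (ae_of_all _ fun t => ?_)
    rw [Complex.normSq_eq_norm_sq, Real.norm_of_nonneg (by positivity)]
    gcongr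
    exact norm_zetaPole_le hN t
  have hI4 := integrable_finsetSum (Finset.range N) fun n _ => hI3 n
  simp_rw [hpt]
  have hre := Complex.reCLM.integral_comp_comm hI4
  simp only [Complex.reCLM_apply] at hre
  have hI5 : Integrable (fun t : ℝ => 2 * (∑ n ∈ Finset.range N,
      ((n : ℂ) + 1) ^ (-(1 / 2 + Complex.I * t)) * (starRingEnd ℂ) (zetaPole N t)).re) ν :=
    hI4.re.const_mul 2
  rw [integral_sub (by exact hI1.add hI2) hI5, integral_add hI1 hI2, integral_const_mul, hre, h.integral_normSq_sum, h.integral_normSq_zetaPole hN,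
    integral_finsetSum _ fun n _ => hI3 n]
  simp_rw [h.integral_sum_mul_conj_zetaPole hN]
  rw [← Complex.ofReal_sum, Complex.ofReal_re]
  ring

end IsBandLimited

/-! ### Harmonic tails and Stirling's formula -/

/-- The sum of `1 / m` over `a ≤ m ≤ N`. -/
noncomputable def harmonicTail (N : ℕ) (a : ℝ) : ℝ :=
  ∑ m ∈ Finset.range N, if a ≤ (m : ℝ) + 1 then 1 / ((m : ℝ) + 1) else 0

lemma harmonic_eq_sum_range (N : ℕ) :
    (harmonic N : ℝ) = ∑ m ∈ Finset.range N, 1 / ((m : ℝ) + 1) := by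
  simp [harmonic]

lemma harmonicTail_eq {N M : ℕ} {a : ℝ} (h1 : (M : ℝ) < a) (h2 : a ≤ M + 1) (hMN : M ≤ N) :
    harmonicTail N a = harmonic N - harmonic M := by
  rw [harmonic_eq_sum_range, harmonic_eq_sum_range, harmonicTail, ← Finset.sum_Ico_eq_sub _ hMN,
    Finset.range_eq_Ico, ← Finset.sum_Ico_consecutive _ (Nat.zero_le M) hMN]
  rw [Finset.sum_eq_zero, zero_add]
  · refine Finset.sum_congr rfl fun m hm => if_pos ?_
    have : (M : ℝ) ≤ m := by exact_mod_cast (Finset.mem_Ico.mp hm).1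
    linarith
  · intro m hm
    refine if_neg ?_
    have : (m : ℝ) + 1 ≤ M := by exact_mod_cast (Finset.mem_Ico.mp hm).2
    linarith

/-- The tail is `H_N - H_M` with `M = ⌈a⌉ - 1`. The lower bound uses that `H_n - log(n+1)`
increases, the upper one that `H_n - log n` decreases. -/
lemma abs_harmonicTail_sub_le {N : ℕ} {a : ℝ} (ha : 1 ≤ a) (haN : a ≤ N) :
    |harmonicTail N a - Real.log (N / a)| ≤ 1 / a := by
  have ha0 : 0 < a := by linarith
  have hN0 : (0 : ℝ) < N := by linarith
  obtain ⟨M, hM⟩ : ∃ M, ⌈a⌉₊ = M + 1 := ⟨⌈a⌉₊ - 1, by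
    have := Nat.ceil_pos.mpr ha0; omega⟩
  have h2 : a ≤ M + 1 := by exact_mod_cast hM ▸ Nat.le_ceil a
  have h1 : (M : ℝ) < a := by
    have := Nat.ceil_lt_add_one ha0.le
    rw [hM] at this; push_cast at this; linarith
  have hMN : M + 1 ≤ N := hM ▸ Nat.ceil_le.mpr haN
  rw [harmonicTail_eq h1 h2 (by omega), Real.log_div hN0.ne' ha0.ne', abs_le]
  have hM0 : (0 : ℝ) < (M : ℝ) + 1 := by positivity
  constructor
  · have h3 := Real.strictMono_eulerMascheroniSeq.monotone (show M ≤ N by omega)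
    simp only [Real.eulerMascheroniSeq] at h3
    have h4 : Real.log N ≤ Real.log (N + 1) := Real.log_le_log hN0 (by linarith)
    have h5 : Real.log (M + 1) ≤ Real.log a + 1 / a := by
      have : Real.log (M + 1) ≤ Real.log (a * (1 + 1 / a)) := by
        refine Real.log_le_log hM0 ?_
        rw [mul_add, mul_one_div_cancel ha0.ne']; linarith
      rw [Real.log_mul ha0.ne' (by positivity)] at this
      have h6 := Real.log_le_sub_one_of_pos (show 0 < 1 + 1 / a by positivity)
      linarith
    linarith
  · have h3 := Real.strictAnti_eulerMascheroniSeq'.antitone hMN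
    simp only [Real.eulerMascheroniSeq', Nat.succ_ne_zero, if_false, show N ≠ 0 by omega] at h3
    rw [harmonic_succ] at h3
    push_cast at h3
    have h4 : Real.log a ≤ Real.log (M + 1) := Real.log_le_log ha0 h2
    have h5 : ((M : ℝ) + 1)⁻¹ ≤ 1 / a := by
      rw [inv_eq_one_div]; exact one_div_le_one_div_of_le ha0 h2
    linarith

lemma log_stirlingSeq_sub_succ_le (n : ℕ) : Real.log (Stirling.stirlingSeq n)
    - Real.log (Stirling.stirlingSeq (n + 1)) ≤ 1 / (4 * (n : ℝ) ^ 2) := by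
  refine (Stirling.log_stirlingSeq_sdiff_le n).trans ?_
  rcases Nat.eq_zero_or_pos n with rfl | hn
  · simp
  · have : (0 : ℝ) < n := by exact_mod_cast hn
    rw [div_le_div_iff₀ (by positivity) (by positivity)]
    nlinarith

/-- The decrements of the logarithm are at most `1/(4(n+1)²)`, hence dominated by those of
`1/(2(n+1))`. So the difference of the two sequences increases to its limit `log √π`. -/
lemma log_stirlingSeq_succ_le (n : ℕ) :
    Real.log (Stirling.stirlingSeq (n + 1)) ≤ Real.log Real.pi / 2 + 1 / (2 * ((n : ℝ) + 1)) := by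
  have hmono : Monotone fun n : ℕ =>
      Real.log (Stirling.stirlingSeq (n + 1)) - 1 / (2 * ((n : ℝ) + 1)) := by
    refine monotone_nat_of_le_succ fun n => ?_
    have h := log_stirlingSeq_sub_succ_le (n + 1)
    have h2 : 1 / (4 * ((n + 1 : ℕ) : ℝ) ^ 2)
        ≤ 1 / (2 * ((n : ℝ) + 1)) - 1 / (2 * (((n + 1 : ℕ) : ℝ) + 1)) := by
      push_cast
      rw [div_sub_div _ _ (by positivity) (by positivity), div_le_div_iff₀ (by positivity)
        (by positivity)]
      have : (0 : ℝ) ≤ n := Nat.cast_nonneg n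
      nlinarith [pow_nonneg this 2, pow_nonneg this 3]
    linarith
  have hlim : Tendsto (fun n : ℕ =>
      Real.log (Stirling.stirlingSeq (n + 1)) - 1 / (2 * ((n : ℝ) + 1))) atTop
      (𝓝 (Real.log √Real.pi - 0)) := by
    refine Tendsto.sub ?_ ?_
    · exact ((Stirling.tendsto_stirlingSeq_sqrt_pi.comp (tendsto_add_atTop_nat 1)).log
        (Real.sqrt_pos.mpr Real.pi_pos).ne')
    · have := (tendsto_one_div_add_atTop_nhds_zero_nat (𝕜 := ℝ)).const_mul (1 / 2)
      rw [mul_zero] at this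
      refine this.congr fun n => ?_
      field_simp
  have := hmono.ge_of_tendsto hlim n
  rw [Real.log_sqrt Real.pi_pos.le] at this
  linarith

lemma abs_log_le {x : ℝ} (h0 : 0 < x) (h1 : x ≤ 1) : |Real.log x| ≤ 2 * x ^ (-(1 / 2) : ℝ) := by
  rw [abs_of_nonpos (Real.log_nonpos h0.le h1)]
  have := Real.log_le_sub_one_of_pos (show 0 < x ^ (-(1 / 2) : ℝ) by positivity)
  rw [Real.log_rpow h0] at this
  linarith

lemma sum_log_div (J : ℕ) {y : ℝ} (hy : 0 < y) :
    ∑ j ∈ Finset.range J, Real.log (y / ((j : ℝ) + 1))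
      = J * Real.log y - Real.log (J.factorial) := by
  induction J with
  | zero => simp
  | succ J ih =>
    rw [Finset.sum_range_succ, ih, Nat.factorial_succ, Nat.cast_mul, Real.log_mul (by positivity)
      (by positivity), Real.log_div hy.ne' (by positivity)]
    push_cast; ring

/-- Stirling for `⌊y⌋!`, with the fractional part of `y` absorbed in the error. The weak error
`y^(-1/2)` is deliberate: it also covers `0 < y < 1`, where the sum is empty and the logarithm is
large, and it stays integrable near 0. -/
lemma abs_sum_log_div_sub_le {y : ℝ} (hy : 0 < y) :
    |∑ j ∈ Finset.range ⌊y⌋₊, Real.log (y / ((j : ℝ) + 1)) - y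
      + Real.log (2 * Real.pi * y) / 2| ≤ 4 * y ^ (-(1 / 2) : ℝ) := by
  rw [sum_log_div _ hy]
  have hpi : Real.log (2 * Real.pi * y) = Real.log 2 + Real.log Real.pi + Real.log y := by
    rw [Real.log_mul (by positivity) hy.ne', Real.log_mul (by norm_num) Real.pi_pos.ne']
  have hpi1 : 0 ≤ Real.log Real.pi := Real.log_nonneg (by linarith [Real.pi_gt_three])
  rcases lt_or_ge y 1 with hy1 | hy1
  · rw [Nat.floor_eq_zero.mpr hy1]
    have h1 := abs_log_le hy hy1.le
    have h2 : 1 ≤ y ^ (-(1 / 2) : ℝ) :=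
      Real.one_le_rpow_of_pos_of_le_one_of_nonpos hy hy1.le (by norm_num)
    have h3 : Real.log Real.pi ≤ 2 * Real.log 2 := by
      rw [← Real.log_rpow (by norm_num)]
      exact Real.log_le_log Real.pi_pos (by norm_num; exact Real.pi_le_four)
    have := Real.log_two_lt_d9
    have : 0 < Real.log 2 := Real.log_pos (by norm_num)
    rw [hpi]
    simp only [Nat.cast_zero, zero_mul, Nat.factorial_zero, Nat.cast_one, Real.log_one]
    rw [abs_le] at h1 ⊢
    constructor <;> linarith
  · obtain ⟨n, hn⟩ : ∃ n, ⌊y⌋₊ = n + 1 := ⟨⌊y⌋₊ - 1, by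
      have := Nat.floor_pos.mpr hy1; omega⟩
    have hJ1 : ((n : ℝ) + 1) ≤ y := by exact_mod_cast hn ▸ Nat.floor_le hy.le
    have hJ2 : y < (n : ℝ) + 1 + 1 := by exact_mod_cast hn ▸ Nat.lt_floor_add_one y
    rw [hn]
    have hs := log_stirlingSeq_succ_le n
    have hs' : Real.log Real.pi / 2 ≤ Real.log (Stirling.stirlingSeq (n + 1)) := by
      rw [← Real.log_sqrt Real.pi_pos.le]
      exact Real.log_le_log (Real.sqrt_pos.mpr Real.pi_pos)
        (Stirling.sqrt_pi_le_stirlingSeq (by omega))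
    rw [Stirling.log_stirlingSeq_formula] at hs hs'
    push_cast at hs hs' ⊢
    set J : ℝ := (n : ℝ) + 1 with hJ
    have hJ0 : 0 < J := by positivity
    rw [Real.log_mul (by norm_num) hJ0.ne', Real.log_div hJ0.ne' (Real.exp_pos 1).ne',
      Real.log_exp] at hs hs'
    set l := Real.log (y / J) with hl
    have hly : Real.log y = Real.log J + l := by rw [hl, Real.log_div hy.ne' hJ0.ne']; ring
    have hl1 : l ≤ y / J - 1 := Real.log_le_sub_one_of_pos (by positivity)
    have hl2 : 1 - J / y ≤ l := by
      have := Real.one_sub_inv_le_log_of_pos (show 0 < y / J by positivity)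
      rwa [inv_div] at this
    have hl0 : 0 ≤ l := Real.log_nonneg ((one_le_div hJ0).mpr hJ1)
    have h3 : J * l ≤ y - J := by
      calc J * l ≤ J * (y / J - 1) := by gcongr
        _ = y - J := by field_simp
    -- Together with `h3`, this says `J log(y/J) = y - J` up to `1/J`, since `(y - J)² / y ≤ 1/J`
    -- when `J` is the integer part of `y`.
    have h4 : y - J - 1 / J ≤ J * l := by
      have : J * (1 - J / y) ≤ J * l := by gcongr
      have h5 : y - J - J * (1 - J / y) = (y - J) ^ 2 / y := by field_simp
      have h6 : (y - J) ^ 2 / y ≤ 1 / J := by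
        rw [div_le_div_iff₀ hy hJ0]
        have : (y - J) ^ 2 ≤ 1 := by
          rw [sq_le_one_iff_abs_le_one, abs_le]; constructor <;> linarith
        nlinarith
      linarith
    have h5 : l ≤ 1 / J := hl1.trans (by rw [div_sub_one hJ0.ne']; gcongr; linarith)
    have h6 : 1 / (2 * J) = 1 / J / 2 := by field_simp
    have h7 : 2 * (1 / J) ≤ 4 * y ^ (-(1 / 2) : ℝ) := by
      have h8 : y ^ (-1 : ℝ) ≤ y ^ (-(1 / 2) : ℝ) :=
        Real.rpow_le_rpow_of_exponent_le hy1 (by norm_num)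
      rw [Real.rpow_neg_one] at h8
      have h9 : 1 / J ≤ 2 * y⁻¹ := by
        rw [← div_eq_mul_inv, div_le_div_iff₀ hJ0 hy]; linarith [(Nat.cast_nonneg n : (0 : ℝ) ≤ n)]
      linarith
    rw [hpi, hly]
    rw [h6] at hs
    refine le_trans ?_ h7
    rw [abs_le]
    constructor <;> linarith

/-! ### Counting pairs of integers with ratio near 1 -/

/-- The sum of `1 / m` over the pairs `1 ≤ n < m ≤ N` with `log (m / n) ≤ θ`. -/
noncomputable def closePairSum (N : ℕ) (θ : ℝ) : ℝ :=
  ∑ m ∈ Finset.range N, ∑ n ∈ Finset.range m,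
    if Real.log ((m : ℝ) + 1) - Real.log ((n : ℝ) + 1) ≤ θ then 1 / ((m : ℝ) + 1) else 0

lemma half_le_one_sub_exp_neg {θ : ℝ} (h0 : 0 ≤ θ) (h1 : θ ≤ 1 / 2) :
    θ / 2 ≤ 1 - Real.exp (-θ) := by
  have h := Real.add_one_le_exp θ
  have h2 : Real.exp (-θ) * Real.exp θ = 1 := by rw [← Real.exp_add]; simp
  have h3 := Real.exp_pos (-θ)
  nlinarith

lemma one_sub_exp_neg_le (θ : ℝ) : 1 - Real.exp (-θ) ≤ θ := by
  linarith [Real.add_one_le_exp (-θ)]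

/-- With `z = 1 - exp(-θ)`, the condition `log(m/n) ≤ θ` reads `m - n ≤ m z`. Grouping by the gap `j
= m - n` leaves, for each `j`, the sum of `1/m` over `m ≥ j/z`; this is empty once `j > N z`. -/
lemma closePairSum_eq (N : ℕ) {θ : ℝ} (h0 : 0 < θ) (h1 : θ ≤ 1 / 2) :
    closePairSum N θ = ∑ j ∈ Finset.range ⌊N * (1 - Real.exp (-θ))⌋₊,
      harmonicTail N (((j : ℝ) + 1) / (1 - Real.exp (-θ))) := by
  have hz1 := half_le_one_sub_exp_neg h0.le h1
  have hz2 := one_sub_exp_neg_le θ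
  have hexp : Real.exp (-θ) = 1 - (1 - Real.exp (-θ)) := by ring
  set z := 1 - Real.exp (-θ)
  have hz0 : 0 < z := by linarith
  have hcond : ∀ m n : ℕ, Real.log ((m : ℝ) + 1) - Real.log ((n : ℝ) + 1) ≤ θ
      ↔ (m : ℝ) + 1 - (n + 1) ≤ (m + 1) * z := fun m n => by
    have hm : (0 : ℝ) < (m : ℝ) + 1 := by positivity
    have hn : (0 : ℝ) < (n : ℝ) + 1 := by positivity
    rw [← Real.log_div hm.ne' hn.ne', Real.log_le_iff_le_exp (by positivity), div_le_iff₀ hn]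
    have h2 : Real.exp (-θ) * Real.exp θ = 1 := by rw [← Real.exp_add]; simp
    have h3 := Real.exp_pos θ
    have h4 := Real.exp_pos (-θ)
    have h5 : (m : ℝ) + 1 - (n + 1) ≤ (m + 1) * z ↔ ((m : ℝ) + 1) * Real.exp (-θ) ≤ n + 1 := by
      rw [hexp]; constructor <;> intro h <;> linarith
    rw [h5]
    constructor
    · intro h
      calc ((m : ℝ) + 1) * Real.exp (-θ) ≤ (Real.exp θ * (n + 1)) * Real.exp (-θ) := by gcongr
        _ = n + 1 := by linear_combination ((n : ℝ) + 1) * h2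
    · intro h
      calc (m : ℝ) + 1 = Real.exp θ * ((m + 1) * Real.exp (-θ)) := by
            linear_combination (-((m : ℝ) + 1)) * h2
        _ ≤ Real.exp θ * (n + 1) := by gcongr
  -- The reflection `n ↦ m - 1 - n` makes the index one less than the gap. Extending the range from
  -- `m` to `N` adds only zeros because `z < 1`.
  have hstep : ∀ m ∈ Finset.range N, (∑ n ∈ Finset.range m,
      if Real.log ((m : ℝ) + 1) - Real.log ((n : ℝ) + 1) ≤ θ then 1 / ((m : ℝ) + 1) else 0)
      = ∑ j ∈ Finset.range N, if ((j : ℝ) + 1) / z ≤ m + 1 then 1 / ((m : ℝ) + 1) else 0 := by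
    intro m hm
    rw [← Finset.sum_range_reflect]
    have hsub : Finset.range m ⊆ Finset.range N :=
      Finset.range_subset_range.mpr (Finset.mem_range.mp hm).le
    rw [← Finset.sum_subset hsub]
    · refine Finset.sum_congr rfl fun j hj => ?_
      have hj' := Finset.mem_range.mp hj
      refine if_congr ?_ rfl rfl
      rw [hcond, div_le_iff₀ hz0]
      have : ((m - 1 - j : ℕ) : ℝ) = m - 1 - j := by
        rw [Nat.sub_sub, Nat.cast_sub (by omega)]; push_cast; ring
      rw [this]
      constructor <;> intro h <;> linarith
    · intro j _ hj
      refine if_neg ?_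
      have hj' : (m : ℝ) ≤ j := by exact_mod_cast not_lt.mp fun h => hj (Finset.mem_range.mpr h)
      rw [div_le_iff₀ hz0, not_le]
      have hm0 : (0 : ℝ) ≤ m := Nat.cast_nonneg m
      nlinarith
  rw [closePairSum, Finset.sum_congr rfl hstep, Finset.sum_comm]
  have hfl : ⌊N * z⌋₊ ≤ N := by
    refine Nat.floor_le_of_le ?_
    have hN0 : (0 : ℝ) ≤ N := Nat.cast_nonneg N
    nlinarith
  rw [← Finset.sum_subset (Finset.range_subset_range.mpr hfl)]
  · rfl
  · intro j _ hj
    refine Finset.sum_eq_zero fun m hm => if_neg ?_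
    have hj' : N * z < (j : ℝ) + 1 := by
      have : ⌊N * z⌋₊ < j + 1 := by
        have := not_lt.mp fun h => hj (Finset.mem_range.mpr h)
        omega
      exact_mod_cast (Nat.floor_lt' (by omega)).mp this
    have hm' : (m : ℝ) + 1 ≤ N := by exact_mod_cast Finset.mem_range.mp hm
    rw [div_le_iff₀ hz0, not_le]
    nlinarith

/-- Each harmonic tail is `log(N z / j)` up to `z/j`. Stirling evaluates the sum of the logarithms,
and the errors add up to at most `z H_N`. -/
theorem abs_closePairSum_sub_le {N : ℕ} (hN : 1 ≤ N) {θ : ℝ} (h0 : 0 < θ) (h1 : θ ≤ 1 / 2) :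
    |closePairSum N θ - N * (1 - Real.exp (-θ))
      + Real.log (2 * Real.pi * (N * (1 - Real.exp (-θ)))) / 2|
      ≤ 8 * ((N : ℝ) ^ (-(1 / 2) : ℝ) * θ ^ (-(1 / 2) : ℝ)) + θ * (1 + Real.log N) := by
  have hz1 := half_le_one_sub_exp_neg h0.le h1
  have hz2 := one_sub_exp_neg_le θ
  rw [closePairSum_eq N h0 h1]
  set z := 1 - Real.exp (-θ)
  have hz0 : 0 < z := by linarith
  have hN0 : (0 : ℝ) < N := by exact_mod_cast hN
  have hy : 0 < N * z := by positivity
  have hlogN : 0 ≤ Real.log N := Real.log_natCast_nonneg N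
  have hA := abs_sum_log_div_sub_le hy
  have hfl : ⌊N * z⌋₊ ≤ N := Nat.floor_le_of_le (by nlinarith)
  have hB : |∑ j ∈ Finset.range ⌊N * z⌋₊, harmonicTail N (((j : ℝ) + 1) / z)
      - ∑ j ∈ Finset.range ⌊N * z⌋₊, Real.log (N * z / ((j : ℝ) + 1))| ≤ θ * (1 + Real.log N) := by
    rw [← Finset.sum_sub_distrib]
    refine (Finset.abs_sum_le_sum_abs _ _).trans ?_
    calc _ ≤ ∑ j ∈ Finset.range ⌊N * z⌋₊, z * (1 / ((j : ℝ) + 1)) := by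
          refine Finset.sum_le_sum fun j hj => ?_
          have hj0 : (0 : ℝ) < (j : ℝ) + 1 := by positivity
          have hj' : (j : ℝ) + 1 ≤ N * z := by
            have : j + 1 ≤ ⌊N * z⌋₊ := Finset.mem_range.mp hj
            exact_mod_cast (Nat.le_floor_iff hy.le).mp this
          have := abs_harmonicTail_sub_le (N := N) (a := ((j : ℝ) + 1) / z)
            (by rw [one_le_div hz0]; linarith [(Nat.cast_nonneg j : (0 : ℝ) ≤ j)])
            (by rw [div_le_iff₀ hz0]; exact hj')
          rw [div_div_eq_mul_div] at this
          refine this.trans_eq ?_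
          rw [one_div_div, mul_one_div]
      _ = z * (harmonic ⌊N * z⌋₊ : ℝ) := by rw [← Finset.mul_sum, harmonic_eq_sum_range]
      _ ≤ θ * (1 + Real.log N) := by
          have h2 : (harmonic ⌊N * z⌋₊ : ℝ) ≤ harmonic N := by
            rw [harmonic_eq_sum_range, harmonic_eq_sum_range]
            exact Finset.sum_le_sum_of_subset_of_nonneg (Finset.range_subset_range.mpr hfl)
              fun j _ _ => by positivity
          have h3 := harmonic_le_one_add_log N
          exact mul_le_mul hz2 (h2.trans h3)
            (by rw [harmonic_eq_sum_range]; exact Finset.sum_nonneg fun j _ => by positivity) h0.le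
  have hC : 4 * (N * z) ^ (-(1 / 2) : ℝ)
      ≤ 8 * ((N : ℝ) ^ (-(1 / 2) : ℝ) * θ ^ (-(1 / 2) : ℝ)) := by
    rw [Real.mul_rpow hN0.le hz0.le]
    have h2 : z ^ (-(1 / 2) : ℝ) ≤ (θ / 4) ^ (-(1 / 2) : ℝ) :=
      Real.rpow_le_rpow_of_nonpos (by positivity) (by linarith) (by norm_num)
    have h3 : (θ / 4) ^ (-(1 / 2) : ℝ) = 2 * θ ^ (-(1 / 2) : ℝ) := by
      rw [Real.div_rpow h0.le (by norm_num), show (4 : ℝ) = 2 ^ (2 : ℝ) by norm_num,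
        ← Real.rpow_mul (by norm_num), show (2 : ℝ) * (-(1 / 2)) = -1 by norm_num,
        Real.rpow_neg_one]
      field_simp
    have h4 : 0 < (N : ℝ) ^ (-(1 / 2) : ℝ) := by positivity
    nlinarith
  rw [abs_le] at hA hB ⊢
  constructor <;> linarith [hA.1, hA.2, hB.1, hB.2]

lemma sum_sum_range_symm (f : ℕ → ℕ → ℝ) (hf : ∀ m n, f m n = f n m) (N : ℕ) :
    ∑ m ∈ Finset.range N, ∑ n ∈ Finset.range N, f m n
      = ∑ m ∈ Finset.range N, f m m
        + 2 * ∑ m ∈ Finset.range N, ∑ n ∈ Finset.range m, f m n := by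
  induction N with
  | zero => simp
  | succ N ih =>
    rw [Finset.sum_range_succ, Finset.sum_range_succ _ N, Finset.sum_range_succ _ N,
      Finset.sum_range_succ _ N]
    simp_rw [Finset.sum_range_succ _ N]
    rw [Finset.sum_add_distrib, ih, Finset.sum_congr rfl fun m _ => hf m N]
    ring

/-! ### Partial summation and cancellation of the main terms -/

namespace IsBandLimited

variable {ν : Measure ℝ} {k k' : ℝ → ℝ} {Θ K K₁ : ℝ}

lemma nonneg (h : IsBandLimited ν k k' Θ K K₁) : 0 ≤ K := (abs_nonneg _).trans (h.abs_le 0)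

lemma nonneg' (h : IsBandLimited ν k k' Θ K K₁) : 0 ≤ K₁ := (abs_nonneg _).trans (h.abs_deriv_le 0)

lemma exp_half_le {y : ℝ} (hy : y ≤ 1 / 2) : Real.exp (y / 2) ≤ 2 := by
  have h1 : Real.exp (y / 2) ≤ Real.exp (1 / 4) := Real.exp_le_exp.mpr (by linarith)
  have h2 : Real.exp (1 / 4) * Real.exp (-(1 / 4)) = 1 := by rw [← Real.exp_add]; simp
  have h3 := Real.add_one_le_exp (-(1 / 4) : ℝ)
  nlinarith [Real.exp_pos (1 / 4)]

/-- For `y ≤ 0` every `m ≤ N` qualifies and there is equality; for `y ≥ 0` the count is `⌊N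
exp(-y)⌋` and only the fractional part is lost. Consequently the cross term matches the pole term
with no loss growing in `N`. -/
lemma card_filter_log_le {N : ℕ} (hN : 1 ≤ N) (y : ℝ) :
    |(((Finset.range N).filter fun m : ℕ => y ≤ Real.log N - Real.log ((m : ℝ) + 1)).card : ℝ)
      * Real.exp (y / 2) - N * Real.exp (-|y| / 2)| ≤ Real.exp (y / 2) := by
  have hN0 : (0 : ℝ) < N := by exact_mod_cast hN
  have hcond : ∀ m : ℕ, y ≤ Real.log N - Real.log ((m : ℝ) + 1) ↔ (m : ℝ) + 1 ≤ N * Real.exp (-y) := by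
    intro m
    have hm : (0 : ℝ) < (m : ℝ) + 1 := by positivity
    rw [show (y ≤ Real.log N - Real.log ((m : ℝ) + 1))
      ↔ (Real.log ((m : ℝ) + 1) ≤ Real.log N + -y) by constructor <;> intro h <;> linarith,
      Real.log_le_iff_le_exp hm, Real.exp_add, Real.exp_log hN0]
  simp_rw [hcond]
  rcases le_total y 0 with hy | hy
  · rw [Finset.filter_true_of_mem, Finset.card_range, abs_of_nonpos hy, neg_neg, sub_self, abs_zero]
    · positivity
    · intro m hm
      have : (m : ℝ) + 1 ≤ N := by exact_mod_cast Finset.mem_range.mp hm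
      have h1 : 1 ≤ Real.exp (-y) := Real.one_le_exp (by linarith)
      nlinarith
  · have hle : N * Real.exp (-y) ≤ N := by
      have : Real.exp (-y) ≤ 1 := Real.exp_le_one_iff.mpr (by linarith)
      nlinarith
    have hpos : 0 ≤ N * Real.exp (-y) := by positivity
    have hset : ((Finset.range N).filter fun m : ℕ => (m : ℝ) + 1 ≤ N * Real.exp (-y))
        = Finset.range ⌊N * Real.exp (-y)⌋₊ := by
      ext m
      rw [Finset.mem_filter, Finset.mem_range, Finset.mem_range, ← Nat.succ_le_iff (n := ⌊_⌋₊),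
        Nat.le_floor_iff hpos]
      push_cast
      refine ⟨fun h => h.2, fun h => ⟨?_, h⟩⟩
      exact_mod_cast (lt_add_one (m : ℝ)).trans_le (h.trans hle)
    rw [hset, Finset.card_range, abs_of_nonneg hy]
    have h1 : N * Real.exp (-y / 2) = N * Real.exp (-y) * Real.exp (y / 2) := by
      rw [mul_assoc, ← Real.exp_add]; ring_nf
    rw [h1, ← sub_mul, abs_mul, abs_of_pos (Real.exp_pos (y / 2))]
    refine mul_le_of_le_one_left (Real.exp_pos _).le ?_
    rw [_root_.abs_le]
    constructor <;> linarith [Nat.floor_le hpos, Nat.lt_floor_add_one (N * Real.exp (-y))]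

lemma abs_sum_setIntegral_sub_le (h : IsBandLimited ν k k' Θ K K₁) {N : ℕ} (hN : 1 ≤ N) :
    |(∑ m ∈ Finset.range N, ∫ y in Set.Iic (Real.log N - Real.log (m + 1)), Real.exp (y / 2) * k y)
      - N * ∫ y, Real.exp (-|y| / 2) * k y| ≤ 4 * K * Θ := by
  have hI1 := h.integrable_mul (f := fun y => Real.exp (y / 2)) (by fun_prop)
  have hI2 := h.integrable_mul (f := fun y => Real.exp (-|y| / 2)) (by fun_prop)
  simp_rw [← integral_indicator measurableSet_Iic]
  have hI3 : ∀ m : ℕ, Integrable ((Set.Iic (Real.log N - Real.log ((m : ℝ) + 1))).indicator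
    fun y => Real.exp (y / 2) * k y) := fun m => hI1.indicator measurableSet_Iic
  rw [← integral_finsetSum _ fun m _ => hI3 m, ← integral_const_mul,
    ← integral_sub (integrable_finsetSum _ fun m _ => hI3 m) (hI2.const_mul _)]
  have hpt : ∀ y : ℝ, (∑ m ∈ Finset.range N, (Set.Iic (Real.log N - Real.log ((m : ℝ) + 1))).indicator
      (fun y => Real.exp (y / 2) * k y) y) - N * (Real.exp (-|y| / 2) * k y)
      = ((((Finset.range N).filter fun m : ℕ => y ≤ Real.log N - Real.log ((m : ℝ) + 1)).card : ℝ)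
        * Real.exp (y / 2) - N * Real.exp (-|y| / 2)) * k y := fun y => by
    simp only [Set.indicator, Set.mem_Iic]
    rw [← Finset.sum_filter, Finset.sum_const, nsmul_eq_mul]
    ring
  simp_rw [hpt]
  rw [← setIntegral_eq_integral_of_forall_compl_eq_zero (s := Set.Icc (-Θ) Θ)]
  · have hb := norm_setIntegral_le_of_norm_le_const (μ := volume) (s := Set.Icc (-Θ) Θ) (C := 2 * K)
      (f := fun y => ((((Finset.range N).filter fun m : ℕ =>
        y ≤ Real.log N - Real.log ((m : ℝ) + 1)).card : ℝ)
        * Real.exp (y / 2) - N * Real.exp (-|y| / 2)) * k y) (by simp) ?_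
    · rw [Real.norm_eq_abs] at hb
      refine hb.trans_eq ?_
      rw [Real.volume_real_Icc_of_le (by linarith [h.pos])]
      ring
    · intro y hy
      rw [Real.norm_eq_abs, abs_mul]
      exact mul_le_mul ((card_filter_log_le hN y).trans (exp_half_le (hy.2.trans h.le_half)))
        (h.abs_le y) (abs_nonneg _) (by norm_num)
  · intro y hy
    rw [h.eq_zero y, mul_zero]
    by_contra hc
    exact hy (_root_.abs_le.mp (not_le.mp hc).le)

lemma hasDerivAt_mul_exp (h : IsBandLimited ν k k' Θ K K₁) (θ : ℝ) :
    HasDerivAt (fun θ => k θ * Real.exp (θ / 2)) ((k' θ + k θ / 2) * Real.exp (θ / 2)) θ := by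
  refine ((h.hasDerivAt θ).mul (((hasDerivAt_id θ).div_const 2).exp)).congr_deriv ?_
  simp only [id]; ring

lemma continuous_deriv_mul_exp (h : IsBandLimited ν k k' Θ K K₁) :
    Continuous fun θ => (k' θ + k θ / 2) * Real.exp (θ / 2) := by
  have := h.continuous
  have := h.continuous_deriv
  fun_prop

lemma apply_right (h : IsBandLimited ν k k' Θ K K₁) : k Θ = 0 := h.eq_zero Θ (le_abs_self Θ)

/-- Evenness and integration by parts against `1 - exp(-θ)`; the boundary terms vanish since `k Θ =
0` and `1 - exp 0 = 0`. This form exhibits the cancellation with the linear term of `closePairSum`.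
-/
lemma integral_exp_neg_abs_half_mul (h : IsBandLimited ν k k' Θ K K₁) :
    ∫ y, Real.exp (-|y| / 2) * k y
      = -2 * ∫ θ in (0)..Θ, (k' θ + k θ / 2) * Real.exp (θ / 2) * (1 - Real.exp (-θ)) := by
  have h1 : ∫ y, Real.exp (-|y| / 2) * k y
      = 2 * ∫ y in Set.Ioi (0 : ℝ), Real.exp (-y / 2) * k y := by
    rw [← integral_comp_abs (f := fun y => Real.exp (-y / 2) * k y)]
    congr 1; ext y
    rcases abs_choice y with hy | hy
    · rw [hy]
    · rw [hy, h.even]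
  have h2 : ∫ y in Set.Ioi (0 : ℝ), Real.exp (-y / 2) * k y
      = ∫ y in (0)..Θ, Real.exp (-y / 2) * k y := by
    rw [intervalIntegral.integral_of_le h.pos.le]
    refine (setIntegral_eq_of_subset_of_forall_sdiff_eq_zero measurableSet_Ioi
      Set.Ioc_subset_Ioi_self fun y hy => ?_)
    rw [h.eq_zero y, mul_zero]
    have h0 : 0 < y := hy.1
    rw [abs_of_pos h0]
    by_contra hc
    exact hy.2 ⟨h0, (not_le.mp hc).le⟩
  have hc := h.continuous
  have hd : ∀ θ ∈ Set.uIcc 0 Θ, HasDerivAt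
      (fun θ => k θ * Real.exp (θ / 2) * (1 - Real.exp (-θ)))
      ((k' θ + k θ / 2) * Real.exp (θ / 2) * (1 - Real.exp (-θ)) + Real.exp (-θ / 2) * k θ) θ := by
    intro θ _
    refine ((h.hasDerivAt_mul_exp θ).mul (((hasDerivAt_neg θ).exp).const_sub 1)).congr_deriv ?_
    have : Real.exp (-θ / 2) = Real.exp (θ / 2) * Real.exp (-θ) := by
      rw [← Real.exp_add]; ring_nf
    rw [this]
    ring
  have hg := h.continuous_deriv_mul_exp
  have h3 := intervalIntegral.integral_eq_sub_of_hasDerivAt hd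
    (Continuous.intervalIntegrable (by fun_prop) _ _)
  rw [intervalIntegral.integral_add (Continuous.intervalIntegrable (by fun_prop) _ _)
    (Continuous.intervalIntegrable (by fun_prop) _ _)] at h3
  simp only [h.apply_right, zero_mul, neg_zero, Real.exp_zero, sub_self, mul_zero] at h3
  rw [h1, h2]
  linarith

lemma mul_exp_eq_neg_integral (h : IsBandLimited ν k k' Θ K K₁) {x : ℝ} (hx : 0 < x) :
    k x * Real.exp (x / 2)
      = -∫ θ in Set.Ioc 0 Θ, (Set.Ici x).indicator (fun θ => (k' θ + k θ / 2) * Real.exp (θ / 2)) θ := by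
  rw [setIntegral_indicator measurableSet_Ici]
  rcases le_or_gt x Θ with hxΘ | hxΘ
  · have : Set.Ioc 0 Θ ∩ Set.Ici x = Set.Icc x Θ := by
      ext θ; simp only [Set.mem_inter_iff, Set.mem_Ioc, Set.mem_Ici, Set.mem_Icc]
      constructor
      · rintro ⟨⟨_, h2⟩, h3⟩; exact ⟨h3, h2⟩
      · rintro ⟨h1, h2⟩; exact ⟨⟨by linarith, h2⟩, h1⟩
    rw [this, integral_Icc_eq_integral_Ioc, ← intervalIntegral.integral_of_le hxΘ,
      intervalIntegral.integral_eq_sub_of_hasDerivAt (fun θ _ => h.hasDerivAt_mul_exp θ)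
        (h.continuous_deriv_mul_exp.intervalIntegrable _ _), h.apply_right]
    ring
  · have : Set.Ioc 0 Θ ∩ Set.Ici x = ∅ := by
      ext θ; simp only [Set.mem_inter_iff, Set.mem_Ioc, Set.mem_Ici, Set.mem_empty_iff_false,
        iff_false]
      rintro ⟨⟨_, h2⟩, h3⟩; linarith
    rw [this, h.eq_zero x (hxΘ.le.trans (le_abs_self x))]
    simp

/-- For `n < m`, `(mn)^(-1/2)` is `exp(log(m/n)/2) / m`. Writing `k(x) exp(x/2)` as minus the
integral of its derivative over `θ ≥ x` and exchanging sum and integral collects the pairs into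
`closePairSum`. -/
lemma sum_mul_exp_eq (h : IsBandLimited ν k k' Θ K K₁) (N : ℕ) :
    ∑ m ∈ Finset.range N, ∑ n ∈ Finset.range N, ((m : ℝ) + 1) ^ (-(1 / 2) : ℝ)
          * ((n : ℝ) + 1) ^ (-(1 / 2) : ℝ) * k (Real.log (m + 1) - Real.log (n + 1))
      = k 0 * harmonic N
        - 2 * ∫ θ in (0)..Θ, (k' θ + k θ / 2) * Real.exp (θ / 2) * closePairSum N θ := by
  rw [sum_sum_range_symm]
  · have hdiag : ∑ m ∈ Finset.range N, ((m : ℝ) + 1) ^ (-(1 / 2) : ℝ)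
        * ((m : ℝ) + 1) ^ (-(1 / 2) : ℝ) * k (Real.log (m + 1) - Real.log (m + 1))
        = k 0 * harmonic N := by
      rw [harmonic_eq_sum_range, Finset.mul_sum]
      refine Finset.sum_congr rfl fun m _ => ?_
      rw [← Real.rpow_add (by positivity), sub_self]
      norm_num
      rw [Real.rpow_neg_one]; ring
    have hoff : ∀ m n : ℕ, n < m → ((m : ℝ) + 1) ^ (-(1 / 2) : ℝ)
        * ((n : ℝ) + 1) ^ (-(1 / 2) : ℝ) * k (Real.log (m + 1) - Real.log (n + 1))
        = -∫ θ in Set.Ioc 0 Θ, (Set.Ici (Real.log ((m : ℝ) + 1) - Real.log ((n : ℝ) + 1))).indicator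
          (fun θ => (k' θ + k θ / 2) * Real.exp (θ / 2)) θ * (1 / ((m : ℝ) + 1)) := by
      intro m n hmn
      have hm : (0 : ℝ) < (m : ℝ) + 1 := by positivity
      have hn : (0 : ℝ) < (n : ℝ) + 1 := by positivity
      have hlt : 0 < Real.log ((m : ℝ) + 1) - Real.log ((n : ℝ) + 1) :=
        sub_pos.mpr (Real.log_lt_log hn (by
          have : (n : ℝ) < m := by exact_mod_cast hmn
          linarith))
      rw [integral_mul_const, ← neg_mul, ← h.mul_exp_eq_neg_integral hlt]
      have h1 : ((m : ℝ) + 1) ^ (-(1 / 2) : ℝ) * ((n : ℝ) + 1) ^ (-(1 / 2) : ℝ)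
          = Real.exp ((Real.log ((m : ℝ) + 1) - Real.log ((n : ℝ) + 1)) / 2) * (1 / ((m : ℝ) + 1)) := by
        rw [Real.rpow_def_of_pos hm, Real.rpow_def_of_pos hn, ← Real.exp_add]
        have h2 : 1 / ((m : ℝ) + 1) = Real.exp (-Real.log ((m : ℝ) + 1)) := by
          rw [Real.exp_neg, Real.exp_log hm, one_div]
        rw [h2, ← Real.exp_add]
        ring_nf
      rw [h1]; ring
    have hI : ∀ m n : ℕ, Integrable (fun θ =>
        (Set.Ici (Real.log ((m : ℝ) + 1) - Real.log ((n : ℝ) + 1))).indicator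
          (fun θ => (k' θ + k θ / 2) * Real.exp (θ / 2)) θ * (1 / ((m : ℝ) + 1)))
        (volume.restrict (Set.Ioc 0 Θ)) := fun m n =>
      (Integrable.indicator (h.continuous_deriv_mul_exp.integrableOn_Ioc) measurableSet_Ici).mul_const _
    rw [hdiag, Finset.sum_congr rfl fun m _ => Finset.sum_congr rfl fun n hn =>
      hoff m n (Finset.mem_range.mp hn), sub_eq_add_neg, ← mul_neg]
    congr 2
    simp_rw [Finset.sum_neg_distrib]
    congr 1
    rw [intervalIntegral.integral_of_le h.pos.le]
    simp_rw [← integral_finsetSum _ fun n _ => hI _ n]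
    rw [← integral_finsetSum _ fun m _ => integrable_finsetSum _ fun n _ => hI m n]
    congr 1; ext θ
    rw [closePairSum, Finset.mul_sum]
    refine Finset.sum_congr rfl fun m _ => ?_
    rw [Finset.mul_sum]
    refine Finset.sum_congr rfl fun n _ => ?_
    simp only [Set.indicator, Set.mem_Ici]
    split_ifs <;> ring
  · intro m n
    rw [← h.even, neg_sub, mul_comm (((m : ℝ) + 1) ^ _)]

end IsBandLimited

lemma monotone_closePairSum (N : ℕ) : Monotone (closePairSum N) := by
  intro a b hab
  refine Finset.sum_le_sum fun m _ => Finset.sum_le_sum fun n _ => ?_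
  split_ifs with h1 h2
  · exact le_rfl
  · exact absurd (h1.trans hab) h2
  · positivity
  · exact le_rfl

lemma log_one_sub_exp_neg_mem {θ : ℝ} (h0 : 0 < θ) :
    Real.log θ - θ ≤ Real.log (1 - Real.exp (-θ)) ∧ Real.log (1 - Real.exp (-θ)) ≤ Real.log θ := by
  have h2 : Real.exp (-θ) * Real.exp θ = 1 := by rw [← Real.exp_add]; simp
  have h3 := Real.exp_pos (-θ)
  have h4 := Real.add_one_le_exp θ
  have h5 : θ * Real.exp (-θ) ≤ 1 - Real.exp (-θ) := by nlinarith
  have h6 : 0 < θ * Real.exp (-θ) := by positivity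
  constructor
  · have := Real.log_le_log h6 h5
    rw [Real.log_mul h0.ne' h3.ne', Real.log_exp] at this
    linarith
  · exact Real.log_le_log (by linarith) (one_sub_exp_neg_le θ)

lemma intervalIntegrable_log_one_sub_exp_neg {Θ : ℝ} (h : 0 ≤ Θ) :
    IntervalIntegrable (fun θ => Real.log (1 - Real.exp (-θ))) volume 0 Θ := by
  have hg : IntervalIntegrable (fun θ : ℝ => |Real.log θ| + θ) volume 0 Θ :=
    intervalIntegral.intervalIntegrable_log'.abs.add (continuous_id.intervalIntegrable 0 Θ)
  refine hg.mono_fun' (Measurable.aestronglyMeasurable (by fun_prop)) ?_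
  rw [Set.uIoc_of_le h]
  filter_upwards [ae_restrict_mem measurableSet_Ioc] with θ hθ
  obtain ⟨h1, h2⟩ := log_one_sub_exp_neg_mem hθ.1
  rw [Real.norm_eq_abs, abs_le]
  have := neg_abs_le (Real.log θ)
  have := le_abs_self (Real.log θ)
  constructor <;> linarith [hθ.1]

lemma abs_harmonic_sub_log_sub_le {N : ℕ} (hN : 1 ≤ N) :
    |(harmonic N : ℝ) - Real.log N - Real.eulerMascheroniConstant| ≤ (N : ℝ) ^ (-(1 / 2) : ℝ) := by
  have hN0 : (0 : ℝ) < N := by exact_mod_cast hN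
  have h1 := Real.eulerMascheroniSeq_lt_eulerMascheroniConstant N
  have h2 := Real.eulerMascheroniConstant_lt_eulerMascheroniSeq' N
  simp only [Real.eulerMascheroniSeq, Real.eulerMascheroniSeq', show N ≠ 0 by omega, if_false]
    at h1 h2
  have h3 : Real.log ((N : ℝ) + 1) ≤ Real.log N + 1 / N := by
    have : Real.log ((N : ℝ) + 1) = Real.log N + Real.log (1 + 1 / N) := by
      rw [← Real.log_mul hN0.ne' (by positivity), mul_add, mul_one_div_cancel hN0.ne', mul_one]
    rw [this]
    linarith [Real.log_le_sub_one_of_pos (show 0 < 1 + 1 / (N : ℝ) by positivity)]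
  have h4 : 1 / (N : ℝ) ≤ (N : ℝ) ^ (-(1 / 2) : ℝ) := by
    rw [one_div, ← Real.rpow_neg_one]
    exact Real.rpow_le_rpow_of_exponent_le (by exact_mod_cast hN) (by norm_num)
  rw [abs_le]
  constructor <;> linarith

lemma integral_rpow_neg_half (Θ : ℝ) :
    ∫ θ in (0)..Θ, θ ^ (-(1 / 2) : ℝ) = 2 * Θ ^ (1 / 2 : ℝ) := by
  rw [integral_rpow (Or.inl (by norm_num))]
  norm_num
  ring

namespace IsBandLimited

variable {ν : Measure ℝ} {k k' : ℝ → ℝ} {Θ K K₁ : ℝ}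

lemma abs_deriv_mul_exp_le (h : IsBandLimited ν k k' Θ K K₁) {θ : ℝ} (h1 : θ ≤ Θ) :
    |(k' θ + k θ / 2) * Real.exp (θ / 2)| ≤ 2 * (K₁ + K) := by
  rw [abs_mul, abs_of_pos (Real.exp_pos _), mul_comm]
  refine mul_le_mul (exp_half_le (h1.trans h.le_half)) ?_ (abs_nonneg _) (by norm_num)
  refine (abs_add_le _ _).trans ?_
  rw [abs_div, abs_two]
  linarith [h.abs_deriv_le θ, h.abs_le θ, h.nonneg]

lemma mul_abs_deriv_mul_exp_le (h : IsBandLimited ν k k' Θ K K₁) {θ : ℝ} (h0 : 0 ≤ θ)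
    (h1 : θ ≤ Θ) : θ * |(k' θ + k θ / 2) * Real.exp (θ / 2)| ≤ 3 * K := by
  have hK := h.abs_mul_deriv_le θ
  rw [abs_mul, abs_of_nonneg h0] at hK
  have h2 : |k' θ + k θ / 2| ≤ |k' θ| + |k θ| / 2 := by
    refine (abs_add_le _ _).trans ?_
    rw [abs_div, abs_two]
  have h3 := exp_half_le (h1.trans h.le_half)
  rw [abs_mul, abs_of_pos (Real.exp_pos _)]
  have h4 : θ * |k' θ + k θ / 2| ≤ 5 / 4 * K := by
    have : θ * |k' θ + k θ / 2| ≤ θ * |k' θ| + θ * (|k θ| / 2) := by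
      rw [← mul_add]; gcongr
    have h5 : θ * (|k θ| / 2) ≤ 1 / 2 * (K / 2) :=
      mul_le_mul (h1.trans h.le_half) (by linarith [h.abs_le θ]) (by positivity) (by norm_num)
    linarith
  calc θ * (|k' θ + k θ / 2| * Real.exp (θ / 2)) = (θ * |k' θ + k θ / 2|) * Real.exp (θ / 2) := by ring
    _ ≤ (5 / 4 * K) * 2 := mul_le_mul h4 h3 (Real.exp_pos _).le (by linarith [h.nonneg])
    _ ≤ 3 * K := by linarith [h.nonneg]

/-- Only `θ k'` is bounded by `K`, so every replacement must gain a factor `θ`: both `exp(θ/2) - 1`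
and `log(1 - exp(-θ)) - log θ` are `O(θ)`. -/
lemma abs_integral_log_sub_le (h : IsBandLimited ν k k' Θ K K₁) :
    |(∫ θ in (0)..Θ, (k' θ + k θ / 2) * Real.exp (θ / 2) * Real.log (1 - Real.exp (-θ)))
      - ∫ θ in (0)..Θ, k' θ * Real.log θ| ≤ 20 * K * Θ ^ (1 / 2 : ℝ) := by
  have hG := h.continuous_deriv_mul_exp
  have hI1 := (intervalIntegrable_log_one_sub_exp_neg h.pos.le).continuousOn_mul hG.continuousOn
  have hI2 := (intervalIntegral.intervalIntegrable_log' (a := 0) (b := Θ)).continuousOn_mul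
    h.continuous_deriv.continuousOn
  rw [← intervalIntegral.integral_sub hI1 hI2, ← Real.norm_eq_abs]
  have hrp : IntervalIntegrable (fun θ : ℝ => θ ^ (-(1 / 2) : ℝ)) volume 0 Θ :=
    intervalIntegral.intervalIntegrable_rpow' (by norm_num)
  refine (intervalIntegral.norm_integral_le_of_norm_le h.pos.le (g := fun θ => 10 * K * θ ^ (-(1 / 2) : ℝ))
    (ae_of_all _ fun θ hθ => ?_) (hrp.const_mul _)).trans_eq ?_
  · have hθ0 : 0 < θ := hθ.1
    have hθ1 : θ ≤ 1 / 2 := hθ.2.trans h.le_half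
    obtain ⟨h1, h2⟩ := log_one_sub_exp_neg_mem hθ.1
    have hlog := abs_log_le hθ0 (by linarith)
    have hone : 1 ≤ θ ^ (-(1 / 2) : ℝ) :=
      Real.one_le_rpow_of_pos_of_le_one_of_nonpos hθ0 (by linarith) (by norm_num)
    set P := θ ^ (-(1 / 2) : ℝ)
    set l := Real.log (1 - Real.exp (-θ))
    have hneg : Real.log θ ≤ 0 := Real.log_nonpos hθ0.le (by linarith)
    rw [abs_of_nonpos hneg] at hlog
    have hE1 : Real.exp (θ / 2) - 1 ≤ θ := by
      have h5 : Real.exp (θ / 2) * Real.exp (-(θ / 2)) = 1 := by rw [← Real.exp_add]; simp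
      have h6 := Real.add_one_le_exp (-(θ / 2))
      nlinarith [exp_half_le hθ1]
    have hE0 : 1 ≤ Real.exp (θ / 2) := Real.one_le_exp (by linarith)
    have hE2 := exp_half_le hθ1
    set E := Real.exp (θ / 2)
    have habsl : |l| ≤ 3 * P := by rw [_root_.abs_le]; constructor <;> linarith
    have hk := h.abs_le θ
    have hk' := h.abs_mul_deriv_le θ
    rw [abs_mul, abs_of_pos hθ0] at hk'
    have hK := h.nonneg
    have hdecomp : (k' θ + k θ / 2) * E * l - k' θ * Real.log θ
        = k' θ * ((E - 1) * l + (l - Real.log θ)) + k θ / 2 * E * l := by ring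
    rw [Real.norm_eq_abs, hdecomp]
    have hA : |(E - 1) * l + (l - Real.log θ)| ≤ θ * (4 * P) := by
      refine (abs_add_le _ _).trans ?_
      rw [abs_mul, abs_of_nonneg (by linarith : 0 ≤ E - 1)]
      have h7 : |l - Real.log θ| ≤ θ := by rw [_root_.abs_le]; constructor <;> linarith
      have h8 : (E - 1) * |l| ≤ θ * (3 * P) := mul_le_mul hE1 habsl (abs_nonneg _) hθ0.le
      nlinarith
    refine (abs_add_le _ _).trans ?_
    have hB : |k' θ * ((E - 1) * l + (l - Real.log θ))| ≤ K * (4 * P) := by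
      rw [abs_mul]
      calc |k' θ| * |(E - 1) * l + (l - Real.log θ)| ≤ |k' θ| * (θ * (4 * P)) := by gcongr
        _ = (θ * |k' θ|) * (4 * P) := by ring
        _ ≤ K * (4 * P) := by gcongr
    have hC : |k θ / 2 * E * l| ≤ K / 2 * 2 * (3 * P) := by
      rw [abs_mul, abs_mul, abs_div, abs_two, abs_of_pos (by linarith : 0 < E)]
      gcongr
    nlinarith
  · rw [intervalIntegral.integral_const_mul, integral_rpow_neg_half]
    ring

/-- The error `N^(-1/2) θ^(-1/2)` is paired with the crude bound through `K₁`, and the error `θ (1 +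
log N)` with the bound on `θ` times the derivative through `K`. -/
lemma abs_integral_mul_remainder_le (h : IsBandLimited ν k k' Θ K K₁) {N : ℕ} (hN : 1 ≤ N) :
    |∫ θ in (0)..Θ, (k' θ + k θ / 2) * Real.exp (θ / 2) *
      (closePairSum N θ - N * (1 - Real.exp (-θ))
        + Real.log (2 * Real.pi * (N * (1 - Real.exp (-θ)))) / 2)|
      ≤ 32 * (K₁ + K) * (N : ℝ) ^ (-(1 / 2) : ℝ) + 3 * K * Θ * (1 + Real.log N) := by
  have hrp : IntervalIntegrable (fun θ : ℝ => θ ^ (-(1 / 2) : ℝ)) volume 0 Θ :=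
    intervalIntegral.intervalIntegrable_rpow' (by norm_num)
  rw [← Real.norm_eq_abs]
  refine (intervalIntegral.norm_integral_le_of_norm_le h.pos.le
    (g := fun θ => 16 * (K₁ + K) * (N : ℝ) ^ (-(1 / 2) : ℝ) * θ ^ (-(1 / 2) : ℝ)
      + 3 * K * (1 + Real.log N))
    (ae_of_all _ fun θ hθ => ?_) ((hrp.const_mul _).add intervalIntegrable_const)).trans ?_
  · have hR := abs_closePairSum_sub_le hN hθ.1 (hθ.2.trans h.le_half)
    have h1 := h.abs_deriv_mul_exp_le hθ.2
    have h2 := h.mul_abs_deriv_mul_exp_le hθ.1.le hθ.2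
    have hlog : 0 ≤ 1 + Real.log N := by linarith [Real.log_natCast_nonneg N]
    rw [Real.norm_eq_abs, abs_mul]
    set A := |(k' θ + k θ / 2) * Real.exp (θ / 2)|
    calc _ ≤ A * (8 * ((N : ℝ) ^ (-(1 / 2) : ℝ) * θ ^ (-(1 / 2) : ℝ)) + θ * (1 + Real.log N)) := by
          gcongr
      _ = A * (8 * ((N : ℝ) ^ (-(1 / 2) : ℝ) * θ ^ (-(1 / 2) : ℝ))) + θ * A * (1 + Real.log N) := by ring
      _ ≤ 2 * (K₁ + K) * (8 * ((N : ℝ) ^ (-(1 / 2) : ℝ) * θ ^ (-(1 / 2) : ℝ)))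
          + 3 * K * (1 + Real.log N) := by
          have : 0 ≤ θ ^ (-(1 / 2) : ℝ) := Real.rpow_nonneg hθ.1.le _
          gcongr
      _ = _ := by ring
  · rw [intervalIntegral.integral_add (hrp.const_mul _) intervalIntegrable_const,
      intervalIntegral.integral_const_mul, integral_rpow_neg_half, intervalIntegral.integral_const]
    have hΘ : Θ ^ (1 / 2 : ℝ) ≤ 1 :=
      Real.rpow_le_one h.pos.le (by linarith [h.le_half]) (by norm_num)
    have hc : 0 ≤ 16 * (K₁ + K) * (N : ℝ) ^ (-(1 / 2) : ℝ) := by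
      have := h.nonneg; have := h.nonneg'; positivity
    rw [smul_eq_mul]
    nlinarith

/-- The terms of size `N` cancel through `integral_exp_neg_abs_half_mul`. The integral of the
derivative of `k(θ) exp(θ/2)` is `-k 0`, so `-k 0 (log 2π + log N)` meets `k 0 H_N` and leaves `k 0
(γ - log 2π)`. -/
theorem abs_integral_zetaTrunc_sub_le [IsFiniteMeasure ν] (h : IsBandLimited ν k k' Θ K K₁) {N : ℕ}
    (hN : 1 ≤ N) :
    |∫ t, ‖zetaTrunc N t‖ ^ 2 ∂ν
      - (k 0 * (Real.eulerMascheroniConstant - Real.log (2 * Real.pi))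
        + ∫ θ in (0)..Θ, k' θ * Real.log θ)|
      ≤ 20 * K * Θ ^ (1 / 2 : ℝ) + 14 * K * Θ * (1 + Real.log N)
        + 65 * (K₁ + K) * (N : ℝ) ^ (-(1 / 2) : ℝ) := by
  have hN0 : (0 : ℝ) < N := by exact_mod_cast hN
  rw [h.integral_norm_zetaTrunc_sq hN, h.sum_mul_exp_eq]
  have e1 := h.abs_sum_setIntegral_sub_le hN
  have e2 := h.abs_integral_log_sub_le
  have e3 := h.abs_integral_mul_remainder_le hN
  have e4 := abs_harmonic_sub_log_sub_le hN
  have hκ := h.integral_exp_neg_abs_half_mul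
  have hG := h.continuous_deriv_mul_exp
  have hI1 : IntervalIntegrable (fun θ => (k' θ + k θ / 2) * Real.exp (θ / 2) * closePairSum N θ)
      volume 0 Θ := ((monotone_closePairSum N).intervalIntegrable).continuousOn_mul hG.continuousOn
  have hI2 : IntervalIntegrable (fun θ => (k' θ + k θ / 2) * Real.exp (θ / 2)
      * Real.log (1 - Real.exp (-θ))) volume 0 Θ :=
    (intervalIntegrable_log_one_sub_exp_neg h.pos.le).continuousOn_mul hG.continuousOn
  have hI3 : IntervalIntegrable (fun θ => (k' θ + k θ / 2) * Real.exp (θ / 2)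
      * (1 - Real.exp (-θ))) volume 0 Θ := Continuous.intervalIntegrable (by fun_prop) _ _
  have hI4 : IntervalIntegrable (fun θ => (k' θ + k θ / 2) * Real.exp (θ / 2)) volume 0 Θ :=
    hG.intervalIntegrable _ _
  have hk0 : ∫ θ in (0)..Θ, (k' θ + k θ / 2) * Real.exp (θ / 2) = - k 0 := by
    rw [intervalIntegral.integral_eq_sub_of_hasDerivAt (fun θ _ => h.hasDerivAt_mul_exp θ) hI4,
      h.apply_right]
    simp
  have hsplit : ∫ θ in (0)..Θ, (k' θ + k θ / 2) * Real.exp (θ / 2) *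
      (closePairSum N θ - N * (1 - Real.exp (-θ))
        + Real.log (2 * Real.pi * (N * (1 - Real.exp (-θ)))) / 2)
      = (∫ θ in (0)..Θ, (k' θ + k θ / 2) * Real.exp (θ / 2) * closePairSum N θ)
        - N * (∫ θ in (0)..Θ, (k' θ + k θ / 2) * Real.exp (θ / 2) * (1 - Real.exp (-θ)))
        + 1 / 2 * (∫ θ in (0)..Θ, (k' θ + k θ / 2) * Real.exp (θ / 2)
          * Real.log (1 - Real.exp (-θ)))
        + (Real.log (2 * Real.pi) + Real.log N) / 2
          * ∫ θ in (0)..Θ, (k' θ + k θ / 2) * Real.exp (θ / 2) := by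
    rw [← intervalIntegral.integral_const_mul, ← intervalIntegral.integral_const_mul,
      ← intervalIntegral.integral_const_mul, ← intervalIntegral.integral_sub hI1 (hI3.const_mul _),
      ← intervalIntegral.integral_add (hI1.sub (hI3.const_mul _)) (hI2.const_mul _),
      ← intervalIntegral.integral_add ((hI1.sub (hI3.const_mul _)).add (hI2.const_mul _))
        (hI4.const_mul _)]
    rw [intervalIntegral.integral_of_le h.pos.le, intervalIntegral.integral_of_le h.pos.le]
    refine setIntegral_congr_fun measurableSet_Ioc fun θ hθ => ?_
    have hz : 0 < 1 - Real.exp (-θ) := by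
      have := half_le_one_sub_exp_neg hθ.1.le (hθ.2.trans h.le_half)
      linarith [hθ.1]
    rw [Real.log_mul (by positivity) (by positivity), Real.log_mul hN0.ne' hz.ne']
    ring
  rw [hk0] at hsplit
  rw [hκ] at e1 ⊢
  have hlog : 0 ≤ Real.log N := Real.log_natCast_nonneg N
  have hKΘ : 0 ≤ K * Θ := mul_nonneg h.nonneg h.pos.le
  have e4' : |k 0 * ((harmonic N : ℝ) - Real.log N - Real.eulerMascheroniConstant)|
      ≤ (K₁ + K) * (N : ℝ) ^ (-(1 / 2) : ℝ) := by
    rw [abs_mul]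
    refine mul_le_mul ((h.abs_le 0).trans (by linarith [h.nonneg'])) e4 (abs_nonneg _) ?_
    have := h.nonneg; have := h.nonneg'; positivity
  rw [hsplit] at e3
  clear hsplit
  rw [_root_.abs_le] at e1 e2 e3 e4' ⊢
  -- `14 = 2·4 + 2·3`: twice the cross-term error plus twice the `θ (1 + log N)` error. Likewise `65
  -- = 2·32 + 1`, the 1 coming from the harmonic sum.
  have hexp : 14 * K * Θ * (1 + Real.log N) = 8 * (K * Θ) + 6 * (K * Θ) +
    14 * (K * Θ * Real.log N) := by ring
  have hpl : 0 ≤ K * Θ * Real.log N := by positivity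
  constructor <;> nlinarith
end IsBandLimited

/-! ### Laplace transform of the logarithm -/

lemma abs_log_le_add {x : ℝ} (hx : 0 < x) : |Real.log x| ≤ 2 * x ^ (-(1 / 2) : ℝ) + x := by
  have h0 : 0 < x ^ (-(1 / 2) : ℝ) := by positivity
  rcases le_total x 1 with h | h
  · linarith [abs_log_le hx h]
  · rw [abs_of_nonneg (Real.log_nonneg h)]
    linarith [Real.log_le_sub_one_of_pos hx]

lemma integrableOn_abs_log_mul_exp {ε : ℝ} (hε : 0 < ε) :
    IntegrableOn (fun θ => |Real.log θ| * Real.exp (-(ε * θ))) (Set.Ioi 0) := by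
  have h1 := integrableOn_rpow_mul_exp_neg_mul_rpow (s := -(1 / 2)) (p := 1) (b := ε)
    (by norm_num) (by norm_num) hε
  have h2 := integrableOn_rpow_mul_exp_neg_mul_rpow (s := 1) (p := 1) (b := ε)
    (by norm_num) (by norm_num) hε
  refine Integrable.mono' ((h1.const_mul 2).add h2)
    (Measurable.aestronglyMeasurable (by fun_prop)) ?_
  filter_upwards [ae_restrict_mem measurableSet_Ioi] with θ hθ
  have h3 := abs_log_le_add (x := θ) hθ
  rw [Real.norm_of_nonneg (by positivity)]
  simp only [Pi.add_apply, Real.rpow_one]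
  have := Real.exp_pos (-(ε * θ))
  rw [neg_mul]
  nlinarith

lemma integrableOn_mul_abs_log_mul_exp {ε : ℝ} (hε : 0 < ε) :
    IntegrableOn (fun θ => θ * |Real.log θ| * Real.exp (-(ε * θ))) (Set.Ioi 0) := by
  refine Integrable.mono' ((integrableOn_abs_log_mul_exp (half_pos hε)).const_mul (2 / ε))
    (Measurable.aestronglyMeasurable (by fun_prop)) ?_
  filter_upwards [ae_restrict_mem measurableSet_Ioi] with θ hθ
  have hθ0 : 0 < θ := hθ
  rw [Real.norm_of_nonneg (by positivity)]
  have h1 : θ ≤ 2 / ε * Real.exp (ε / 2 * θ) := by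
    have := Real.add_one_le_exp (ε / 2 * θ)
    calc θ = 2 / ε * (ε / 2 * θ) := by field_simp
      _ ≤ 2 / ε * Real.exp (ε / 2 * θ) := by gcongr; linarith
  have h2 : Real.exp (-(ε / 2 * θ)) = Real.exp (ε / 2 * θ) * Real.exp (-(ε * θ)) := by
    rw [← Real.exp_add]; ring_nf
  rw [h2]
  calc θ * |Real.log θ| * Real.exp (-(ε * θ))
      ≤ (2 / ε * Real.exp (ε / 2 * θ)) * |Real.log θ| * Real.exp (-(ε * θ)) := by gcongr
    _ = _ := by ring

lemma norm_exp_neg_mul (r : ℂ) (θ : ℝ) : ‖Complex.exp (-(r * θ))‖ = Real.exp (-(r.re * θ)) := by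
  rw [Complex.norm_exp]; simp

lemma integrableOn_log_mul_exp {r : ℂ} (hr : 0 < r.re) :
    IntegrableOn (fun θ : ℝ => (Real.log θ : ℂ) * Complex.exp (-(r * θ))) (Set.Ioi 0) := by
  refine Integrable.mono' (integrableOn_abs_log_mul_exp hr)
    (Measurable.aestronglyMeasurable (by fun_prop)) (ae_of_all _ fun θ => ?_)
  rw [norm_mul, norm_exp_neg_mul, Complex.norm_real, Real.norm_eq_abs]

lemma hasDerivAt_integral_log_mul_exp {r : ℂ} (hr : 0 < r.re) :
    HasDerivAt (fun r : ℂ => ∫ θ in Set.Ioi (0 : ℝ), (Real.log θ : ℂ) * Complex.exp (-(r * θ)))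
      (∫ θ in Set.Ioi (0 : ℝ), (Real.log θ : ℂ) * (Complex.exp (-(r * θ)) * -θ)) r := by
  have hs : {z : ℂ | r.re / 2 < z.re} ∈ 𝓝 r :=
    (isOpen_lt continuous_const Complex.continuous_re).mem_nhds (by
      show r.re / 2 < r.re
      linarith)
  refine (hasDerivAt_integral_of_dominated_loc_of_deriv_le
    (F := fun (r : ℂ) (θ : ℝ) => (Real.log θ : ℂ) * Complex.exp (-(r * θ)))
    (F' := fun (r : ℂ) (θ : ℝ) => (Real.log θ : ℂ) * (Complex.exp (-(r * θ)) * -θ))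
    (bound := fun θ => θ * |Real.log θ| * Real.exp (-(r.re / 2 * θ))) hs
    (Eventually.of_forall fun z => Measurable.aestronglyMeasurable (by fun_prop))
    (integrableOn_log_mul_exp hr) (Measurable.aestronglyMeasurable (by fun_prop)) ?_
    (integrableOn_mul_abs_log_mul_exp (half_pos hr)) ?_).2
  · filter_upwards [ae_restrict_mem measurableSet_Ioi] with θ hθ z hz
    have hθ0 : 0 < θ := hθ
    have hz' : r.re / 2 < z.re := hz
    rw [norm_mul, norm_mul, norm_exp_neg_mul, norm_neg, Complex.norm_real, Complex.norm_real,
      Real.norm_eq_abs, Real.norm_of_nonneg hθ0.le]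
    have : Real.exp (-(z.re * θ)) ≤ Real.exp (-(r.re / 2 * θ)) :=
      Real.exp_le_exp.mpr (by nlinarith)
    calc |Real.log θ| * (Real.exp (-(z.re * θ)) * θ)
        ≤ |Real.log θ| * (Real.exp (-(r.re / 2 * θ)) * θ) := by gcongr
      _ = _ := by ring
  · refine ae_of_all _ fun θ z _ => ?_
    refine HasDerivAt.const_mul _ ?_
    simpa using ((hasDerivAt_id z).mul_const (θ : ℂ)).neg.cexp

/-- The Mellin transform of `exp(-rθ)` is `r^(-a) Γ(a)`; differentiating at `a = 1` brings down `log
θ`, and `Γ'(1) = -γ`. -/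
lemma integral_log_mul_exp_neg_of_pos {r : ℝ} (hr : 0 < r) :
    ∫ θ in Set.Ioi (0 : ℝ), (Real.log θ : ℂ) * Complex.exp (-((r : ℂ) * θ))
      = -(Real.eulerMascheroniConstant + Complex.log r) / r := by
  have hr' : (r : ℂ) ≠ 0 := by exact_mod_cast hr.ne'
  set f : ℝ → ℂ := fun θ => Complex.exp (-((r : ℂ) * θ)) with hf
  have hfn : ∀ θ, ‖f θ‖ = Real.exp (-(r * θ)) := fun θ => by
    simp only [hf]; rw [norm_exp_neg_mul, Complex.ofReal_re]
  have hcont : Continuous f := by fun_prop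
  have hO1 : f =O[atTop] fun x => x ^ (-(2 : ℝ)) := by
    have := (isLittleO_exp_neg_mul_rpow_atTop hr (-(2 : ℝ))).isBigO
    refine Asymptotics.IsBigO.of_norm_left ?_
    refine this.congr_left fun x => ?_
    rw [hfn, neg_mul]
  have hO2 : f =O[𝓝[>] 0] fun x => x ^ (-(0 : ℝ)) := by
    refine Asymptotics.IsBigO.of_bound 1 ?_
    filter_upwards [self_mem_nhdsWithin] with x hx
    have hx0 : 0 < x := hx
    rw [hfn]
    simp
    positivity
  have hM := (mellin_hasDerivAt_of_isBigO_rpow (s := 1) (a := 2) (b := 0)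
    (hcont.locallyIntegrable.locallyIntegrableOn _) hO1 (by norm_num) hO2 (by norm_num)).2
  have heq : mellin f =ᶠ[𝓝 1] fun a => (1 / (r : ℂ)) ^ a * Complex.Gamma a := by
    have : IsOpen {z : ℂ | 0 < z.re} := isOpen_lt continuous_const Complex.continuous_re
    filter_upwards [this.mem_nhds (show 0 < (1 : ℂ).re by simp)] with a ha
    rw [← Complex.integral_cpow_mul_exp_neg_mul_Ioi ha hr]
    rfl
  have hG : HasDerivAt (fun a : ℂ => (1 / (r : ℂ)) ^ a * Complex.Gamma a)
      ((1 / (r : ℂ)) ^ (1 : ℂ) * Complex.log (1 / r) * 1 * Complex.Gamma 1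
        + (1 / (r : ℂ)) ^ (1 : ℂ) * -Real.eulerMascheroniConstant) 1 :=
    ((hasDerivAt_id (1 : ℂ)).const_cpow (Or.inl (one_div_ne_zero hr'))).mul
      Complex.hasDerivAt_Gamma_one
  have := (hM.congr_of_eventuallyEq heq.symm).unique hG
  rw [Complex.Gamma_one, Complex.cpow_one] at this
  have hlog : Complex.log (1 / r) = - Complex.log r := by
    rw [one_div, Complex.log_inv]
    rw [Complex.arg_ofReal_of_nonneg hr.le]
    exact Real.pi_pos.ne
  rw [hlog] at this
  rw [show -(Real.eulerMascheroniConstant + Complex.log r) / (r : ℂ)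
    = 1 / r * -Complex.log r * 1 * 1 + 1 / r * -Real.eulerMascheroniConstant by ring, ← this, mellin]
  refine setIntegral_congr_fun measurableSet_Ioi fun θ _ => ?_
  simp [hf]

/-- Both sides are holomorphic in the right half-plane and agree on the positive reals. -/
theorem integral_log_mul_exp_neg {r : ℂ} (hr : 0 < r.re) :
    ∫ θ in Set.Ioi (0 : ℝ), (Real.log θ : ℂ) * Complex.exp (-(r * θ))
      = -(Real.eulerMascheroniConstant + Complex.log r) / r := by
  set U : Set ℂ := {z : ℂ | 0 < z.re} with hU
  have hUo : IsOpen U := isOpen_lt continuous_const Complex.continuous_re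
  have hUc : Convex ℝ U := convex_halfSpace_re_gt 0
  have hf : AnalyticOnNhd ℂ (fun r : ℂ => ∫ θ in Set.Ioi (0 : ℝ),
      (Real.log θ : ℂ) * Complex.exp (-(r * θ))) U :=
    DifferentiableOn.analyticOnNhd (fun z hz =>
      (hasDerivAt_integral_log_mul_exp hz).differentiableAt.differentiableWithinAt) hUo
  have hg : AnalyticOnNhd ℂ (fun r : ℂ =>
      -(Real.eulerMascheroniConstant + Complex.log r) / r) U := by
    refine DifferentiableOn.analyticOnNhd (fun z hz => ?_) hUo
    have hz0 : z ≠ 0 := by rintro rfl; simp [hU] at hz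
    refine (DifferentiableAt.div (((differentiableAt_const _).add
      (Complex.differentiableAt_log (Or.inl hz))).neg) differentiableAt_id hz0).differentiableWithinAt
  refine hf.eqOn_of_preconnected_of_frequently_eq hg hUc.isPreconnected (z₀ := 1)
    (by simp [hU]) ?_ hr
  have ht : Tendsto (fun x : ℝ => (x : ℂ)) (𝓝[≠] 1) (𝓝[≠] 1) := by
    refine tendsto_nhdsWithin_iff.mpr ⟨?_, ?_⟩
    · exact (Complex.continuous_ofReal.tendsto' 1 1 (by simp)).mono_left nhdsWithin_le_nhds
    · filter_upwards [self_mem_nhdsWithin] with x hx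
      simpa using hx
  refine ht.frequently (Eventually.frequently ?_)
  filter_upwards [nhdsWithin_le_nhds (Ioi_mem_nhds (show (0 : ℝ) < 1 by norm_num))] with x hx
  exact integral_log_mul_exp_neg_of_pos hx

namespace IsBandLimited

variable {ν : Measure ℝ} {k k' : ℝ → ℝ} {Θ K K₁ : ℝ}

lemma deriv_eq_integral [IsFiniteMeasure ν] (h : IsBandLimited ν k k' Θ K K₁)
    (hν : MemLp id 1 ν) (θ : ℝ) :
    (k' θ : ℂ) = Complex.I * ∫ t : ℝ, (t : ℂ) * Complex.exp (θ * t * Complex.I) ∂ν := by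
  have h1 := iteratedDeriv_charFun (μ := ν) (n := 1) (t := θ) (by exact_mod_cast hν)
  simp only [pow_one, iteratedDeriv_one] at h1
  rw [← h1]
  have h2 : charFun ν = fun θ => (k θ : ℂ) := funext h.charFun_eq
  rw [h2]
  exact ((h.hasDerivAt θ).ofReal_comp.deriv).symm

lemma deriv_eq_zero (h : IsBandLimited ν k k' Θ K K₁) {θ : ℝ} (hθ : Θ < θ) : k' θ = 0 := by
  have h1 : k =ᶠ[𝓝 θ] fun _ => 0 := by
    filter_upwards [Ioi_mem_nhds hθ] with x hx
    exact h.eq_zero x ((le_of_lt hx).trans (le_abs_self x))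
  exact (h.hasDerivAt θ).unique ((hasDerivAt_const θ (0 : ℝ)).congr_of_eventuallyEq h1)

/-- The factor `exp(-δθ)` makes `log` integrable on the half-line, so that `k'` can be written as a
`ν`-integral and Fubini applied. -/
lemma integral_log_mul_exp_mul_deriv [IsFiniteMeasure ν] (h : IsBandLimited ν k k' Θ K K₁)
    (hν : MemLp id 1 ν) {δ : ℝ} (hδ : 0 < δ) :
    ((∫ θ in (0)..Θ, Real.log θ * Real.exp (-(δ * θ)) * k' θ : ℝ) : ℂ)
      = ∫ t : ℝ, -(Complex.I * t) * (Real.eulerMascheroniConstant + Complex.log (δ - Complex.I * t))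
        / (δ - Complex.I * t) ∂ν := by
  have hre : ∀ t : ℝ, (δ - Complex.I * t : ℂ).re = δ := fun t => by simp
  have h1 : ∫ θ in (0)..Θ, Real.log θ * Real.exp (-(δ * θ)) * k' θ
      = ∫ θ in Set.Ioi (0 : ℝ), Real.log θ * Real.exp (-(δ * θ)) * k' θ := by
    rw [intervalIntegral.integral_of_le h.pos.le]
    refine (setIntegral_eq_of_subset_of_forall_sdiff_eq_zero measurableSet_Ioi
      Set.Ioc_subset_Ioi_self fun y hy => ?_).symm
    have h0 : 0 < y := hy.1
    rw [h.deriv_eq_zero, mul_zero]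
    exact not_le.mp fun hc => hy.2 ⟨h0, hc⟩
  have h2 : ∀ θ : ℝ, ((Real.log θ * Real.exp (-(δ * θ)) * k' θ : ℝ) : ℂ)
      = Complex.I * ∫ t : ℝ, (t : ℂ) * ((Real.log θ : ℂ)
        * Complex.exp (-((δ - Complex.I * t) * θ))) ∂ν := fun θ => by
    rw [Complex.ofReal_mul, h.deriv_eq_integral hν, ← mul_assoc, mul_comm _ Complex.I, mul_assoc,
      ← integral_const_mul]
    congr 2; ext t
    rw [show -((δ - Complex.I * t) * θ) = ((-(δ * θ) : ℝ) : ℂ) + θ * t * Complex.I by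
      push_cast; ring, Complex.exp_add, ← Complex.ofReal_exp]
    push_cast; ring
  rw [h1, ← integral_complex_ofReal]
  simp_rw [h2]
  rw [integral_const_mul, integral_integral_swap]
  · have h3 := fun t : ℝ => integral_log_mul_exp_neg (r := δ - Complex.I * t) (by rw [hre]; exact hδ)
    simp_rw [integral_const_mul, h3]
    rw [← integral_const_mul]
    congr 1; ext t
    ring
  · have hprod := (integrableOn_abs_log_mul_exp hδ).mul_prod (memLp_one_iff_integrable.mp hν).norm
    refine hprod.mono' (Measurable.aestronglyMeasurable (by fun_prop)) (ae_of_all _ fun p => ?_)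
    simp only [Function.uncurry]
    rw [norm_mul, norm_mul, norm_exp_neg_mul, hre, Complex.norm_real, Complex.norm_real,
      Real.norm_eq_abs (Real.log _), mul_comm]
    rfl

/-- Let `δ → 0` in the damped identity: `-it/(δ - it)` tends to 1, leaving `γ + log(-it)`, whose
real part is `γ + log|t|`. Here `Real.log t` is `log|t|`, so negative `t` needs no separate
treatment. -/
theorem integral_deriv_mul_log [IsFiniteMeasure ν] (h : IsBandLimited ν k k' Θ K K₁)
    (hν : MemLp id 1 ν) (hlog : Integrable Real.log ν) (h0 : ∀ᵐ t ∂ν, t ≠ 0) :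
    ∫ θ in (0)..Θ, k' θ * Real.log θ
      = ∫ t, (Real.eulerMascheroniConstant + Real.log t) ∂ν := by
  have hlim1 : Tendsto (fun δ : ℝ => ((∫ θ in (0)..Θ, Real.log θ * Real.exp (-(δ * θ)) * k' θ : ℝ) : ℂ))
      (𝓝[>] 0) (𝓝 ((∫ θ in (0)..Θ, k' θ * Real.log θ : ℝ) : ℂ)) := by
    refine (Complex.continuous_ofReal.tendsto _).comp ?_
    refine intervalIntegral.tendsto_integral_filter_of_dominated_convergence
      (fun θ => |Real.log θ| * K₁) (Eventually.of_forall fun δ => ?_) ?_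
      (intervalIntegral.intervalIntegrable_log'.abs.mul_const _) (ae_of_all _ fun θ _ => ?_)
    · have := h.continuous_deriv.measurable
      exact Measurable.aestronglyMeasurable (by fun_prop)
    · filter_upwards [self_mem_nhdsWithin] with δ hδ
      refine ae_of_all _ fun θ hθ => ?_
      rw [Set.uIoc_of_le h.pos.le] at hθ
      have hδ0 : 0 < δ := hδ
      rw [norm_mul, norm_mul, Real.norm_eq_abs, Real.norm_eq_abs, Real.norm_eq_abs, Real.abs_exp]
      have h1 : Real.exp (-(δ * θ)) ≤ 1 :=
        Real.exp_le_one_iff.mpr (by have := mul_pos hδ0 hθ.1; linarith)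
      exact mul_le_mul (mul_le_of_le_one_right (abs_nonneg _) h1) (h.abs_deriv_le θ)
        (abs_nonneg _) (abs_nonneg _)
    · have : Tendsto (fun δ : ℝ => Real.log θ * Real.exp (-(δ * θ)) * k' θ) (𝓝 0)
          (𝓝 (Real.log θ * Real.exp (-(0 * θ)) * k' θ)) :=
        Continuous.tendsto (by fun_prop) 0
      simp only [zero_mul, neg_zero, Real.exp_zero, mul_one] at this
      rw [mul_comm (k' θ)]
      exact this.mono_left nhdsWithin_le_nhds
  have hlim2 : Tendsto (fun δ : ℝ => ∫ t : ℝ, -(Complex.I * t)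
      * (Real.eulerMascheroniConstant + Complex.log (δ - Complex.I * t))
        / (δ - Complex.I * t) ∂ν) (𝓝[>] 0)
      (𝓝 (∫ t : ℝ, (Real.eulerMascheroniConstant + Complex.log (-(Complex.I * t))) ∂ν)) := by
    -- The majorant uses `|t| ≤ ‖δ - it‖ ≤ 1 + |t|`: the quotient has norm at most 1, and the real
    -- part of the logarithm lies between `log|t|` and `|t|`.
    refine tendsto_integral_filter_of_dominated_convergence
      (fun t => |Real.eulerMascheroniConstant| + (|Real.log t| + 1 + |t| + Real.pi))
      (Eventually.of_forall fun δ => Measurable.aestronglyMeasurable (by fun_prop)) ?_ ?_ ?_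
    · filter_upwards [self_mem_nhdsWithin,
        nhdsWithin_le_nhds (Iio_mem_nhds (show (0 : ℝ) < 1 by norm_num))] with δ hδ hδ1
      filter_upwards [h0] with t ht
      have hδ0 : 0 < δ := hδ
      have hδ1' : δ < 1 := hδ1
      set r : ℂ := δ - Complex.I * t with hr
      have hr1 : |t| ≤ ‖r‖ := by
        have := Complex.abs_im_le_norm r
        simpa [hr] using this
      have hr2 : ‖r‖ ≤ 1 + |t| := by
        refine (norm_sub_le _ _).trans ?_
        simp only [Complex.norm_real, Real.norm_eq_abs, norm_mul, Complex.norm_I, one_mul]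
        rw [abs_of_pos hδ0]; linarith
      have ht0 : 0 < |t| := abs_pos.mpr ht
      have hr0 : 0 < ‖r‖ := ht0.trans_le hr1
      have hl1 : Real.log t ≤ Real.log ‖r‖ := by
        rw [← Real.log_abs]; exact Real.log_le_log ht0 hr1
      have hl2 : Real.log ‖r‖ ≤ |t| := by
        linarith [Real.log_le_sub_one_of_pos hr0]
      have hl3 : ‖Complex.log r‖ ≤ |Real.log t| + 1 + |t| + Real.pi := by
        refine (Complex.norm_le_abs_re_add_abs_im _).trans ?_
        rw [Complex.log_re, Complex.log_im]
        have := Complex.abs_arg_le_pi r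
        have : |Real.log ‖r‖| ≤ |Real.log t| + |t| := by
          rw [_root_.abs_le]
          constructor <;> linarith [neg_abs_le (Real.log t), abs_nonneg (Real.log t)]
        linarith
      rw [norm_div, div_le_iff₀ hr0, norm_mul, norm_neg, norm_mul, Complex.norm_I, one_mul,
        Complex.norm_real, Real.norm_eq_abs, mul_comm]
      refine mul_le_mul ((norm_add_le _ _).trans (add_le_add ?_ hl3)) hr1 ht0.le (by
        have := Real.pi_pos; positivity)
      rw [Complex.norm_real, Real.norm_eq_abs]
    · have := memLp_one_iff_integrable.mp hν
      have h2 : Integrable (fun t : ℝ => |t|) ν := this.norm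
      exact (integrable_const _).add (((hlog.abs.add (integrable_const _)).add h2).add
        (integrable_const _))
    · filter_upwards [h0] with t ht
      have hI : -(Complex.I * t) ≠ 0 := by simpa using ht
      have hslit : (-(Complex.I * t) : ℂ) ∈ Complex.slitPlane := Or.inr (by simpa using ht)
      have hc : Tendsto (fun δ : ℝ => (δ - Complex.I * t : ℂ)) (𝓝[>] 0) (𝓝 (-(Complex.I * t))) := by
        have : Tendsto (fun δ : ℝ => (δ - Complex.I * t : ℂ)) (𝓝 0)
          (𝓝 (((0 : ℝ) : ℂ) - Complex.I * t)) := Continuous.tendsto (by fun_prop) 0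
        rw [Complex.ofReal_zero, zero_sub] at this
        exact this.mono_left nhdsWithin_le_nhds
      have := ((hc.clog hslit).const_add (Real.eulerMascheroniConstant : ℂ)).const_mul
        (-(Complex.I * t)) |>.div hc hI
      rw [mul_div_cancel_left₀ _ hI] at this
      exact this
  have heq : ((∫ θ in (0)..Θ, k' θ * Real.log θ : ℝ) : ℂ)
      = ∫ t : ℝ, (Real.eulerMascheroniConstant + Complex.log (-(Complex.I * t))) ∂ν := by
    refine tendsto_nhds_unique hlim1 (hlim2.congr' ?_)
    filter_upwards [self_mem_nhdsWithin] with δ hδ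
    exact (h.integral_log_mul_exp_mul_deriv hν hδ).symm
  have hI : Integrable (fun t : ℝ => (Real.eulerMascheroniConstant : ℂ)
      + Complex.log (-(Complex.I * t))) ν := by
    refine (integrable_const _).add ?_
    refine (hlog.abs.add (integrable_const Real.pi)).mono'
      (Measurable.aestronglyMeasurable (by fun_prop)) (ae_of_all _ fun t => ?_)
    refine (Complex.norm_le_abs_re_add_abs_im _).trans ?_
    rw [Complex.log_re, Complex.log_im]
    refine add_le_add ?_ (Complex.abs_arg_le_pi _)
    simp
  have := congrArg Complex.re heq
  rw [Complex.ofReal_re] at this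
  rw [this]
  have hre := Complex.reCLM.integral_comp_comm hI
  simp only [Complex.reCLM_apply] at hre
  rw [← hre]
  congr 1; ext t
  simp [Complex.log_re]

end IsBandLimited

/-! ### From the truncation to `ζ` -/

lemma abs_norm_riemannZeta_sq_sub_le {N : ℕ} (hN : 1 ≤ N) (t : ℝ) :
    |‖riemannZeta (1 / 2 + Complex.I * t)‖ ^ 2 - ‖zetaTrunc N t‖ ^ 2|
      ≤ 125 * (N : ℝ) ^ (-(1 / 2) : ℝ) * (1 + |t|) ^ 2 := by
  have h1 := norm_riemannZeta_sub_zetaTrunc_le hN t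
  have h2 := norm_riemannZeta_le t
  have h3 := abs_norm_sub_norm_le (riemannZeta (1 / 2 + Complex.I * t)) (zetaTrunc N t)
  have hP : (N : ℝ) ^ (-(1 / 2) : ℝ) ≤ 1 :=
    Real.rpow_le_one_of_one_le_of_nonpos (by exact_mod_cast hN) (by norm_num)
  have hP0 : 0 ≤ (N : ℝ) ^ (-(1 / 2) : ℝ) := by positivity
  set P := (N : ℝ) ^ (-(1 / 2) : ℝ)
  set a := ‖riemannZeta (1 / 2 + Complex.I * t)‖ with ha
  set b := ‖zetaTrunc N t‖ with hb
  have ha0 : 0 ≤ a := norm_nonneg _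
  have hb0 : 0 ≤ b := norm_nonneg _
  have ht : 0 ≤ |t| := abs_nonneg t
  have h4 : |a - b| ≤ 5 * (1 + |t|) * P := h3.trans h1
  have h5 : a + b ≤ 25 * (1 + |t|) := by
    have := (abs_le.mp h4).1
    nlinarith
  calc |a ^ 2 - b ^ 2| = |a - b| * (a + b) := by
        rw [show a ^ 2 - b ^ 2 = (a - b) * (a + b) by ring, abs_mul,
          abs_of_nonneg (by linarith : 0 ≤ a + b)]
    _ ≤ (5 * (1 + |t|) * P) * (25 * (1 + |t|)) := by gcongr
    _ = 125 * P * (1 + |t|) ^ 2 := by ring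

lemma continuous_riemannZeta_line :
    Continuous fun t : ℝ => riemannZeta (1 / 2 + Complex.I * t) := by
  refine continuous_iff_continuousAt.mpr fun t => ?_
  have h : (1 / 2 + Complex.I * t : ℂ) ≠ 1 := fun h => by
    have := congrArg Complex.re h
    simp at this
  exact (differentiableAt_riemannZeta h).continuousAt.comp
    (f := fun t : ℝ => (1 / 2 + Complex.I * t : ℂ)) (by fun_prop)

lemma continuous_zetaTrunc {N : ℕ} (hN : 1 ≤ N) : Continuous (zetaTrunc N) :=
  (continuous_finsetSum _ fun n _ => IsBandLimited.continuous_cpow_nat n).sub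
    (IsBandLimited.continuous_zetaPole hN)

lemma integrable_norm_riemannZeta_sq {ν : Measure ℝ} [IsFiniteMeasure ν]
    (hν : Integrable (fun t : ℝ => (1 + |t|) ^ 2) ν) :
    Integrable (fun t : ℝ => ‖riemannZeta (1 / 2 + Complex.I * t)‖ ^ 2) ν := by
  refine (hν.const_mul 100).mono'
    (continuous_riemannZeta_line.norm.pow 2).aestronglyMeasurable (ae_of_all _ fun t => ?_)
  rw [Real.norm_of_nonneg (by positivity)]
  have := pow_le_pow_left₀ (norm_nonneg _) (norm_riemannZeta_le t) 2
  linarith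

/-- Mean square of `ζ(1/2 + it)` against a band-limited measure. -/
theorem IsBandLimited.abs_integral_riemannZeta_sub_le {ν : Measure ℝ} {k k' : ℝ → ℝ} {Θ K K₁ : ℝ}
    [IsFiniteMeasure ν] (h : IsBandLimited ν k k' Θ K K₁)
    (hν : Integrable (fun t : ℝ => (1 + |t|) ^ 2) ν) (hν1 : MemLp id 1 ν)
    (hlog : Integrable Real.log ν) (h0 : ∀ᵐ t ∂ν, t ≠ 0) {N : ℕ} (hN : 1 ≤ N) :
    |∫ t, ‖riemannZeta (1 / 2 + Complex.I * t)‖ ^ 2 ∂ν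
      - (∫ t, Real.log t ∂ν
        + ν.real Set.univ * (2 * Real.eulerMascheroniConstant - Real.log (2 * Real.pi)))|
      ≤ 20 * K * Θ ^ (1 / 2 : ℝ) + 14 * K * Θ * (1 + Real.log N)
        + (65 * (K₁ + K) + 125 * ∫ t : ℝ, (1 + |t|) ^ 2 ∂ν) * (N : ℝ) ^ (-(1 / 2) : ℝ) := by
  have h1 := h.abs_integral_zetaTrunc_sub_le hN
  rw [h.integral_deriv_mul_log hν1 hlog h0, integral_add (integrable_const _) hlog,
    integral_const, smul_eq_mul] at h1
  have hk0 : k 0 = ν.real Set.univ := by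
    have := h.charFun_eq 0
    rw [charFun_zero] at this
    exact_mod_cast this.symm
  rw [hk0] at h1
  have hZ := integrable_norm_riemannZeta_sq hν
  have hA : Integrable (fun t => ‖zetaTrunc N t‖ ^ 2) ν := by
    refine (hZ.add (hν.const_mul (125 * (N : ℝ) ^ (-(1 / 2) : ℝ)))).mono'
      ((continuous_zetaTrunc hN).norm.pow 2).aestronglyMeasurable (ae_of_all _ fun t => ?_)
    rw [Real.norm_of_nonneg (by positivity)]
    have := (_root_.abs_le.mp (abs_norm_riemannZeta_sq_sub_le hN t)).1
    simp only [Pi.add_apply]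
    linarith
  have h2 : |∫ t, ‖riemannZeta (1 / 2 + Complex.I * t)‖ ^ 2 ∂ν - ∫ t, ‖zetaTrunc N t‖ ^ 2 ∂ν|
      ≤ 125 * (N : ℝ) ^ (-(1 / 2) : ℝ) * ∫ t : ℝ, (1 + |t|) ^ 2 ∂ν := by
    rw [← integral_sub hZ hA, ← integral_const_mul, ← Real.norm_eq_abs]
    refine norm_integral_le_of_norm_le (hν.const_mul _) (ae_of_all _ fun t => ?_)
    rw [Real.norm_eq_abs]
    exact abs_norm_riemannZeta_sq_sub_le hN t
  rw [_root_.abs_le] at h1 h2 ⊢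
  constructor <;> linarith

/-! ### A probability measure with compactly supported characteristic function -/

open scoped FourierTransform SchwartzMap in
/-- A nonnegative Schwartz function whose inverse Fourier transform is real and supported in
`[-1/8, 1/8]`. -/
lemma exists_nonneg_schwartz_fourierInv_eq_zero :
    ∃ (G : 𝓢(ℝ, ℂ)) (w r : ℝ → ℝ), (∀ t, G t = w t) ∧ (∀ t, 0 ≤ w t) ∧
      (∀ x, 𝓕⁻ (G : ℝ → ℂ) x = r x) ∧ (∀ x, 1 / 8 ≤ |x| → r x = 0) ∧ 0 < r 0 := by
  -- The transform of an even real bump is real, so the transform of its self-convolution is a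
  -- square. The self-convolution is supported in twice the radius `1/16`, and its value at 0 is `∫
  -- ψ² > 0`.
  let ψ : ContDiffBump (0 : ℝ) := ⟨1 / 32, 1 / 16, by norm_num, by norm_num⟩
  have hψc : HasCompactSupport fun x => (ψ x : ℂ) :=
    ψ.hasCompactSupport.comp_left (g := fun x : ℝ => (x : ℂ)) (by simp)
  have hψs : ContDiff ℝ ((⊤ : ℕ∞) : WithTop ℕ∞) fun x => (ψ x : ℂ) :=
    Complex.ofRealCLM.contDiff.comp ψ.contDiff
  let f : 𝓢(ℝ, ℂ) := hψc.toSchwartzMap hψs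
  have hf : ∀ x, f x = (ψ x : ℂ) := fun x => rfl
  let B := ContinuousLinearMap.mul ℂ ℂ
  let C : 𝓢(ℝ, ℂ) := SchwartzMap.convolution B f f
  have hG : ∀ t, 𝓕 C t = 𝓕 f t * 𝓕 f t := fun t => by
    simp only [C, SchwartzMap.fourier_convolution]
    rfl
  have hreal : ∀ t, (starRingEnd ℂ) (𝓕 f t) = 𝓕 f t := fun t => by
    rw [SchwartzMap.fourier_coe, Real.fourier_real_eq_integral_exp_smul, ← integral_conj,
      ← integral_neg_eq_self (fun v => _)]
    congr 1; ext v
    simp only [smul_eq_mul, map_mul, hf, ψ.neg, ← Complex.exp_conj, Complex.conj_ofReal,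
      Complex.conj_I]
    push_cast
    ring_nf
  have hre : ∀ t, ((𝓕 f t).re : ℂ) = 𝓕 f t := fun t => Complex.conj_eq_iff_re.mp (hreal t)
  refine ⟨𝓕 C, fun t => (𝓕 f t).re ^ 2, fun x => ∫ y, ψ y * ψ (x - y), fun t => ?_,
    fun t => by positivity, fun x => ?_, fun x hx => ?_, ?_⟩
  · rw [hG]; push_cast; rw [hre]; ring
  · rw [← SchwartzMap.fourierInv_coe, FourierTransform.fourierInv_fourier_eq]
    simp only [C, SchwartzMap.convolution_apply]
    rw [convolution_def, ← integral_complex_ofReal]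
    congr 1; ext y
    simp [B, hf]
  · refine integral_eq_zero_of_ae (ae_of_all _ fun y => ?_)
    by_cases hy : |y| < 1 / 16
    · have : ψ (x - y) = 0 := ψ.zero_of_le_dist (by
        rw [Real.dist_eq, sub_zero]
        have := abs_sub_abs_le_abs_sub x y
        simp only [ψ]; linarith)
      simp [this]
    · have : ψ y = 0 := ψ.zero_of_le_dist (by
        rw [Real.dist_eq, sub_zero]; simp only [ψ]; linarith)
      simp [this]
  · have h1 : ∀ y, ψ y * ψ (0 - y) = ψ y * ψ y := fun y => by rw [zero_sub, ψ.neg]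
    simp only [h1]
    refine Continuous.integral_pos_of_hasCompactSupport_nonneg_nonzero
      (x := 0) (ψ.continuous.mul ψ.continuous) ψ.hasCompactSupport.mul_left
      (fun y => mul_self_nonneg _) ?_
    rw [ψ.one_of_mem_closedBall (Metric.mem_closedBall_self (by norm_num))]
    norm_num

open scoped FourierTransform SchwartzMap in
/-- A probability measure with all moments and a compactly supported characteristic function. -/
lemma exists_probabilityMeasure_charFun_eq_zero :
    ∃ μ : Measure ℝ, IsProbabilityMeasure μ ∧ (∀ n : ℕ, Integrable (fun t => |t| ^ n) μ) ∧
      (∀ θ, (charFun μ θ).im = 0) ∧ ∀ θ, 1 ≤ |θ| → charFun μ θ = 0 := by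
  obtain ⟨G, w, r, hGw, hw, hr, hr0, hrpos⟩ := exists_nonneg_schwartz_fourierInv_eq_zero
  have hwG : w = fun t => (G t).re := by ext t; rw [hGw, Complex.ofReal_re]
  have hwc : Continuous w := by
    rw [hwG]; exact Complex.continuous_re.comp G.continuous
  have hwi : Integrable w := by rw [hwG]; exact G.integrable.re
  have hI : ∫ t, w t = r 0 := by
    have := hr 0
    rw [Real.fourierInv_eq] at this
    simp only [inner_zero_right, AddChar.map_zero_eq_one, one_smul, hGw] at this
    rw [integral_complex_ofReal] at this
    exact_mod_cast this
  set d : ℝ → ENNReal := fun t => ENNReal.ofReal (w t / r 0) with hd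
  have hdm : Measurable d := (hwc.div_const _).measurable.ennreal_ofReal
  have hdlt : ∀ᵐ t : ℝ, d t < ⊤ := ae_of_all _ fun t => ENNReal.ofReal_lt_top
  have hdr : ∀ t, (d t).toReal = w t / r 0 := fun t =>
    ENNReal.toReal_ofReal (div_nonneg (hw t) hrpos.le)
  have hchar : ∀ θ, charFun (volume.withDensity d) θ = ((r (θ / (2 * Real.pi)) / r 0 : ℝ) : ℂ) := by
    intro θ
    rw [charFun_apply_real, integral_withDensity_eq_integral_toReal_smul hdm hdlt]
    push_cast
    rw [← hr, Real.fourierInv_eq', ← integral_div]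
    congr 1; ext t
    rw [hdr, hGw, Complex.real_smul, smul_eq_mul]
    have : (2 * Real.pi * inner ℝ t (θ / (2 * Real.pi)) : ℝ) = θ * t := by
      simp only [inner, star_trivial, RCLike.re_to_real]
      field_simp
    rw [this]
    push_cast
    ring
  refine ⟨volume.withDensity d, ⟨?_⟩, fun n => ?_, fun θ => ?_, fun θ hθ => ?_⟩
  · rw [withDensity_apply _ MeasurableSet.univ, Measure.restrict_univ,
      ← ofReal_integral_eq_lintegral_ofReal (hwi.div_const _)
        (ae_of_all _ fun t => div_nonneg (hw t) hrpos.le), integral_div, hI,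
      div_self hrpos.ne', ENNReal.ofReal_one]
  · rw [integrable_withDensity_iff_integrable_smul' hdm hdlt]
    refine ((G.integrable_pow_mul volume n).div_const (r 0)).congr (ae_of_all _ fun t => ?_)
    simp only [hdr, hGw, Complex.norm_real, Real.norm_eq_abs, abs_of_nonneg (hw t), smul_eq_mul]
    ring
  · rw [hchar, Complex.ofReal_im]
  · rw [hchar, hr0, zero_div, Complex.ofReal_zero]
    -- The Fourier normalisation rescales by `2π`, and `1/(2π) ≥ 1/8` because `π < 4`.
    rw [abs_div, abs_of_pos Real.two_pi_pos, le_div_iff₀ Real.two_pi_pos]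
    have := Real.pi_lt_four
    linarith

/-! ### Smeared Lebesgue measure on an interval -/

lemma memLp_id_one {ν : Measure ℝ} (h : Integrable (fun t : ℝ => |t|) ν) : MemLp id 1 ν :=
  memLp_one_iff_integrable.mpr ((integrable_norm_iff aestronglyMeasurable_id).mp h)

lemma norm_deriv_charFun_le {ν : Measure ℝ} [IsFiniteMeasure ν] (h : MemLp id 1 ν) (θ : ℝ) :
    ‖deriv (charFun ν) θ‖ ≤ ∫ t, |t| ∂ν := by
  have h1 : MemLp id ((1 : ℕ) : ENNReal) ν := by exact_mod_cast h
  rw [← iteratedDeriv_one, iteratedDeriv_charFun h1, pow_one, norm_mul, Complex.norm_I, one_mul]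
  refine norm_integral_le_of_norm_le (memLp_one_iff_integrable.mp h).abs (ae_of_all _ fun t => ?_)
  have : ((θ : ℂ) * t * Complex.I) = ((θ * t : ℝ) : ℂ) * Complex.I := by push_cast; rfl
  rw [norm_mul, this, Complex.norm_exp_ofReal_mul_I, mul_one, pow_one, Complex.norm_real,
    Real.norm_eq_abs]

lemma contDiff_one_charFun {ν : Measure ℝ} [IsFiniteMeasure ν] (h : MemLp id 1 ν) :
    ContDiff ℝ 1 (charFun ν) := by
  have h1 : MemLp id ((1 : ℕ) : ENNReal) ν := by exact_mod_cast h
  exact_mod_cast contDiff_charFun h1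

lemma mul_charFun_restrict_Ioc {T : ℝ} (hT : 0 ≤ T) (θ : ℝ) :
    (θ : ℂ) * charFun (volume.restrict (Set.Ioc (-T) T)) θ = (2 * Real.sin (T * θ) : ℝ) := by
  rcases eq_or_ne θ 0 with rfl | hθ
  · simp
  have hc : (θ : ℂ) * Complex.I ≠ 0 := mul_ne_zero (by exact_mod_cast hθ) Complex.I_ne_zero
  have hc' : (θ : ℂ) ≠ 0 := by exact_mod_cast hθ
  rw [charFun_apply_real, ← intervalIntegral.integral_of_le (by linarith)]
  have : ∀ x : ℝ, Complex.exp (θ * x * Complex.I) = Complex.exp (θ * Complex.I * x) := fun x => by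
    ring_nf
  simp_rw [this]
  rw [integral_exp_mul_complex hc]
  push_cast
  rw [Complex.sin]
  field_simp
  rw [Complex.I_sq]
  ring_nf

/-- The convolution of a dilate of `μ` with Lebesgue measure on `(-T, T]`. -/
noncomputable def smear (μ : Measure ℝ) (D T : ℝ) : Measure ℝ :=
  (μ.map (D * ·)) ∗ (volume.restrict (Set.Ioc (-T) T))

section Smear

variable {μ : Measure ℝ} {D T : ℝ}

instance [IsProbabilityMeasure μ] : IsProbabilityMeasure (μ.map (D * ·)) :=
  Measure.isProbabilityMeasure_map (by fun_prop)

instance [IsProbabilityMeasure μ] : IsFiniteMeasure (smear μ D T) := by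
  unfold smear; infer_instance

lemma integral_smear [IsProbabilityMeasure μ] (hD : D ≠ 0) (hT : 0 ≤ T) {f : ℝ → ℝ}
    (hf : Integrable f (smear μ D T)) :
    ∫ t, f t ∂(smear μ D T) = ∫ u, (∫ y in (D * u - T)..(D * u + T), f y) ∂μ := by
  unfold smear at hf ⊢
  rw [integral_conv hf, (measurableEmbedding_mulLeft₀ hD).integral_map]
  congr 1; ext u
  rw [← intervalIntegral.integral_of_le (by linarith),
    intervalIntegral.integral_comp_add_left (fun y => f y), ← sub_eq_add_neg]

lemma integrable_smear (hD : D ≠ 0) (hT : 0 ≤ T) {f g : ℝ → ℝ} (hf : Measurable f)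
    (hfi : ∀ a b, IntervalIntegrable f volume a b) (hg : Integrable g μ)
    (hfg : ∀ u, ∫ y in (D * u - T)..(D * u + T), |f y| ≤ g u) :
    Integrable f (smear μ D T) := by
  unfold smear
  rw [integrable_conv_iff hf.aestronglyMeasurable]
  refine ⟨ae_of_all _ fun x => ?_, ?_⟩
  · have := (hfi (x + -T) (x + T)).comp_add_left x
    simp only [add_sub_cancel_left] at this
    exact (intervalIntegrable_iff_integrableOn_Ioc_of_le (by linarith)).mp this
  · rw [(measurableEmbedding_mulLeft₀ hD).integrable_map_iff]
    have hm : StronglyMeasurable fun x : ℝ =>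
        ∫ y, ‖f (x + y)‖ ∂(volume.restrict (Set.Ioc (-T) T)) :=
      StronglyMeasurable.integral_prod_right
        (f := fun x y => ‖f (x + y)‖) (by
          refine Measurable.stronglyMeasurable ?_
          simp only [Function.uncurry_def]
          exact (hf.comp (measurable_fst.add measurable_snd)).norm)
    refine hg.mono' (hm.comp_measurable (measurable_const_mul D)).aestronglyMeasurable
      (ae_of_all _ fun u => ?_)
    simp only [Function.comp]
    rw [Real.norm_of_nonneg (integral_nonneg fun _ => norm_nonneg _),
      ← intervalIntegral.integral_of_le (by linarith)]
    simp only [Real.norm_eq_abs]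
    rw [intervalIntegral.integral_comp_add_left (fun y => |f y|), ← sub_eq_add_neg]
    exact hfg u

lemma integral_le_of_monotone_abs {φ : ℝ → ℝ} (hφ : Continuous φ) (hm : MonotoneOn φ (Set.Ici 0))
    (hT : 0 ≤ T) (x : ℝ) :
    ∫ y in (x - T)..(x + T), φ |y| ≤ 2 * T * φ (|x| + T) := by
  have h : ∫ y in (x - T)..(x + T), φ |y| ≤ ∫ y in (x - T)..(x + T), φ (|x| + T) := by
    refine intervalIntegral.integral_mono_on (by linarith)
      ((hφ.comp continuous_abs).intervalIntegrable _ _) (by simp) fun y hy => ?_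
    refine hm (abs_nonneg y) (by simp only [Set.mem_Ici]; positivity) ?_
    rw [abs_le]
    constructor <;> linarith [neg_abs_le x, le_abs_self x, hy.1, hy.2]
  refine h.trans_eq ?_
  rw [intervalIntegral.integral_const, smul_eq_mul]
  ring

lemma integrable_abs_of_moments
    (hμ : ∀ n : ℕ, Integrable (fun t : ℝ => |t| ^ n) μ) :
    Integrable (fun t : ℝ => |t|) μ := by simpa using hμ 1

lemma integrable_add_sq [IsProbabilityMeasure μ]
    (hμ : ∀ n : ℕ, Integrable (fun t : ℝ => |t| ^ n) μ) :
    Integrable (fun t : ℝ => (2 + |t|) ^ 2) μ := by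
  have : (fun t : ℝ => (2 + |t|) ^ 2) = fun t : ℝ => 4 + 4 * |t| + |t| ^ 2 := by ext t; ring
  rw [this]
  exact ((integrable_const _).add ((integrable_abs_of_moments hμ).const_mul 4)).add (hμ 2)

lemma integrable_abs_smear [IsProbabilityMeasure μ]
    (hμ : ∀ n : ℕ, Integrable (fun t : ℝ => |t| ^ n) μ)
    (hD : 0 < D) (hT : 0 ≤ T) :
    Integrable (fun t : ℝ => |t|) (smear μ D T) ∧
      ∫ t, |t| ∂(smear μ D T) ≤ 2 * T * (D * ∫ u, |u| ∂μ + T) := by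
  have hb : ∀ u, ∫ y in (D * u - T)..(D * u + T), |y| ≤ 2 * T * (D * |u| + T) := fun u => by
    have := integral_le_of_monotone_abs (φ := id) continuous_id (fun _ _ _ _ h => h) hT (D * u)
    simpa [abs_mul, abs_of_pos hD] using this
  have hg : Integrable (fun u : ℝ => 2 * T * (D * |u| + T)) μ :=
    (((integrable_abs_of_moments hμ).const_mul D).add (integrable_const _)).const_mul _
  have hi : Integrable (fun t : ℝ => |t|) (smear μ D T) := by
    refine integrable_smear hD.ne' hT (by fun_prop)
      (fun a b => continuous_abs.intervalIntegrable _ _) hg (fun u => ?_)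
    simpa using hb u
  refine ⟨hi, ?_⟩
  rw [integral_smear hD.ne' hT hi]
  refine (integral_mono_of_nonneg (ae_of_all _ fun u => ?_) hg (ae_of_all _ hb)).trans_eq ?_
  · exact intervalIntegral.integral_nonneg (by linarith) fun _ _ => abs_nonneg _
  · rw [integral_const_mul, integral_add ((integrable_abs_of_moments hμ).const_mul D)
      (integrable_const _), integral_const_mul]
    simp

lemma integrable_one_add_sq_smear [IsProbabilityMeasure μ]
    (hμ : ∀ n : ℕ, Integrable (fun t : ℝ => |t| ^ n) μ)
    (hD : 0 < D) (hDT : D ≤ T) (hT : 1 ≤ T) :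
    Integrable (fun t : ℝ => (1 + |t|) ^ 2) (smear μ D T) ∧
      ∫ t, (1 + |t|) ^ 2 ∂(smear μ D T) ≤ 2 * T ^ 3 * ∫ u, (2 + |u|) ^ 2 ∂μ := by
  have hT0 : 0 ≤ T := by linarith
  have hb : ∀ u, ∫ y in (D * u - T)..(D * u + T), (1 + |y|) ^ 2 ≤ 2 * T ^ 3 * (2 + |u|) ^ 2 :=
      fun u => by
    have h1 := integral_le_of_monotone_abs (φ := fun y => (1 + y) ^ 2) (by fun_prop)
      (fun a ha b hb h => by
        simp only [Set.mem_Ici] at ha hb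
        exact pow_le_pow_left₀ (by linarith) (by linarith) 2) hT0 (D * u)
    refine h1.trans ?_
    have h2 : 1 + (|D * u| + T) ≤ T * (2 + |u|) := by
      rw [abs_mul, abs_of_pos hD]
      nlinarith [abs_nonneg u]
    calc 2 * T * (1 + (|D * u| + T)) ^ 2 ≤ 2 * T * (T * (2 + |u|)) ^ 2 := by gcongr
      _ = _ := by ring
  have hg : Integrable (fun u : ℝ => 2 * T ^ 3 * (2 + |u|) ^ 2) μ :=
    (integrable_add_sq hμ).const_mul _
  have hi : Integrable (fun t : ℝ => (1 + |t|) ^ 2) (smear μ D T) := by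
    refine integrable_smear hD.ne' hT0 (by fun_prop)
      (fun a b => Continuous.intervalIntegrable (by fun_prop) _ _) hg (fun u => ?_)
    simpa [abs_of_nonneg, pow_nonneg] using hb u
  refine ⟨hi, ?_⟩
  rw [integral_smear hD.ne' hT0 hi, ← integral_const_mul]
  refine integral_mono_of_nonneg (ae_of_all _ fun u => ?_) hg (ae_of_all _ hb)
  exact intervalIntegral.integral_nonneg (by linarith) fun _ _ => by positivity

/-- Here `k(θ) = ω(Dθ) · 2 sin(Tθ)/θ` with `ω` the characteristic function of `μ`: the first factor
supplies the support, the second the size. Bounding `k'` by the first moment gives only order `T²`,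
but `θ k'` has order `T`. -/
lemma isBandLimited_smear [IsProbabilityMeasure μ]
    (hμ : ∀ n : ℕ, Integrable (fun t : ℝ => |t| ^ n) μ)
    (him : ∀ θ, (charFun μ θ).im = 0)
    (hsupp : ∀ θ, 1 ≤ |θ| → charFun μ θ = 0) (hD : 2 ≤ D) (hDT : D ≤ T) :
    IsBandLimited (smear μ D T) (fun θ => (charFun (smear μ D T) θ).re)
      (fun θ => (deriv (charFun (smear μ D T)) θ).re) (1 / D)
      ((4 + 2 * ∫ u, |u| ∂μ) * T) (2 * (1 + ∫ u, |u| ∂μ) * T ^ 2) := by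
  have hD0 : 0 < D := by linarith
  have hT0 : 0 ≤ T := by linarith
  have hc0 : 0 ≤ ∫ u, |u| ∂μ := integral_nonneg fun _ => abs_nonneg _
  obtain ⟨hi, hib⟩ := integrable_abs_smear hμ hD0 hT0
  have hcd := contDiff_one_charFun (memLp_id_one hi)
  have hcdμ := contDiff_one_charFun (memLp_id_one (integrable_abs_of_moments hμ))
  set ω := charFun μ with hω
  set m := charFun (volume.restrict (Set.Ioc (-T) T)) with hm
  have hprod : ∀ θ, charFun (smear μ D T) θ = ω (D * θ) * m θ := fun θ => by
    rw [smear, charFun_conv, charFun_map_mul]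
  have hωre : ∀ θ, ω θ = ((ω θ).re : ℂ) := fun θ => Complex.ext rfl (him θ)
  have hωle : ∀ θ, |(ω θ).re| ≤ 1 := fun θ =>
    (Complex.abs_re_le_norm _).trans (norm_charFun_le_one θ)
  have hmim : ∀ θ, (m θ).im = 0 := fun θ => by
    rcases eq_or_ne θ 0 with rfl | hθ
    · simp [hm]
    · have := congrArg Complex.im (mul_charFun_restrict_Ioc hT0 θ)
      rw [Complex.ofReal_im, Complex.im_ofReal_mul] at this
      exact (mul_eq_zero.mp this).resolve_left hθ
  have hmre : ∀ θ, m θ = ((m θ).re : ℂ) := fun θ => Complex.ext rfl (hmim θ)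
  have hvol : (volume.restrict (Set.Ioc (-T) T)).real Set.univ = 2 * T := by
    simp only [measureReal_restrict_apply_univ, Real.volume_real_Ioc]
    rw [max_eq_left (by linarith)]; ring
  have hkre : ∀ θ, (charFun (smear μ D T) θ).re = (ω (D * θ)).re * (m θ).re := fun θ => by
    rw [hprod, Complex.mul_re, him, zero_mul, sub_zero]
  have hk : ∀ θ, HasDerivAt (fun θ => (charFun (smear μ D T) θ).re)
      (deriv (charFun (smear μ D T)) θ).re θ := fun θ => by
    have := (hcd.differentiable (by norm_num) θ).hasDerivAt
    exact (Complex.reCLM.hasFDerivAt.comp_hasDerivAt θ this)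
  have hωd : ∀ θ, HasDerivAt (fun θ => (ω θ).re) (deriv ω θ).re θ := fun θ => by
    have := (hcdμ.differentiable (by norm_num) θ).hasDerivAt
    exact (Complex.reCLM.hasFDerivAt.comp_hasDerivAt θ this)
  have hωd' : ∀ θ, |(deriv ω θ).re| ≤ ∫ u, |u| ∂μ := fun θ =>
    (Complex.abs_re_le_norm _).trans
      (norm_deriv_charFun_le (memLp_id_one (integrable_abs_of_moments hμ)) θ)
  have hkle : ∀ θ, |(charFun (smear μ D T) θ).re| ≤ 2 * T := fun θ => by
    rw [hkre, abs_mul]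
    have h1 : |(m θ).re| ≤ 2 * T :=
      (Complex.abs_re_le_norm _).trans ((norm_charFun_le θ).trans_eq hvol)
    nlinarith [hωle (D * θ), abs_nonneg (ω (D * θ)).re, abs_nonneg (m θ).re]
  refine ⟨fun θ => ?_, hk, ?_, fun θ => ?_, fun θ => ?_, fun θ => ?_, fun θ hθ => ?_,
    by positivity, ?_⟩
  · rw [hkre, hprod, hωre, hmre]
    push_cast
    simp
  · exact Complex.continuous_re.comp (hcd.continuous_deriv (by norm_num))
  · refine (hkle θ).trans ?_
    nlinarith
  · have h1 : ∀ θ, θ * (charFun (smear μ D T) θ).re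
        = 2 * Real.sin (T * θ) * (ω (D * θ)).re := fun θ => by
      have := congrArg Complex.re (mul_charFun_restrict_Ioc hT0 θ)
      rw [Complex.ofReal_re, Complex.re_ofReal_mul] at this
      rw [hkre, ← this]
      ring
    have h2 := (hasDerivAt_id θ).mul (hk θ)
    have h3 : HasDerivAt (fun θ => 2 * Real.sin (T * θ) * (ω (D * θ)).re)
        (2 * (Real.cos (T * θ) * T) * (ω (D * θ)).re
          + 2 * Real.sin (T * θ) * ((deriv ω (D * θ)).re * D)) θ := by
      have ha : HasDerivAt (fun θ : ℝ => T * θ) T θ := by simpa using (hasDerivAt_id θ).const_mul T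
      have hb : HasDerivAt (fun θ : ℝ => D * θ) D θ := by simpa using (hasDerivAt_id θ).const_mul D
      exact ((ha.sin).const_mul 2).mul ((hωd (D * θ)).comp θ hb)
    have h4 := h2.unique (h3.congr_of_eventuallyEq (Eventually.of_forall h1))
    simp only [one_mul, id] at h4
    have h5 : θ * (deriv (charFun (smear μ D T)) θ).re
        = 2 * (Real.cos (T * θ) * T) * (ω (D * θ)).re
          + 2 * Real.sin (T * θ) * ((deriv ω (D * θ)).re * D)
          - (charFun (smear μ D T) θ).re := by linarith
    rw [h5]
    have h6 : |2 * (Real.cos (T * θ) * T) * (ω (D * θ)).re| ≤ 2 * T := by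
      rw [abs_mul, abs_mul, abs_mul, abs_two, abs_of_nonneg hT0]
      calc 2 * (|Real.cos (T * θ)| * T) * |(ω (D * θ)).re| ≤ 2 * (1 * T) * 1 := by
            gcongr
            · exact Real.abs_cos_le_one _
            · exact hωle _
        _ = 2 * T := by ring
    have h7 : |2 * Real.sin (T * θ) * ((deriv ω (D * θ)).re * D)| ≤ 2 * (∫ u, |u| ∂μ) * T := by
      rw [abs_mul, abs_mul, abs_mul, abs_two, abs_of_pos hD0]
      calc 2 * |Real.sin (T * θ)| * (|(deriv ω (D * θ)).re| * D)
          ≤ 2 * 1 * ((∫ u, |u| ∂μ) * T) := by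
            gcongr
            · exact Real.abs_sin_le_one _
            · exact hωd' _
        _ = _ := by ring
    have h8 := hkle θ
    rw [abs_le] at *
    constructor <;> linarith
  · refine (Complex.abs_re_le_norm _).trans
      ((norm_deriv_charFun_le (memLp_id_one hi) θ).trans (hib.trans ?_))
    nlinarith [mul_le_mul_of_nonneg_right hDT (mul_nonneg hT0 hc0)]
  · have : 1 ≤ |D * θ| := by
      rw [abs_mul, abs_of_pos hD0]
      rwa [div_le_iff₀' hD0] at hθ
    rw [hkre, hsupp _ this]
    simp
  · exact one_div_le_one_div_of_le (by norm_num) hD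

end Smear

/-! ### The mean of the logarithm under smearing -/

lemma sub_one_le_mul_log {y : ℝ} (hy : 0 < y) : y - 1 ≤ y * Real.log y := by
  have := mul_le_mul_of_nonneg_left (Real.one_sub_inv_le_log_of_pos hy) hy.le
  rwa [mul_sub, mul_inv_cancel₀ hy.ne', mul_one] at this

lemma mul_log_le {y : ℝ} (hy : 0 < y) : y * Real.log y ≤ y * (y - 1) :=
  mul_le_mul_of_nonneg_left (Real.log_le_sub_one_of_pos hy) hy.le

/-- The first-order terms cancel by symmetry. All real `v` are needed, since a shifted window may
lie on one side of 0; beyond `|v| = 1` the logarithm is that of the absolute value. -/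
lemma abs_mul_log_add_mul_log_le (v : ℝ) :
    |(1 + v) * Real.log (1 + v) + (1 - v) * Real.log (1 - v)| ≤ 3 * v ^ 2 := by
  wlog hv : 0 ≤ v generalizing v
  · have := this (-v) (by linarith)
    rwa [neg_sq, sub_neg_eq_add, ← sub_eq_add_neg, add_comm] at this
  have h1 := sub_one_le_mul_log (y := 1 + v) (by linarith)
  have h2 := mul_log_le (y := 1 + v) (by linarith)
  rcases lt_trichotomy v 1 with h | h | h
  · have h3 := sub_one_le_mul_log (y := 1 - v) (by linarith)
    have h4 := mul_log_le (y := 1 - v) (by linarith)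
    rw [abs_le]
    constructor <;> nlinarith
  · subst h
    rw [abs_le]
    constructor <;> norm_num at * <;> linarith
  · have h3 := sub_one_le_mul_log (y := v - 1) (by linarith)
    have h4 := mul_log_le (y := v - 1) (by linarith)
    have h5 : (1 - v) * Real.log (1 - v) = -((v - 1) * Real.log (v - 1)) := by
      rw [← Real.log_neg_eq_log (1 - v), neg_sub]; ring
    rw [h5, abs_le]
    constructor <;> nlinarith

/-- Scaling by `T` reduces to `v = x/T`. The quadratic error in the shift can be averaged using the
second moment of `μ`. -/
lemma abs_integral_log_sub_le {T : ℝ} (hT : 0 < T) (x : ℝ) :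
    |(∫ y in (x - T)..(x + T), Real.log y) - 2 * (T * Real.log T - T)| ≤ 3 * x ^ 2 / T := by
  set v := x / T with hv
  have hx : x = T * v := by rw [hv]; field_simp
  have key : ∀ w : ℝ, (T * w) * Real.log (T * w) = T * w * Real.log T + T * (w * Real.log w) := by
    intro w
    rcases eq_or_ne w 0 with rfl | hw
    · simp
    · rw [Real.log_mul hT.ne' hw]; ring
  have h1 : (∫ y in (x - T)..(x + T), Real.log y) - 2 * (T * Real.log T - T)
      = T * ((1 + v) * Real.log (1 + v) + (1 - v) * Real.log (1 - v)) := by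
    have e1 : x + T = T * (1 + v) := by rw [hx]; ring
    have e2 : x - T = -(T * (1 - v)) := by rw [hx]; ring
    rw [integral_log, e1, e2, Real.log_neg_eq_log, neg_mul, key, key]
    ring
  rw [h1, abs_mul, abs_of_pos hT]
  calc T * _ ≤ T * (3 * v ^ 2) := by gcongr; exact abs_mul_log_add_mul_log_le v
    _ = 3 * x ^ 2 / T := by rw [hx]; field_simp

lemma abs_log_le_two_mul_sq_sub_log (y : ℝ) : |Real.log y| ≤ 2 * y ^ 2 - Real.log y := by
  have h : Real.log y ≤ y ^ 2 := by
    rcases eq_or_ne y 0 with rfl | hy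
    · simp
    · have := Real.log_le_sub_one_of_pos (abs_pos.mpr hy)
      rw [Real.log_abs] at this
      nlinarith [sq_abs y, sq_nonneg (|y| - 1)]
  rw [abs_le]
  constructor <;> nlinarith [sq_nonneg y]

lemma integrable_log_smear {μ : Measure ℝ} [IsProbabilityMeasure μ] {D T : ℝ}
    (hμ : ∀ n : ℕ, Integrable (fun t : ℝ => |t| ^ n) μ) (hD : 0 < D) (hT : 0 < T) :
    Integrable Real.log (smear μ D T) ∧
      |∫ t, Real.log t ∂(smear μ D T) - 2 * (T * Real.log T - T)|
        ≤ 3 * D ^ 2 * (∫ u, |u| ^ 2 ∂μ) / T := by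
  set A := |2 * (T * Real.log T - T)| with hA
  have hb : ∀ x, ∫ y in (x - T)..(x + T), |Real.log y|
      ≤ 2 * T * (2 * (|x| + T) ^ 2) + A + 3 * x ^ 2 / T := fun x => by
    have h2 : IntervalIntegrable (fun y : ℝ => 2 * |y| ^ 2) volume (x - T) (x + T) :=
      Continuous.intervalIntegrable (by fun_prop) _ _
    have h1 : ∫ y in (x - T)..(x + T), |Real.log y|
        ≤ ∫ y in (x - T)..(x + T), (2 * |y| ^ 2 - Real.log y) := by
      refine intervalIntegral.integral_mono_on (by linarith)
        intervalIntegral.intervalIntegrable_log'.abs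
        (h2.sub intervalIntegral.intervalIntegrable_log') fun y _ => ?_
      rw [sq_abs]
      exact abs_log_le_two_mul_sq_sub_log y
    rw [intervalIntegral.integral_sub h2 intervalIntegral.intervalIntegrable_log'] at h1
    have h3 := integral_le_of_monotone_abs (φ := fun y => 2 * y ^ 2) (by fun_prop)
      (fun a ha b hb h => by
        simp only [Set.mem_Ici] at ha hb
        exact mul_le_mul_of_nonneg_left (pow_le_pow_left₀ ha h 2) zero_le_two) hT.le x
    have h4 := (abs_le.mp (abs_integral_log_sub_le hT x)).1
    have h5 := neg_abs_le (2 * (T * Real.log T - T))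
    linarith
  have hi : Integrable Real.log (smear μ D T) := by
    refine integrable_smear (g := fun u => 2 * T * (2 * (D ^ 2 * |u| ^ 2 + 2 * D * T * |u| + T ^ 2))
      + A + 3 * D ^ 2 / T * |u| ^ 2) hD.ne' hT.le Real.measurable_log
      (fun a b => intervalIntegral.intervalIntegrable_log') ?_ (fun u => ?_)
    · have i1 := integrable_abs_of_moments hμ
      have i2 := hμ 2
      exact ((((((i2.const_mul _).add (i1.const_mul _)).add (integrable_const _)).const_mul
        _).const_mul _).add (integrable_const _)).add (i2.const_mul _)
    · refine (hb (D * u)).trans_eq ?_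
      rw [abs_mul, abs_of_pos hD, mul_pow, ← sq_abs u]
      ring
  refine ⟨hi, ?_⟩
  rw [integral_smear hD.ne' hT.le hi]
  have hb' : ∀ u, |(∫ y in (D * u - T)..(D * u + T), Real.log y) - 2 * (T * Real.log T - T)|
      ≤ 3 * D ^ 2 / T * |u| ^ 2 := fun u => by
    refine (abs_integral_log_sub_le hT (D * u)).trans_eq ?_
    rw [sq_abs]; ring
  have hd : Integrable (fun u => (∫ y in (D * u - T)..(D * u + T), Real.log y)
      - 2 * (T * Real.log T - T)) μ := by
    refine ((hμ 2).const_mul (3 * D ^ 2 / T)).mono' ?_ (ae_of_all _ hb')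
    simp only [integral_log]
    exact Measurable.aestronglyMeasurable (by fun_prop)
  have hm : Integrable (fun u => ∫ y in (D * u - T)..(D * u + T), Real.log y) μ := by
    refine (hd.add (integrable_const (2 * (T * Real.log T - T)))).congr (ae_of_all _ fun u => ?_)
    simp only [Pi.add_apply, sub_add_cancel]
  have he : 2 * (T * Real.log T - T) = ∫ _u, 2 * (T * Real.log T - T) ∂μ := by simp
  rw [he, ← integral_sub hm (integrable_const _), ← Real.norm_eq_abs]
  refine (norm_integral_le_of_norm_le ((hμ 2).const_mul (3 * D ^ 2 / T))
    (ae_of_all _ hb')).trans_eq ?_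
  rw [integral_const_mul]
  ring

lemma measureReal_smear_univ {μ : Measure ℝ} [IsProbabilityMeasure μ] {D T : ℝ} (hT : 0 ≤ T) :
    (smear μ D T).real Set.univ = 2 * T := by
  have h := charFun_zero (smear μ D T)
  rw [smear, charFun_conv, charFun_zero, charFun_zero, probReal_univ] at h
  simp only [measureReal_restrict_apply_univ, Real.volume_real_Ioc] at h
  rw [max_eq_left (by linarith)] at h
  rw [smear]
  have h' : (2 * T : ℂ) = (2 * T : ℝ) := by push_cast; rfl
  norm_cast at h
  rw [← h]; ring

lemma ae_ne_zero_smear {μ : Measure ℝ} {D T : ℝ} : ∀ᵐ t ∂(smear μ D T), t ≠ 0 :=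
  (Measure.conv_absolutelyContinuous Measure.restrict_le_self.absolutelyContinuous).ae_le
    (Measure.ae_ne volume 0)

/-! ### Comparison of smeared and sharp cutoffs -/

theorem abs_integral_riemannZeta_smear_sub_le {μ : Measure ℝ} [IsProbabilityMeasure μ] {D T : ℝ}
    (hμ : ∀ n : ℕ, Integrable (fun t : ℝ => |t| ^ n) μ) (him : ∀ θ, (charFun μ θ).im = 0)
    (hsupp : ∀ θ, 1 ≤ |θ| → charFun μ θ = 0) (hD : 2 ≤ D) (hDT : D ≤ T) {N : ℕ} (hN : 1 ≤ N) :
    |∫ t, ‖riemannZeta (1 / 2 + Complex.I * t)‖ ^ 2 ∂(smear μ D T)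
      - 2 * T * (Real.log T - 1 + 2 * Real.eulerMascheroniConstant - Real.log (2 * Real.pi))|
      ≤ 3 * D ^ 2 * (∫ u, |u| ^ 2 ∂μ) / T
        + (4 + 2 * ∫ u, |u| ∂μ) * T * (20 * (1 / D) ^ (1 / 2 : ℝ) + 14 / D * (1 + Real.log N))
        + (65 * (2 * (1 + ∫ u, |u| ∂μ) * T ^ 2 + (4 + 2 * ∫ u, |u| ∂μ) * T)
          + 250 * T ^ 3 * ∫ u, (2 + |u|) ^ 2 ∂μ) * (N : ℝ) ^ (-(1 / 2) : ℝ) := by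
  obtain ⟨hs, hs'⟩ := integrable_one_add_sq_smear hμ (by linarith : 0 < D) hDT (by linarith)
  obtain ⟨hl, hl'⟩ := integrable_log_smear hμ (by linarith : 0 < D) (by linarith : 0 < T)
  have h := (isBandLimited_smear hμ him hsupp hD hDT).abs_integral_riemannZeta_sub_le hs
    (memLp_id_one (integrable_abs_smear hμ (by linarith) (by linarith)).1) hl ae_ne_zero_smear hN
  rw [measureReal_smear_univ (by linarith)] at h
  have hP : 0 ≤ (N : ℝ) ^ (-(1 / 2) : ℝ) := by positivity
  have h2 := mul_le_mul_of_nonneg_right (mul_le_mul_of_nonneg_left hs' (by norm_num : (0 : ℝ) ≤ 125))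
    hP
  rw [abs_le] at *
  constructor
  · linear_combination h.1 + hl'.1 + h2
  · linear_combination h.2 + hl'.2 + h2

lemma integrable_integral_smear {μ : Measure ℝ} {D T : ℝ} (hD : D ≠ 0) (hT : 0 ≤ T) {f : ℝ → ℝ}
    (hf : Integrable f (smear μ D T)) (h0 : ∀ t, 0 ≤ f t) :
    Integrable (fun u => ∫ y in (D * u - T)..(D * u + T), f y) μ := by
  unfold smear at hf
  have h := ((integrable_conv_iff hf.aestronglyMeasurable).mp hf).2
  rw [(measurableEmbedding_mulLeft₀ hD).integrable_map_iff] at h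
  refine h.congr (ae_of_all _ fun u => ?_)
  simp only [Function.comp, Real.norm_eq_abs, abs_of_nonneg (h0 _)]
  rw [← intervalIntegral.integral_of_le (by linarith),
    intervalIntegral.integral_comp_add_left (fun y => f y), ← sub_eq_add_neg]

/-- When `|Du| ≤ B` the shifted window contains `[-(T-B), T-B]`; otherwise the weight `1 - (Du/B)²`
is negative and the bound is trivial. This is Chebyshev's inequality in integrated form. -/
lemma integral_le_integral_smear {μ : Measure ℝ} [IsProbabilityMeasure μ] {D T B : ℝ}
    (hμ : ∀ n : ℕ, Integrable (fun t : ℝ => |t| ^ n) μ) (hD : 0 < D) (hB : 0 < B) (hBT : B ≤ T)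
    {f : ℝ → ℝ} (hc : Continuous f) (h0 : ∀ t, 0 ≤ f t) (hf : Integrable f (smear μ D T)) :
    (∫ t in -(T - B)..(T - B), f t) * (1 - (D / B) ^ 2 * ∫ u, |u| ^ 2 ∂μ)
      ≤ ∫ t, f t ∂(smear μ D T) := by
  have hT : 0 ≤ T := by linarith
  set V := ∫ t in -(T - B)..(T - B), f t with hV
  have hV0 : 0 ≤ V := intervalIntegral.integral_nonneg (by linarith) fun t _ => h0 t
  have hl : V * (1 - (D / B) ^ 2 * ∫ u, |u| ^ 2 ∂μ) = ∫ u, V * (1 - (D / B) ^ 2 * |u| ^ 2) ∂μ := by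
    rw [integral_const_mul, integral_sub (integrable_const _) ((hμ 2).const_mul _),
      integral_const_mul]
    simp
  rw [hl, integral_smear hD.ne' hT hf]
  refine integral_mono (((integrable_const _).sub ((hμ 2).const_mul _)).const_mul _)
    (integrable_integral_smear hD.ne' hT hf h0) fun u => ?_
  have hW0 : 0 ≤ ∫ y in (D * u - T)..(D * u + T), f y :=
    intervalIntegral.integral_nonneg (by linarith) fun t _ => h0 t
  simp only
  rcases le_or_gt (|D * u|) B with h | h
  · have h1 := abs_le.mp h
    calc V * (1 - (D / B) ^ 2 * |u| ^ 2) ≤ V * 1 := by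
          gcongr
          have : 0 ≤ (D / B) ^ 2 * |u| ^ 2 := by positivity
          linarith
      _ ≤ _ := by
          rw [mul_one]
          exact intervalIntegral.integral_mono_interval (by linarith) (by linarith) (by linarith)
            (ae_of_all _ h0) (hc.intervalIntegrable _ _)
  · refine le_trans (mul_nonpos_of_nonneg_of_nonpos hV0 ?_) hW0
    rw [← mul_pow, div_mul_eq_mul_div]
    have : 1 ≤ D * |u| / B := by
      rw [le_div_iff₀ hB]
      rw [abs_mul, abs_of_pos hD] at h
      linarith
    have := one_le_pow₀ this (n := 2)
    linarith

/-- When `|Du| ≤ B` the window lies in `[-(T+B), T+B]`. For larger shifts the quadratic growth of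
`f` gives order `T³`, and a Markov factor `(D|u|/B)ⁿ` of high order compensates. -/
lemma integral_smear_le_integral {μ : Measure ℝ} [IsProbabilityMeasure μ] {D T B C : ℝ}
    (hμ : ∀ n : ℕ, Integrable (fun t : ℝ => |t| ^ n) μ) (hD : 0 < D) (hDT : D ≤ T) (hT : 1 ≤ T)
    (hB : 0 < B) (n : ℕ)
    {f : ℝ → ℝ} (hc : Continuous f) (h0 : ∀ t, 0 ≤ f t) (hfC : ∀ t, f t ≤ C * (1 + |t|) ^ 2)
    (hf : Integrable f (smear μ D T)) :
    ∫ t, f t ∂(smear μ D T) ≤ (∫ t in -(T + B)..(T + B), f t)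
      + 2 * C * T ^ 3 * (D / B) ^ n * ∫ u, (2 + |u|) ^ 2 * |u| ^ n ∂μ := by
  have hT0 : 0 ≤ T := by linarith
  have hC : 0 ≤ C := by simpa using (h0 0).trans (hfC 0)
  set V := ∫ t in -(T + B)..(T + B), f t with hV
  have hV0 : 0 ≤ V := intervalIntegral.integral_nonneg (by linarith) fun t _ => h0 t
  have hm : Integrable (fun u : ℝ => (2 + |u|) ^ 2 * |u| ^ n) μ := by
    have : (fun u : ℝ => (2 + |u|) ^ 2 * |u| ^ n)
        = fun u : ℝ => 4 * |u| ^ n + 4 * |u| ^ (n + 1) + |u| ^ (n + 2) := by ext u; ring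
    rw [this]
    exact (((hμ n).const_mul 4).add ((hμ (n + 1)).const_mul 4)).add (hμ (n + 2))
  have hr : V + 2 * C * T ^ 3 * (D / B) ^ n * ∫ u, (2 + |u|) ^ 2 * |u| ^ n ∂μ
      = ∫ u, V + 2 * C * T ^ 3 * (D / B) ^ n * ((2 + |u|) ^ 2 * |u| ^ n) ∂μ := by
    rw [integral_add (integrable_const _) (hm.const_mul _), integral_const_mul]
    simp
  rw [hr, integral_smear hD.ne' hT0 hf]
  refine integral_mono (integrable_integral_smear hD.ne' hT0 hf h0)
    ((integrable_const _).add (hm.const_mul _)) fun u => ?_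
  simp only
  rcases le_or_gt (|D * u|) B with h | h
  · have h1 := abs_le.mp h
    have h2 : 0 ≤ 2 * C * T ^ 3 * (D / B) ^ n * ((2 + |u|) ^ 2 * |u| ^ n) := by positivity
    have h3 : ∫ y in (D * u - T)..(D * u + T), f y ≤ V :=
      intervalIntegral.integral_mono_interval (by linarith) (by linarith) (by linarith)
        (ae_of_all _ h0) (hc.intervalIntegrable _ _)
    linarith
  · have h1 : 1 ≤ (D * |u| / B) ^ n := by
      refine one_le_pow₀ ?_
      rw [le_div_iff₀ hB]
      rw [abs_mul, abs_of_pos hD] at h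
      linarith
    have h2 : ∫ y in (D * u - T)..(D * u + T), f y
        ≤ 2 * T * (C * (1 + (|D * u| + T)) ^ 2) := by
      refine le_trans ?_ (integral_le_of_monotone_abs (φ := fun y => C * (1 + y) ^ 2)
        (by fun_prop) (fun a ha b hb h => ?_) hT0 (D * u))
      · exact intervalIntegral.integral_mono_on (by linarith) (hc.intervalIntegrable _ _)
          (Continuous.intervalIntegrable (by fun_prop) _ _) fun y _ => hfC y
      · simp only [Set.mem_Ici] at ha hb
        exact mul_le_mul_of_nonneg_left (pow_le_pow_left₀ (by linarith) (by linarith) 2) hC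
    have h3 : 1 + (|D * u| + T) ≤ T * (2 + |u|) := by
      rw [abs_mul, abs_of_pos hD]
      nlinarith [abs_nonneg u]
    calc ∫ y in (D * u - T)..(D * u + T), f y ≤ 2 * T * (C * (1 + (|D * u| + T)) ^ 2) := h2
      _ ≤ 2 * T * (C * (T * (2 + |u|)) ^ 2) := by gcongr
      _ = 2 * C * T ^ 3 * (2 + |u|) ^ 2 * 1 := by ring
      _ ≤ 2 * C * T ^ 3 * (2 + |u|) ^ 2 * (D * |u| / B) ^ n := by gcongr
      _ = 2 * C * T ^ 3 * (D / B) ^ n * ((2 + |u|) ^ 2 * |u| ^ n) := by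
          rw [div_pow, div_pow, mul_pow]; ring
      _ ≤ _ := by linarith

/-! ### The Hardy–Littlewood asymptotics -/

/-- The constant term in the mean square of `ζ(1/2 + it)`. -/
noncomputable def meanSqConst : ℝ :=
  2 * Real.eulerMascheroniConstant - Real.log (2 * Real.pi) - 1

/-- With `D = x²` and `T` of order `x⁴`, the errors `D²/T`, `T D^(-1/2)` and `T log N / D` have
orders `1`, `x³` and `x² log x`. -/
lemma exists_abs_integral_smear_sub_le {μ : Measure ℝ} [IsProbabilityMeasure μ]
    (hμ : ∀ n : ℕ, Integrable (fun t : ℝ => |t| ^ n) μ) (him : ∀ θ, (charFun μ θ).im = 0)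
    (hsupp : ∀ θ, 1 ≤ |θ| → charFun μ θ = 0) :
    ∃ C : ℝ, ∀ x T : ℝ, 2 ≤ x → x ^ 4 / 2 ≤ T → T ≤ 2 * x ^ 4 →
      |∫ t, ‖riemannZeta (1 / 2 + Complex.I * t)‖ ^ 2 ∂(smear μ (x ^ 2) T)
        - 2 * T * (Real.log T + meanSqConst)| ≤ C * (x ^ 3 * (1 + Real.log x)) := by
  set c₁ := ∫ u, |u| ∂μ with hc₁
  set c₂ := ∫ u, |u| ^ 2 ∂μ with hc₂
  set c₃ := ∫ u, (2 + |u|) ^ 2 ∂μ with hc₃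
  have h1 : 0 ≤ c₁ := integral_nonneg fun _ => abs_nonneg _
  have h2 : 0 ≤ c₂ := integral_nonneg fun _ => by positivity
  have h3 : 0 ≤ c₃ := integral_nonneg fun _ => by positivity
  refine ⟨6 * c₂ + (4 + 2 * c₁) * 2 * (20 + 14 * 33)
    + (65 * (2 * (1 + c₁) * 4 + (4 + 2 * c₁) * 2) + 250 * 8 * c₃), fun x T hx hT1 hT2 => ?_⟩
  have hx0 : 0 < x := by linarith
  have hx1 : 1 ≤ x := by linarith
  have hlx : 0 ≤ Real.log x := Real.log_nonneg hx1
  have hT0 : 0 < T := lt_of_lt_of_le (by positivity) hT1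
  have hD : 2 ≤ x ^ 2 := by nlinarith
  have hDT : x ^ 2 ≤ T := by
    linarith [mul_le_mul_of_nonneg_right hD (sq_nonneg x), show x ^ 2 * x ^ 2 = x ^ 4 by ring]
  -- The power 32 gives `N^(-1/2) ≤ x^(-16)`, which beats the factor `T³` of order `x¹²`, while `log
  -- N` stays `O(log x)`.
  set N := ⌈x⌉₊ ^ 32 with hN
  have hcx : x ≤ (⌈x⌉₊ : ℝ) := Nat.le_ceil x
  have hcx2 : (⌈x⌉₊ : ℝ) ≤ x ^ 2 := by
    have := Nat.ceil_lt_add_one hx0.le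
    nlinarith
  have hc1 : 1 ≤ ⌈x⌉₊ := Nat.one_le_ceil_iff.mpr hx0
  have hN1 : 1 ≤ N := Nat.one_le_pow _ _ hc1
  have hlogN : Real.log N ≤ 64 * Real.log x := by
    rw [hN, Nat.cast_pow, Real.log_pow]
    have := Real.log_le_log (by linarith) hcx2
    rw [Real.log_pow] at this
    push_cast at *
    linarith
  have hNp : (N : ℝ) ^ (-(1 / 2) : ℝ) ≤ 1 / x ^ 16 := by
    rw [hN, Nat.cast_pow, ← Real.rpow_natCast_mul (by positivity),
      show ((32 : ℕ) : ℝ) * -(1 / 2) = -((16 : ℕ) : ℝ) by norm_num, Real.rpow_neg (by positivity),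
      Real.rpow_natCast, one_div]
    exact inv_anti₀ (by positivity) (pow_le_pow_left₀ hx0.le hcx 16)
  have hDp : (1 / x ^ 2) ^ (1 / 2 : ℝ) = 1 / x := by
    rw [← Real.sqrt_eq_rpow, ← one_div_pow, Real.sqrt_sq (by positivity)]
  have key := abs_integral_riemannZeta_smear_sub_le hμ him hsupp hD hDT hN1
  rw [hDp, ← hc₁, ← hc₂, ← hc₃] at key
  have e : Real.log T - 1 + 2 * Real.eulerMascheroniConstant - Real.log (2 * Real.pi)
      = Real.log T + meanSqConst := by rw [meanSqConst]; ring
  rw [e] at key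
  refine key.trans ?_
  have hM1 : 1 ≤ x ^ 3 * (1 + Real.log x) := by nlinarith [one_le_pow₀ hx1 (n := 3)]
  have t1 : 3 * (x ^ 2) ^ 2 * c₂ / T ≤ 6 * c₂ := by
    rw [div_le_iff₀ hT0]
    nlinarith
  have t2 : T * (20 * (1 / x) + 14 / x ^ 2 * (1 + Real.log N))
      ≤ 2 * (20 + 14 * 33) * (x ^ 3 * (1 + Real.log x)) := by
    have hl3 : 0 ≤ x ^ 3 * Real.log x := by positivity
    have hx23 : x ^ 2 * (1 + 64 * Real.log x) ≤ x ^ 3 / 2 * (1 + 64 * Real.log x) := by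
      gcongr
      nlinarith [sq_nonneg x]
    have hx3 : 0 ≤ x ^ 3 := by positivity
    calc T * (20 * (1 / x) + 14 / x ^ 2 * (1 + Real.log N))
        ≤ 2 * x ^ 4 * (20 * (1 / x) + 14 / x ^ 2 * (1 + 64 * Real.log x)) := by gcongr
      _ = 40 * x ^ 3 + 28 * (x ^ 2 * (1 + 64 * Real.log x)) := by field_simp; ring
      _ ≤ _ := by linarith
  have t3 : (65 * (2 * (1 + c₁) * T ^ 2 + (4 + 2 * c₁) * T) + 250 * T ^ 3 * c₃)
      * (N : ℝ) ^ (-(1 / 2) : ℝ)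
      ≤ 65 * (2 * (1 + c₁) * 4 + (4 + 2 * c₁) * 2) + 250 * 8 * c₃ := by
    have hTx : T ≤ 2 * x ^ 12 := hT2.trans (by gcongr; norm_num)
    have hTx2 : T ^ 2 ≤ 4 * x ^ 12 := by
      calc T ^ 2 ≤ (2 * x ^ 4) ^ 2 := by gcongr
        _ = 4 * x ^ 8 := by ring
        _ ≤ 4 * x ^ 12 := by gcongr <;> norm_num [hx1]
    have hTx3 : T ^ 3 ≤ 8 * x ^ 12 := by
      calc T ^ 3 ≤ (2 * x ^ 4) ^ 3 := by gcongr
        _ = 8 * x ^ 12 := by ring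
    calc (65 * (2 * (1 + c₁) * T ^ 2 + (4 + 2 * c₁) * T) + 250 * T ^ 3 * c₃)
        * (N : ℝ) ^ (-(1 / 2) : ℝ)
        ≤ (65 * (2 * (1 + c₁) * (4 * x ^ 12) + (4 + 2 * c₁) * (2 * x ^ 12))
          + 250 * (8 * x ^ 12) * c₃) * (1 / x ^ 16) := by gcongr
      _ = (65 * (2 * (1 + c₁) * 4 + (4 + 2 * c₁) * 2) + 250 * 8 * c₃) * (1 / x ^ 4) := by
          field_simp
      _ ≤ (65 * (2 * (1 + c₁) * 4 + (4 + 2 * c₁) * 2) + 250 * 8 * c₃) * 1 := by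
          gcongr
          rw [div_le_one (by positivity)]
          exact one_le_pow₀ hx1
      _ = _ := mul_one _
  have t2' := mul_le_mul_of_nonneg_left t2 (by linarith : 0 ≤ 4 + 2 * c₁)
  have p1 := mul_le_mul_of_nonneg_left hM1 (by linarith : 0 ≤ 6 * c₂)
  have p3 := mul_le_mul_of_nonneg_left hM1
    (by positivity : 0 ≤ 65 * (2 * (1 + c₁) * 4 + (4 + 2 * c₁) * 2) + 250 * 8 * c₃)
  linarith

lemma tendsto_log_div_atTop : Tendsto (fun x : ℝ => Real.log x / x) atTop (𝓝 0) :=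
  Real.isLittleO_log_id_atTop.tendsto_div_nhds_zero

/-- The shift `s x³` changes `T log T / x⁴` by `O(log x / x)`, so enlarging or shrinking the
interval for the sandwich costs nothing in the limit. -/
lemma tendsto_mul_log_shift (a s : ℝ) :
    Tendsto (fun x : ℝ => 2 * (x ^ 4 + s * x ^ 3) * (Real.log (x ^ 4 + s * x ^ 3) + a) / x ^ 4
      - 8 * Real.log x) atTop (𝓝 (2 * a)) := by
  have h1 : Tendsto (fun x : ℝ => 1 + s / x) atTop (𝓝 1) := by
    simpa using (tendsto_const_nhds (x := (1 : ℝ))).add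
      (tendsto_const_nhds.div_atTop tendsto_id (a := s))
  have h2 : Tendsto (fun x : ℝ => 8 * s * (Real.log x / x)
      + 2 * (1 + s / x) * (Real.log (1 + s / x) + a)) atTop (𝓝 (2 * a)) := by
    have := (tendsto_log_div_atTop.const_mul (8 * s)).add
      ((h1.const_mul 2).mul ((h1.log one_ne_zero).add_const a))
    simpa using this
  refine h2.congr' ?_
  filter_upwards [eventually_gt_atTop 0, h1.eventually (lt_mem_nhds zero_lt_one)] with x hx hx1
  have e : x ^ 4 + s * x ^ 3 = x ^ 4 * (1 + s / x) := by field_simp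
  rw [e, Real.log_mul (by positivity) hx1.ne', Real.log_pow]
  field_simp
  push_cast
  ring

lemma tendsto_integral_smear {μ : Measure ℝ} [IsProbabilityMeasure μ]
    (hμ : ∀ n : ℕ, Integrable (fun t : ℝ => |t| ^ n) μ) (him : ∀ θ, (charFun μ θ).im = 0)
    (hsupp : ∀ θ, 1 ≤ |θ| → charFun μ θ = 0) {s : ℝ} (hs : |s| ≤ 1) :
    Tendsto (fun x : ℝ => (∫ t, ‖riemannZeta (1 / 2 + Complex.I * t)‖ ^ 2
      ∂(smear μ (x ^ 2) (x ^ 4 + s * x ^ 3))) / x ^ 4 - 8 * Real.log x)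
      atTop (𝓝 (2 * meanSqConst)) := by
  obtain ⟨C, hC⟩ := exists_abs_integral_smear_sub_le hμ him hsupp
  have h0 : Tendsto (fun x : ℝ => C * (1 / x + Real.log x / x)) atTop (𝓝 0) := by
    simpa using ((tendsto_const_nhds.div_atTop tendsto_id (a := (1 : ℝ))).add
      tendsto_log_div_atTop).const_mul C
  have h1 : Tendsto (fun x : ℝ => ((∫ t, ‖riemannZeta (1 / 2 + Complex.I * t)‖ ^ 2
      ∂(smear μ (x ^ 2) (x ^ 4 + s * x ^ 3)))
      - 2 * (x ^ 4 + s * x ^ 3) * (Real.log (x ^ 4 + s * x ^ 3) + meanSqConst)) / x ^ 4)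
      atTop (𝓝 0) := by
    refine squeeze_zero_norm' ?_ h0
    filter_upwards [eventually_ge_atTop 2] with x hx
    have hx0 : 0 < x := by linarith
    have hx3 : 0 < x ^ 3 := by positivity
    have hx4 : 2 * x ^ 3 ≤ x ^ 4 := by
      have := mul_le_mul_of_nonneg_right hx hx3.le
      linarith [show x * x ^ 3 = x ^ 4 by ring]
    have hs' := abs_le.mp hs
    have := hC x (x ^ 4 + s * x ^ 3) hx (by nlinarith) (by nlinarith)
    rw [norm_div, Real.norm_eq_abs, Real.norm_of_nonneg (by positivity),
      div_le_iff₀ (by positivity)]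
    refine this.trans_eq ?_
    field_simp
  have := h1.add (tendsto_mul_log_shift meanSqConst s)
  rw [zero_add] at this
  refine this.congr fun x => ?_
  ring

/-- Hardy--Littlewood: the mean square of `ζ(1/2 + it)` over `[-T, T]`. -/
lemma tendsto_integral_norm_riemannZeta_sq :
    Tendsto (fun x : ℝ => (∫ t in -(x ^ 4)..(x ^ 4), ‖riemannZeta (1 / 2 + Complex.I * t)‖ ^ 2)
      / x ^ 4 - 8 * Real.log x) atTop (𝓝 (2 * meanSqConst)) := by
  obtain ⟨μ, hμp, hμ, him, hsupp⟩ := exists_probabilityMeasure_charFun_eq_zero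
  have hZc : Continuous fun t : ℝ => ‖riemannZeta (1 / 2 + Complex.I * t)‖ ^ 2 :=
    continuous_riemannZeta_line.norm.pow 2
  have hZ0 : ∀ t : ℝ, 0 ≤ ‖riemannZeta (1 / 2 + Complex.I * t)‖ ^ 2 := fun t => by positivity
  have hZC : ∀ t : ℝ, ‖riemannZeta (1 / 2 + Complex.I * t)‖ ^ 2 ≤ 100 * (1 + |t|) ^ 2 := fun t => by
    have := pow_le_pow_left₀ (norm_nonneg _) (norm_riemannZeta_le t) 2
    linarith
  have hZi : ∀ D T : ℝ, 0 < D → D ≤ T → 1 ≤ T →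
      Integrable (fun t : ℝ => ‖riemannZeta (1 / 2 + Complex.I * t)‖ ^ 2) (smear μ D T) :=
    fun D T hD hDT hT => integrable_norm_riemannZeta_sq (integrable_one_add_sq_smear hμ hD hDT hT).1
  set c₂ := ∫ u, |u| ^ 2 ∂μ with hc₂
  set c := ∫ u, (2 + |u|) ^ 2 * |u| ^ 12 ∂μ with hc
  have hc0 : 0 ≤ c := integral_nonneg fun _ => by positivity
  have hup := tendsto_integral_smear hμ him hsupp (s := 1) (by simp)
  have hlo := tendsto_integral_smear hμ him hsupp (s := -1) (by simp)
  set Z : ℝ → ℝ := fun t => ‖riemannZeta (1 / 2 + Complex.I * t)‖ ^ 2 with hZ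
  set U := fun x : ℝ => (∫ t, Z t ∂(smear μ (x ^ 2) (x ^ 4 + 1 * x ^ 3))) with hU
  set L := fun x : ℝ => (∫ t, Z t ∂(smear μ (x ^ 2) (x ^ 4 + -1 * x ^ 3))) with hL
  have hη : Tendsto (fun x : ℝ => 1 - c₂ / x ^ 2) atTop (𝓝 1) := by
    simpa using (tendsto_const_nhds (x := (1 : ℝ))).sub
      (tendsto_const_nhds.div_atTop (tendsto_pow_atTop (two_ne_zero)) (a := c₂))
  have hlog : Tendsto (fun x : ℝ => 8 * c₂ * (Real.log x / x * (1 / x))) atTop (𝓝 0) := by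
    simpa using (tendsto_log_div_atTop.mul
      (tendsto_const_nhds.div_atTop tendsto_id (a := (1 : ℝ)))).const_mul (8 * c₂)
  -- From `V (1 - c₂/x²) ≤ U`: dividing out the Chebyshev factor after subtracting `8 log x` leaves
  -- the correction `8 c₂ log x / x²`, which vanishes in the limit.
  have hupper : Tendsto (fun x : ℝ => ((U x / x ^ 4 - 8 * Real.log x)
      + 8 * c₂ * (Real.log x / x * (1 / x))) / (1 - c₂ / x ^ 2)) atTop (𝓝 (2 * meanSqConst)) := by
    have := (hup.add hlog).div hη one_ne_zero
    rwa [add_zero, div_one] at this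
  have hlower : Tendsto (fun x : ℝ => (L x / x ^ 4 - 8 * Real.log x) - 200 * c / x ^ 4) atTop
      (𝓝 (2 * meanSqConst)) := by
    have := hlo.sub
      (tendsto_const_nhds.div_atTop (tendsto_pow_atTop (four_ne_zero)) (a := 200 * c))
    rwa [sub_zero] at this
  refine tendsto_of_tendsto_of_tendsto_of_le_of_le' hlower hupper ?_ ?_
  · filter_upwards [eventually_ge_atTop 2] with x hx
    have hx0 : 0 < x := by linarith
    have hx2 : 4 ≤ x ^ 2 := by nlinarith
    have hx24 : 4 * x ^ 2 ≤ x ^ 4 := by nlinarith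
    have hx34 : 2 * x ^ 3 ≤ x ^ 4 := by
      have := mul_le_mul_of_nonneg_right hx (pow_pos hx0 3).le
      linarith [show x * x ^ 3 = x ^ 4 by ring]
    have hT1 : x ^ 2 ≤ x ^ 4 + -1 * x ^ 3 := by linarith
    -- Order 12 is chosen so that `(D/B)¹² = x^(-12)` offsets `T³ ≤ x¹²`.
    have := integral_smear_le_integral hμ (by positivity : 0 < x ^ 2) hT1 (by linarith)
      (by positivity : 0 < x ^ 3) 12 hZc hZ0 hZC
      (hZi _ _ (by positivity) hT1 (by linarith))
    rw [show x ^ 4 + -1 * x ^ 3 + x ^ 3 = x ^ 4 by ring, ← hc] at this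
    have h3 : 2 * 100 * (x ^ 4 + -1 * x ^ 3) ^ 3 * (x ^ 2 / x ^ 3) ^ 12 * c ≤ 200 * c := by
      have hle : x ^ 4 + -1 * x ^ 3 ≤ x ^ 4 := by linarith [pow_pos hx0 3]
      calc 2 * 100 * (x ^ 4 + -1 * x ^ 3) ^ 3 * (x ^ 2 / x ^ 3) ^ 12 * c
          ≤ 2 * 100 * (x ^ 4) ^ 3 * (x ^ 2 / x ^ 3) ^ 12 * c := by
            have : 0 ≤ x ^ 4 + -1 * x ^ 3 := by linarith
            gcongr
        _ = 200 * c := by field_simp; ring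
    have h4 : L x ≤ (∫ t in -(x ^ 4)..(x ^ 4), Z t) + 200 * c := by
      simp only [hL]; linarith
    have := div_le_div_of_nonneg_right h4 (by positivity : 0 ≤ x ^ 4)
    rw [add_div] at this
    linarith
  · filter_upwards [eventually_ge_atTop 2, hη.eventually (lt_mem_nhds zero_lt_one)] with x hx hη0
    have hx0 : 0 < x := by linarith
    have hx3 : 0 < x ^ 3 := by positivity
    have hx2 : 4 ≤ x ^ 2 := by nlinarith
    have hx24 : 4 * x ^ 2 ≤ x ^ 4 := by nlinarith
    have hT1 : x ^ 2 ≤ x ^ 4 + 1 * x ^ 3 := by linarith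
    have := integral_le_integral_smear hμ (by positivity : 0 < x ^ 2) hx3
      (by linarith : x ^ 3 ≤ x ^ 4 + 1 * x ^ 3) hZc hZ0
      (hZi _ _ (by positivity) hT1 (by linarith))
    rw [show x ^ 4 + 1 * x ^ 3 - x ^ 3 = x ^ 4 by ring, ← hc₂,
      show (x ^ 2 / x ^ 3) ^ 2 * c₂ = c₂ / x ^ 2 by field_simp] at this
    rw [le_div_iff₀ hη0]
    have h5 := div_le_div_of_nonneg_right this (by positivity : 0 ≤ x ^ 4)
    rw [mul_div_right_comm] at h5
    have e : 8 * c₂ * (Real.log x / x * (1 / x)) = 8 * Real.log x * (c₂ / x ^ 2) := by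
      field_simp
    rw [e]
    simp only [hU]
    linarith

lemma norm_riemannZeta_line_neg (t : ℝ) :
    ‖riemannZeta (1 / 2 + Complex.I * (-t : ℝ))‖ = ‖riemannZeta (1 / 2 + Complex.I * t)‖ := by
  rw [← Complex.norm_conj, ← riemannZeta_conj]
  congr 2
  simp [Complex.conj_ofNat]

/-- Hardy--Littlewood: `∫₀ᵀ (log t - |ζ(1/2 + it)|²) dt ~ (log 2π - 2γ) T`. -/
lemma tendsto_integral_logModZeta :
    Tendsto (fun T : ℝ => (∫ t in (0 : ℝ)..T, logModZeta t) / T) atTop (𝓝 logModConst) := by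
  have hZc : Continuous fun t : ℝ => ‖riemannZeta (1 / 2 + Complex.I * t)‖ ^ 2 :=
    continuous_riemannZeta_line.norm.pow 2
  have h1 := tendsto_integral_norm_riemannZeta_sq.comp
    (tendsto_rpow_atTop (y := 1 / 4) (by norm_num))
  have h2 := ((h1.const_mul (-(1 / 2))).sub_const 1)
  have h3 : -(1 / 2) * (2 * meanSqConst) - 1 = logModConst := by
    rw [meanSqConst, logModConst]; ring
  rw [h3] at h2
  refine h2.congr' ?_
  filter_upwards [eventually_gt_atTop 0] with T hT
  simp only [Function.comp]
  have e4 : (T ^ (1 / 4 : ℝ)) ^ 4 = T := by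
    rw [← Real.rpow_mul_natCast hT.le]; norm_num
  rw [e4, Real.log_rpow hT]
  have heven : ∫ t in -T..T, ‖riemannZeta (1 / 2 + Complex.I * t)‖ ^ 2
      = 2 * ∫ t in (0 : ℝ)..T, ‖riemannZeta (1 / 2 + Complex.I * t)‖ ^ 2 := by
    rw [← intervalIntegral.integral_add_adjacent_intervals (hZc.intervalIntegrable (-T) 0)
      (hZc.intervalIntegrable 0 T)]
    have := intervalIntegral.integral_comp_neg (a := 0) (b := T)
      fun t : ℝ => ‖riemannZeta (1 / 2 + Complex.I * t)‖ ^ 2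
    rw [neg_zero] at this
    rw [← this]
    simp only [norm_riemannZeta_line_neg]
    ring
  have hlog : ∫ t in (0 : ℝ)..T, logModZeta t
      = T * Real.log T - T - ∫ t in (0 : ℝ)..T, ‖riemannZeta (1 / 2 + Complex.I * t)‖ ^ 2 := by
    simp only [logModZeta]
    rw [intervalIntegral.integral_sub intervalIntegral.intervalIntegrable_log'
      (hZc.intervalIntegrable _ _), integral_log]
    simp
  rw [heven, hlog]
  field_simp
  ring

/-! ### The limit for Fermat rationals -/

/-- From `γ < 2/3` it suffices that `log 2π > 4/3`, that is `e⁴ < (2π)³`. Positivity ensures that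
the integration endpoints tend to `+∞` with `τ`. -/
lemma logModConst_pos : 0 < logModConst := by
  have h1 := Real.eulerMascheroniConstant_lt_two_thirds
  have h2 : 4 < 3 * Real.log (2 * Real.pi) := by
    have h3 : Real.exp 4 < (2 * Real.pi) ^ 3 := by
      have e : Real.exp 4 = Real.exp 1 ^ 4 := by rw [← Real.exp_nat_mul]; norm_num
      rw [e]
      calc Real.exp 1 ^ 4 < 3 ^ 4 := by
            gcongr
            exact Real.exp_one_lt_d9.trans (by norm_num)
        _ < (2 * 3) ^ 3 := by norm_num
        _ < (2 * Real.pi) ^ 3 := by gcongr; exact Real.pi_gt_three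
    have := Real.log_lt_log (Real.exp_pos 4) h3
    rw [Real.log_exp, Real.log_pow] at this
    exact_mod_cast this
  rw [logModConst]
  linarith

lemma tendsto_logModMean (N : ℕ) {q : ℝ} (hq : 0 < q) :
    Tendsto (fun τ : ℝ => logModMean N q τ) atTop (𝓝 (N * q)) := by
  have hc := logModConst_pos
  have hZ : ∀ a b, IntervalIntegrable logModZeta volume a b := fun a b =>
    intervalIntegral.intervalIntegrable_log'.sub
      ((continuous_riemannZeta_line.norm.pow 2).intervalIntegrable _ _)
  have key : ∀ a : ℝ, 0 < a → Tendsto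
      (fun τ : ℝ => (∫ t in (0 : ℝ)..(a * (τ / logModConst)), logModZeta t) / τ) atTop (𝓝 a) := by
    intro a ha
    have h1 : Tendsto (fun τ : ℝ => a * (τ / logModConst)) atTop atTop :=
      (tendsto_id.atTop_div_const hc).const_mul_atTop ha
    have h2 := (tendsto_integral_logModZeta.comp h1).const_mul (a / logModConst)
    rw [div_mul_cancel₀ _ hc.ne'] at h2
    refine h2.congr' ?_
    filter_upwards [eventually_gt_atTop 0] with τ hτ
    simp only [Function.comp]
    field_simp
  have h := (key (((N : ℝ) + 1) * q) (by positivity)).sub (key q hq)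
  rw [show ((N : ℝ) + 1) * q - q = N * q by ring] at h
  refine h.congr fun τ => ?_
  rw [logModMean, ← sub_div, intervalIntegral.integral_interval_sub_left (hZ _ _) (hZ _ _)]
  ring

lemma fermatRational_pos {x y z n : ℕ} (hx : 1 ≤ x) (hz : 1 ≤ z) : 0 < fermatRational x y z n := by
  have hx' : (0 : ℝ) < x := by exact_mod_cast hx
  have hz' : (0 : ℝ) < z := by exact_mod_cast hz
  unfold fermatRational
  positivity

lemma fermatRational_eq_one_iff {x y z n : ℕ} (hz : 1 ≤ z) :
    fermatRational x y z n = 1 ↔ x ^ n + y ^ n = z ^ n := by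
  have hz' : (0 : ℝ) < z := by exact_mod_cast hz
  rw [fermatRational, div_eq_one_iff_eq (by positivity)]
  exact_mod_cast Iff.rfl

/-- For every fixed positive integer `N`: the limit exists and equals `N q` for every Fermat
rational `q`, and the condition that the limit differs from `N` for all Fermat rationals is
equivalent to the Fermat-Wiles theorem. -/
theorem theorem4 (N : ℕ) (hN : 1 ≤ N) :
    (∀ x y z n : ℕ, 1 ≤ x → 1 ≤ y → 1 ≤ z → 3 ≤ n →
      Tendsto (fun τ : ℝ => logModMean N (fermatRational x y z n) τ) atTop
        (𝓝 ((N : ℝ) * fermatRational x y z n))) ∧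
    ((∀ x y z n : ℕ, 1 ≤ x → 1 ≤ y → 1 ≤ z → 3 ≤ n →
      ∃ L : ℝ, Tendsto (fun τ : ℝ => logModMean N (fermatRational x y z n) τ) atTop (𝓝 L) ∧
        L ≠ (N : ℝ)) ↔ FermatLastTheorem) := by
  have hlim : ∀ x y z n : ℕ, 1 ≤ x → 1 ≤ y → 1 ≤ z → 3 ≤ n →
      Tendsto (fun τ : ℝ => logModMean N (fermatRational x y z n) τ) atTop
        (𝓝 ((N : ℝ) * fermatRational x y z n)) := fun x y z n hx _ hz _ =>
    tendsto_logModMean N (fermatRational_pos hx hz)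
  have hN0 : (N : ℝ) ≠ 0 := by exact_mod_cast Nat.one_le_iff_ne_zero.mp hN
  refine ⟨hlim, fun h n hn x y z hx hy hz he => ?_, fun h x y z n hx hy hz hn => ?_⟩
  · have hx' := Nat.one_le_iff_ne_zero.mpr hx
    have hy' := Nat.one_le_iff_ne_zero.mpr hy
    have hz' := Nat.one_le_iff_ne_zero.mpr hz
    obtain ⟨L, hL, hne⟩ := h x y z n hx' hy' hz' hn
    -- A solution of the Fermat equation gives `q = 1`, so the limit would be `N` itself.
    refine hne (tendsto_nhds_unique hL ?_)
    simpa [(fermatRational_eq_one_iff hz').mpr he] using hlim x y z n hx' hy' hz' hn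
  · refine ⟨_, hlim x y z n hx hy hz hn, fun he => ?_⟩
    exact h n hn x y z (by omega) (by omega) (by omega)
      ((fermatRational_eq_one_iff hz).mp (mul_left_cancel₀ hN0 (he.trans (mul_one _).symm)))
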